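/- **Conventions.** Let $t=(t_1,t_2,\dots)$ and $R=\mathbb C[[t_1,t_2,\dots]]$; all functions of $t$ are formal power series (elements of $R$), $z$ is a formal variable, $\oint f(z)\frac{dz}{2\pi i}$ is the coefficient of $z^{-1}$, $[z]=(z,\frac{z^2}{2},\frac{z^3}{3},\dots)$, $\tilde\partial=(\frac{\partial}{\partial t_1},\frac12\frac{\partial}{\partial t_2},\frac13\frac{\partial}{\partial t_3},\dots)$, $S_2(x)=x_2+\frac12x_1^2$, and ${}^{\textstyle\cdot}=\partial/\partial t_1$. Matrices have entries in $R$ and are indexed by $\mathbb N=\{0,1,\dots\}$ (semi-infinite) or by $\mathbb Z$ (bi-infinite); $\Lambda_{i,i+1}=1$ is the shift matrix (other entries $0$), $\chi(z)=(z^i)_i$, $J$ is block diagonal with $2\times2$ blocks $\begin{pmatrix}0&1\\-1&0\end{pmatrix}$, and $\mathcal J(a)=Ja^\top J$. In $2\times 2$ blocks write $a=a_-+a_0+a_+$ (strictly lower, diagonal and strictly upper block parts) and put $\pi_{\mathbf k}a=(a_--\mathcal J a_+)+\frac12(a_0-\mathcal J a_0)$. Let $\mathcal G_{\mathbf k}$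 be the group of lower-triangular matrices whose diagonal $2\times 2$ blocks are $c_{2n}I$ with $c_{2n}\in R$ invertible. For $Q\in\mathcal G_{\mathbf k}$ with diagonal blocks $c_{2n}I$ and inverse $Q^{-1}\in\mathcal G_{\mathbf k}$, put $L=Q\Lambda Q^{-1}$, $Q_2=JQ^{\top-1}$, and $$\Psi_1(t,z)=e^{\sum t_kz^k}Q\chi(z),\qquad \Psi_2(t,z)=e^{-\sum t_kz^{-k}}Q_2\chi(z),$$ $$\Psi_{1,2n}=e^{\sum t_kz^k}z^{2n}c_{2n}\,\psi_{1,2n},\qquad \Psi_{2,2n}=e^{-\sum t_kz^{-k}}z^{2n+1}c_{2n}^{-1}\,\psi_{2,2n}.$$ **Theorem.** Let $Q\in\mathcal G_{\mathbf k}$ be a solution of the Pfaff lattice, in one of the following two senses: (a) (semi-infinite) $m=Q^{-1}JQ^{\top-1}$ is the skew-Borel decomposition of a semi-infinite skew-symmetric matrix $m(t)$ with $\frac{\partial m}{\partial t_k}=\Lambda^km+m\Lambda^{\top k}$ for all $k\ge1$; or (b) (bi-infinite) $\frac{\partial Q}{\partial t_k}=-(\pi_{\mathbf k}L^k)\,Q$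 for all $k\ge1$. Then there are series $\tau_{2n}(t)\in R$ with non-zero constant term, and square roots $\sqrt{\tau_{2n}\tau_{2n+2}}\in R$ ($n\in\mathbb N$ in case (a), $n\in\mathbb Z$ in case (b)), such that for all $n$ (and $m$) in that range the following hold. 1. $\displaystyle\psi_{1,2n}(t,z)=\frac{\tau_{2n}(t-[z^{-1}])}{\tau_{2n}(t)}$ and $\displaystyle\psi_{2,2n}(t,z)=\frac{\tau_{2n+2}(t+[z])}{\tau_{2n+2}(t)}$. 2. The wave functions are $$\Psi_{1,2n}=e^{\sum t_iz^i}z^{2n}\frac{\tau_{2n}(t-[z^{-1}])}{\sqrt{\tau_{2n}\tau_{2n+2}}},\qquad \Psi_{1,2n+1}=e^{\sum t_iz^i}z^{2n}\frac{(z+\frac{\partial}{\partial t_1})\tau_{2n}(t-[z^{-1}])}{\sqrt{\tau_{2n}\tau_{2n+2}}},$$ $$\Psi_{2,2n}=e^{-\sum t_iz^{-i}}z^{2n+1}\frac{\tau_{2n+2}(t+[z])}{\sqrt{\tau_{2n}\tau_{2n+2}}},\qquad \Psi_{2,2n+1}=e^{-\sum t_iz^{-i}}z^{2n+1}\frac{(-z^{-1}+\frac{\partial}{\partial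 t_1})\tau_{2n+2}(t+[z])}{\sqrt{\tau_{2n}\tau_{2n+2}}}.$$ 3. As formal power series in the two sets of variables $t,t'$, $$\oint_{z=\infty}\tau_{2n}(t-[z^{-1}])\,\tau_{2m+2}(t'+[z^{-1}])\,e^{\sum(t_i-t_i')z^i}z^{2n-2m-2}\frac{dz}{2\pi i}+\oint_{z=0}\tau_{2n+2}(t+[z])\,\tau_{2m}(t'-[z])\,e^{\sum(t'_i-t_i)z^{-i}}z^{2n-2m}\frac{dz}{2\pi i}=0 .$$ 4. Let $h=\mathrm{diag}(\dots,h_0,h_0,h_2,h_2,\dots)$ with $h_{2n}=\tau_{2n+2}/\tau_{2n}$ and $h_{2n}^{1/2}=\sqrt{\tau_{2n}\tau_{2n+2}}/\tau_{2n}$. The $2\times2$ blocks $\hat L_{kl}$ of $h^{1/2}Lh^{-1/2}$ satisfy $$\hat L_{nn}=\begin{pmatrix}-(\log\tau_{2n})^{\textstyle\cdot}&1\\[4pt]-\frac{S_2(\tilde\partial)\tau_{2n}}{\tau_{2n}}-\frac{S_2(-\tilde\partial)\tau_{2n+2}}{\tau_{2n+2}}&(\log\tau_{2n+2})^{\textstyle\cdot}\end{pmatrix},\qquad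 \hat L_{n,n+1}=\begin{pmatrix}0&0\\1&0\end{pmatrix},$$ $\hat L_{kl}=0$ for $l>k+1$, and the upper right entry of $\hat L_{n+1,n}$ is $(\log\tau_{2n+2})^{\textstyle\cdot\textstyle\cdot}$. -/

import Mathlib

/-! Formal conventions.  The times are `t_k`, `k : ℕ+`; functions of `t` are formal power series in
the infinitely many variables `t_k` over `ℂ`.  A formal distribution in `z` is a two-sided sequence of
coefficients of the powers `z^N`, `N : ℤ`. -/

open scoped Matrix

noncomputable section

/-- Functions of the times `t = (t_1, t_2, …)`: formal power series over `ℂ`. -/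
abbrev TSeries : Type := MvPowerSeries ℕ+ ℂ

/-- Formal Laurent distributions `∑_{N ∈ ℤ} f_N z^N` whose coefficients are formal power series in
the variables `x_i`, `i : σ`. -/
abbrev ZSeries (σ : Type) : Type := ℤ → MvPowerSeries σ ℂ

/-! ### Infinite matrices, indexed by `ι = ℕ` (semi-infinite) or `ι = ℤ` (bi-infinite) -/

section InfMatrix

variable {ι : Type}

/-- Product of infinite matrices.  It is used only where each entry is a sum with finitely many
nonzero terms. -/
def infMul (A B : Matrix ι ι TSeries) : Matrix ι ι TSeries :=
  fun i j => ∑ᶠ k, A i k * B k j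

infixl:70 " ⊡ " => infMul

/-- Powers for the product `⊡`. -/
def infPow [DecidableEq ι] (A : Matrix ι ι TSeries) : ℕ → Matrix ι ι TSeries
  | 0 => 1
  | k + 1 => infPow A k ⊡ A

/-- The derivative `∂/∂t_k`, applied to every entry of a matrix. -/
def dMat (k : ℕ+) (A : Matrix ι ι TSeries) : Matrix ι ι TSeries :=
  A.map (MvPowerSeries.pderiv ℂ k)

variable [CommSemiring ι] [LinearOrder ι] [Div ι] [Algebra ι ℤ]

/-- The shift matrix: `Λ_{i,i+1} = 1`, all other entries `0`. -/
def shiftMat : Matrix ι ι TSeries :=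
  fun i j => if j = i + 1 then 1 else 0

open Classical in
/-- The skew-symmetric matrix `J`, block diagonal with `2 × 2` diagonal blocks `(0 1; -1 0)`. -/
def skewJ : Matrix ι ι TSeries :=
  fun i j => if Even i ∧ j = i + 1 then 1 else if Even j ∧ i = j + 1 then -1 else 0

/-- The involution `𝒥(a) = J aᵀ J`. -/
def calJ (A : Matrix ι ι TSeries) : Matrix ι ι TSeries :=
  skewJ ⊡ Aᵀ ⊡ skewJ

/-! For the decomposition into `2 × 2` blocks, the row or column `i` lies in the block `i / 2`
(floor division). -/

/-- The part `a_+` strictly above the block diagonal. -/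
def upperPart (A : Matrix ι ι TSeries) : Matrix ι ι TSeries :=
  fun i j => if i / 2 < j / 2 then A i j else 0

/-- The block diagonal part `a_0`. -/
def diagPart (A : Matrix ι ι TSeries) : Matrix ι ι TSeries :=
  fun i j => if i / 2 = j / 2 then A i j else 0

/-- The part `a_-` strictly below the block diagonal. -/
def lowerPart (A : Matrix ι ι TSeries) : Matrix ι ι TSeries :=
  fun i j => if j / 2 < i / 2 then A i j else 0

/-- The projection `π_𝐤 a = (a_- - 𝒥 a_+) + ½ (a_0 - 𝒥 a_0)` along `𝐧 = sp(∞)`. -/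
def projK (A : Matrix ι ι TSeries) : Matrix ι ι TSeries :=
  (lowerPart A - calJ (upperPart A)) + (1 / 2 : ℂ) • (diagPart A - calJ (diagPart A))

/-- The group `𝒢_𝐤`: lower-triangular matrices whose `2 × 2` diagonal blocks are `c_{2n} I` with
`c_{2n}` invertible. -/
structure InGk (Q : Matrix ι ι TSeries) : Prop where
  lower : ∀ i j, i < j → Q i j = 0
  offdiag : ∀ n, Q (2 * n + 1) (2 * n) = 0
  diag_eq : ∀ n, Q (2 * n + 1) (2 * n + 1) = Q (2 * n) (2 * n)
  diag_unit : ∀ n, IsUnit (Q (2 * n) (2 * n))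

/-- `P = Q⁻¹` in the group `𝒢_𝐤`. -/
structure IsGkInverse (Q P : Matrix ι ι TSeries) : Prop where
  mem : InGk P
  mul_inv : Q ⊡ P = 1
  inv_mul : P ⊡ Q = 1

/-- `L = Q Λ Q⁻¹`, where `P = Q⁻¹`. -/
def laxL (Q P : Matrix ι ι TSeries) : Matrix ι ι TSeries :=
  Q ⊡ shiftMat ⊡ P

/-- The diagonal matrix `diag(…, g_0, g_0, g_1, g_1, …)`. -/
def blockDiag (g : ι → TSeries) : Matrix ι ι TSeries :=
  Matrix.diagonal fun i => g (i / 2)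

/-- `(A χ(z))_i = ∑_a A_{i a} z^a`, where `χ(z) = (z^a)_a`. -/
def rowZ (A : Matrix ι ι TSeries) (i : ι) : ZSeries ℕ+ :=
  fun N => ∑ᶠ a : ι, if algebraMap ι ℤ a = N then A i a else 0

end InfMatrix

/-! ### Formal calculus in `z` -/

section FormalZ

variable {σ : Type}

/-- Multiplication by `z^a`. -/
def zMul (a : ℤ) (f : ZSeries σ) : ZSeries σ := fun N => f (N - a)

/-- Multiplication of every coefficient by a series not depending on `z`. -/
def tMul (c : MvPowerSeries σ ℂ) (f : ZSeries σ) : ZSeries σ := fun N => c * f N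

/-- The derivative `∂/∂t_1` of every coefficient. -/
def zDeriv (f : ZSeries ℕ+) : ZSeries ℕ+ := fun N => MvPowerSeries.pderiv ℂ 1 (f N)

/-- The formal residue `∮ f(z) dz/(2πi)`: the coefficient of `z^{-1}`. -/
def residue (f : ZSeries σ) : MvPowerSeries σ ℂ := f (-1)

/-- Multiplication by `exp(∑_i v_i x_i z^{w_i}) = ∑_d (∏_i v_i^{d_i} / d_i!) x^d z^{∑_i d_i w_i}`. -/
def expMul [DecidableEq σ] (v : σ → ℂ) (w : σ → ℤ) (f : ZSeries σ) : ZSeries σ :=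
  fun N d => ∑ p ∈ Finset.HasAntidiagonal.antidiagonal d,
    (p.1.prod fun i k => v i ^ k / (k.factorial : ℂ)) *
      MvPowerSeries.coeff p.2 (f (N - p.1.sum fun i k => (k : ℤ) * w i))

/-- Multiplication by `e^{∑ t_k z^k}`. -/
def expPlus : ZSeries ℕ+ → ZSeries ℕ+ := expMul (fun _ => 1) (fun k => (k : ℤ))

/-- Multiplication by `e^{-∑ t_k z^{-k}}`. -/
def expMinus : ZSeries ℕ+ → ZSeries ℕ+ := expMul (fun _ => -1) (fun k => -(k : ℤ))

/-- In series in the variables `x_i` (`some i`) and `u` (`none`), put `u = z`. -/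
def evalZ (F : MvPowerSeries (Option σ) ℂ) : ZSeries σ :=
  fun N => if 0 ≤ N then (fun d => MvPowerSeries.coeff (d.optionElim N.toNat) F) else 0

/-- In series in the variables `x_i` (`some i`) and `u` (`none`), put `u = z^{-1}`. -/
def evalZinv (F : MvPowerSeries (Option σ) ℂ) : ZSeries σ := fun N => evalZ F (-N)

/-- The substituted values `x_k + s u^k / k`, with `u` the extra variable `none`. -/
def miwaPoint (s : ℂ) (x : ℕ+ → σ) : ℕ+ → MvPowerSeries (Option σ) ℂ :=
  fun k => MvPowerSeries.X (some (x k)) +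
    MvPowerSeries.C (s / (k : ℂ)) * MvPowerSeries.X none ^ (k : ℕ)

/-- The substitution `t_k ↦ x_k + s u^k / k` is admissible for all formal power series. -/
theorem miwaPoint_hasSubst (s : ℂ) {x : ℕ+ → σ} (hx : Function.Injective x) :
    MvPowerSeries.HasSubst (miwaPoint s x) where
  const_coeff k := by
    simp [miwaPoint]
  coeff_zero d := by
    classical
    have h1 : {k : ℕ+ | d = Finsupp.single (some (x k)) 1}.Finite := by
      apply Set.Subsingleton.finite
      intro a ha b hb
      have h : Finsupp.single (some (x a)) 1 = Finsupp.single (some (x b)) (1 : ℕ) :=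
        ha.symm.trans hb
      have := (Finsupp.single_left_inj (one_ne_zero)).1 h
      exact hx (Option.some_injective _ this)
    have h2 : {k : ℕ+ | d = Finsupp.single none (k : ℕ)}.Finite := by
      apply Set.Subsingleton.finite
      intro a ha b hb
      have h : Finsupp.single (none : Option σ) (a : ℕ) = Finsupp.single none (b : ℕ) :=
        ha.symm.trans hb
      exact PNat.coe_injective (Finsupp.single_injective _ h)
    refine (h1.union h2).subset ?_
    intro k hk
    by_contra hcon
    simp only [Set.mem_union, Set.mem_ofPred_eq, not_or] at hcon
    apply hk
    simp [miwaPoint, MvPowerSeries.coeff_X, MvPowerSeries.coeff_X_pow, hcon.1, hcon.2]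

/-- `f(x + s [u])`, where `[u] = (u, u²/2, u³/3, …)`: substitute `t_k ↦ x_k + s u^k / k`. -/
def miwa (s : ℂ) (x : ℕ+ → σ) (f : TSeries) : MvPowerSeries (Option σ) ℂ :=
  MvPowerSeries.subst (miwaPoint s x) f

/-- `f(t - [z⁻¹])`. -/
def shiftMinus (f : TSeries) : ZSeries ℕ+ := evalZinv (miwa (-1) id f)

/-- `f(t + [z])`. -/
def shiftPlus (f : TSeries) : ZSeries ℕ+ := evalZ (miwa 1 id f)

end FormalZ

/-- `∂f/∂t_1`. -/
def dOne (f : TSeries) : TSeries := MvPowerSeries.pderiv ℂ 1 f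

/-- `∂(log f)/∂t_1`, for `f` invertible. -/
def dLog (f : TSeries) : TSeries := f⁻¹ * dOne f

/-- `S_2(s ∂̃) f` for `s = ±1`, where `S_2(x) = x_2 + x_1²/2` and
`∂̃ = (∂/∂t_1, ½ ∂/∂t_2, ⅓ ∂/∂t_3, …)`. -/
def schurTwo (s : ℂ) (f : TSeries) : TSeries :=
  (s / 2) • MvPowerSeries.pderiv ℂ 2 f + (s ^ 2 / 2) • dOne (dOne f)

/-! ### Wave functions and Pfaffian `τ`-functions -/

section Wave

variable {ι : Type} [CommSemiring ι] [LinearOrder ι] [Div ι] [Algebra ι ℤ]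

/-- `Q_2 = J Qᵀ⁻¹`, where `P = Q⁻¹`. -/
def secondQ (P : Matrix ι ι TSeries) : Matrix ι ι TSeries := skewJ ⊡ Pᵀ

/-- `Ψ_{1,i}(t,z) = e^{∑ t_k z^k} (Q χ(z))_i`. -/
def Psi1 (Q : Matrix ι ι TSeries) (i : ι) : ZSeries ℕ+ := expPlus (rowZ Q i)

/-- `Ψ_{2,i}(t,z) = e^{-∑ t_k z^{-k}} (Q_2 χ(z))_i`, where `P = Q⁻¹`. -/
def Psi2 (P : Matrix ι ι TSeries) (i : ι) : ZSeries ℕ+ := expMinus (rowZ (secondQ P) i)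

/-- `ψ_{1,2n} = c_{2n}^{-1} z^{-2n} (Q χ(z))_{2n}`, that is,
`Ψ_{1,2n} = e^{∑ t_k z^k} z^{2n} c_{2n} ψ_{1,2n}`. -/
def psi1Even (Q : Matrix ι ι TSeries) (n : ι) : ZSeries ℕ+ :=
  tMul (Q (2 * n) (2 * n))⁻¹ (zMul (-(2 * algebraMap ι ℤ n)) (rowZ Q (2 * n)))

/-- `ψ_{2,2n} = c_{2n} z^{-2n-1} (Q_2 χ(z))_{2n}`, that is,
`Ψ_{2,2n} = e^{-∑ t_k z^{-k}} z^{2n+1} c_{2n}^{-1} ψ_{2,2n}`. -/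
def psi2Even (Q P : Matrix ι ι TSeries) (n : ι) : ZSeries ℕ+ :=
  tMul (Q (2 * n) (2 * n)) (zMul (-(2 * algebraMap ι ℤ n + 1)) (rowZ (secondQ P) (2 * n)))

/-- The matrix `h^{1/2} L h^{-1/2}`, where `h = diag(…, h_0, h_0, h_2, h_2, …)`,
`h_{2n} = τ_{2n+2}/τ_{2n}`, `τ n` stands for `τ_{2n}`, `r n` for the root `√(τ_{2n} τ_{2n+2})`,
and `h_{2n}^{1/2} = √(τ_{2n} τ_{2n+2}) / τ_{2n}`. -/
def hatL (Q P : Matrix ι ι TSeries) (τ r : ι → TSeries) : Matrix ι ι TSeries :=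
  blockDiag (fun n => r n * (τ n)⁻¹) ⊡ laxL Q P ⊡ blockDiag (fun n => (r n * (τ n)⁻¹)⁻¹)

/-- The bilinear expression
`∮_{z=∞} τ_{2n}(t-[z⁻¹]) τ_{2m+2}(t'+[z⁻¹]) e^{∑(t_i-t'_i) z^i} z^{2n-2m-2} dz/(2πi)
 + ∮_{z=0} τ_{2n+2}(t+[z]) τ_{2m}(t'-[z]) e^{∑(t'_i-t_i) z^{-i}} z^{2n-2m} dz/(2πi)`,
a formal power series in the two sets of variables `t` (`Sum.inl`) and `t'` (`Sum.inr`). -/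
def bilinear (τ : ι → TSeries) (n m : ι) : MvPowerSeries (ℕ+ ⊕ ℕ+) ℂ :=
  residue (expMul (Sum.elim (fun _ => 1) fun _ => -1)
      (Sum.elim (fun k : ℕ+ => (k : ℤ)) fun k : ℕ+ => (k : ℤ))
      (zMul (2 * algebraMap ι ℤ n - 2 * algebraMap ι ℤ m - 2)
        (evalZinv (miwa (-1) Sum.inl (τ n) * miwa 1 Sum.inr (τ (m + 1)))))) +
  residue (expMul (Sum.elim (fun _ => -1) fun _ => 1)
      (Sum.elim (fun k : ℕ+ => -(k : ℤ)) fun k : ℕ+ => -(k : ℤ))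
      (zMul (2 * algebraMap ι ℤ n - 2 * algebraMap ι ℤ m)
        (evalZ (miwa 1 Sum.inl (τ (n + 1)) * miwa (-1) Sum.inr (τ m)))))

/-- `τ n`, standing for `τ_{2n}(t)`, are Pfaffian `τ`-functions of the solution `Q` (with
`P = Q⁻¹`), and `r n` are the square roots `√(τ_{2n} τ_{2n+2})` that occur in the formulas. -/
structure IsPfaffTau (Q P : Matrix ι ι TSeries) (τ r : ι → TSeries) : Prop where
  /-- All divisions by `τ_{2n}` below are by invertible series. -/
  tau_ne : ∀ n, MvPowerSeries.constantCoeff (τ n) ≠ 0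
  root_sq : ∀ n, r n ^ 2 = τ n * τ (n + 1)
  psi1_even : ∀ n, psi1Even Q n = tMul (τ n)⁻¹ (shiftMinus (τ n))
  psi2_even : ∀ n, psi2Even Q P n = tMul (τ (n + 1))⁻¹ (shiftPlus (τ (n + 1)))
  wave1_even : ∀ n, Psi1 Q (2 * n) =
    expPlus (zMul (2 * algebraMap ι ℤ n) (tMul (r n)⁻¹ (shiftMinus (τ n))))
  wave1_odd : ∀ n, Psi1 Q (2 * n + 1) =
    expPlus (zMul (2 * algebraMap ι ℤ n) (tMul (r n)⁻¹
      (zMul 1 (shiftMinus (τ n)) + zDeriv (shiftMinus (τ n)))))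
  wave2_even : ∀ n, Psi2 P (2 * n) =
    expMinus (zMul (2 * algebraMap ι ℤ n + 1) (tMul (r n)⁻¹ (shiftPlus (τ (n + 1)))))
  wave2_odd : ∀ n, Psi2 P (2 * n + 1) =
    expMinus (zMul (2 * algebraMap ι ℤ n + 1) (tMul (r n)⁻¹
      (-zMul (-1) (shiftPlus (τ (n + 1))) + zDeriv (shiftPlus (τ (n + 1))))))
  bilinear_eq : ∀ n m, bilinear τ n m = 0
  /-- The diagonal blocks of `h^{1/2} L h^{-1/2}`. -/
  block_diag : ∀ n,
    hatL Q P τ r (2 * n) (2 * n) = -dLog (τ n) ∧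
    hatL Q P τ r (2 * n) (2 * n + 1) = 1 ∧
    hatL Q P τ r (2 * n + 1) (2 * n) =
      -(schurTwo 1 (τ n) * (τ n)⁻¹) - schurTwo (-1) (τ (n + 1)) * (τ (n + 1))⁻¹ ∧
    hatL Q P τ r (2 * n + 1) (2 * n + 1) = dLog (τ (n + 1))
  /-- The blocks just above the diagonal. -/
  block_upper : ∀ n,
    hatL Q P τ r (2 * n) (2 * (n + 1)) = 0 ∧
    hatL Q P τ r (2 * n) (2 * (n + 1) + 1) = 0 ∧
    hatL Q P τ r (2 * n + 1) (2 * (n + 1)) = 1 ∧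
    hatL Q P τ r (2 * n + 1) (2 * (n + 1) + 1) = 0
  /-- The blocks further above the diagonal vanish. -/
  block_zero : ∀ i j, i / 2 + 1 < j / 2 → hatL Q P τ r i j = 0
  /-- The specified entry of the blocks just below the diagonal. -/
  block_lower : ∀ n, hatL Q P τ r (2 * (n + 1)) (2 * n + 1) = dOne (dLog (τ (n + 1)))

/-- Semi-infinite Pfaff lattice: the skew-symmetric matrix `m` flows by
`∂m/∂t_k = Λ^k m + m Λᵀ^k` and has the skew-Borel decomposition `m = Q⁻¹ J Qᵀ⁻¹`, with
`Q ∈ 𝒢_𝐤` and `P = Q⁻¹`. -/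
structure IsMomentSolution (m Q P : Matrix ℕ ℕ TSeries) : Prop where
  skew : mᵀ = -m
  flow : ∀ k : ℕ+, dMat k m = infPow shiftMat k ⊡ m + m ⊡ infPow shiftMatᵀ k
  mem : InGk Q
  inv : IsGkInverse Q P
  decomp : m = P ⊡ skewJ ⊡ Pᵀ

/-- The Pfaff lattice for the dressing matrix `Q ∈ 𝒢_𝐤` (with `P = Q⁻¹`, `L = Q Λ Q⁻¹`):
`∂Q/∂t_k = -(π_𝐤 L^k) Q`. -/
structure IsPfaffSolution (Q P : Matrix ι ι TSeries) : Prop where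
  mem : InGk Q
  inv : IsGkInverse Q P
  flow : ∀ k : ℕ+, dMat k Q = -(projK (infPow (laxL Q P) k) ⊡ Q)

end Wave

end

/-!
Write the coefficients of `e^{-∑ t_k z^k} Ψ_{1,i}` and `e^{∑ t_k z^{-k}} Ψ_{2,i}`, the `i`-th rows of
`Q` and `Q_2`, as a pair `(f, f')` of sequences indexed by `ℤ`. Both kinds of solutions provide a
space `V` of such pairs (`IsWaveSpace`) that contains all the pairs of rows, is stable under the
operators `(∂_k + z^k, ∂_k - z^{-k})`, and is isotropic for the symmetric form
`⟨f, g'⟩ + ⟨f', g⟩`, where `⟨f, g⟩ = ∑_a f_a g_a`.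

* In the semi-infinite case `V` consists of the pairs `(f, f m)`: isotropy is the skew symmetry of `m`,
  and stability is the equation for `∂_k m` (`IsMomentSolution.isWaveSpace`).
* In the bi-infinite case `V` is spanned by the pairs of rows. Their pairings form the matrix `-J`,
  and the flow multiplies the rows of `Q` by the `𝒥`-invariant matrix `L^k - π_𝐤 L^k`; by
  invariance the rows of `Q_2` obey the same law (`IsPfaffSolution.isWaveSpace`).

The rest uses `V` only. Stability under the flows gives stability under the shifts of `t` by `±[x]`
(`IsWaveSpace.shiftMinus_mem`, `IsWaveSpace.shiftPlus_mem`), where the exponentials contribute the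
factors `1 - x z` and `1 / (1 - x z^{-1})` for `-[x]`, and their inverses for `[x]`. Isotropy of a row and a
shifted row then collapses to a product formula, for instance
`ψ_{1,2n+2}(t, x⁻¹) ψ_{2,2n}(t - [x], x) = 1` (`IsWaveSpace.mul_diagShift_adjacent`), and
isotropy of a row and a row shifted by `-[x] - [y]` shows that
`ψ_{1,2n}(t, x⁻¹) / ψ_{1,2n}(t - [y], x⁻¹)` is symmetric in `x` and `y`. That symmetry makes a one-form
closed, whose integral is `log τ_{2n}` (`exists_tau`). This is needed for a single `n`, since
the product formulas show that `τ_{2n+2} = c_{2n}^{-2} τ_{2n}` solves the equation for `n + 1` exactly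
when `τ_{2n}` solves the one for `n` (`IsWaveSpace.isTauFor_succ`). In the semi-infinite case
`τ_0 = 1`.

The remaining claims follow from these formulas for the even rows.

* The odd rows are the images of the even ones under `(∂_1 + z, ∂_1 - z^{-1})`, because the form is
  nondegenerate (`IsTauFamily.waveRow_odd`).
* The bilinear identity concerns a power series in `t` and `t'` all of whose derivatives have the
  same shape, with other elements of `V`; at `t = t' = 0` they vanish by isotropy
  (`IsWaveSpace.crossForm_eq_zero`).
* The entries of `L` are pairings of rows, one of them multiplied by `z`, and near the diagonal these
  have at most three terms.
-/

open MvPowerSeries (pderiv)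
open Finset.HasAntidiagonal (antidiagonal)

noncomputable section

/-! ### The Miwa shift -/

/-- A complex-valued function of a power series is finitary if it depends on finitely many
coefficients only. -/
def Finitary {σ : Type} (φ : MvPowerSeries σ ℂ → ℂ) : Prop :=
  ∃ D : Finset (σ →₀ ℕ), ∀ f g : MvPowerSeries σ ℂ,
    (∀ d ∈ D, MvPowerSeries.coeff d f = MvPowerSeries.coeff d g) → φ f = φ g

/-- Two finitary functions that agree on polynomials are equal; identities between coefficients of
shifted power series need checking for polynomials only. -/
theorem Finitary.ext {σ : Type} {φ ψ : MvPowerSeries σ ℂ → ℂ} (hφ : Finitary φ)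
    (hψ : Finitary ψ) (h : ∀ p : MvPolynomial σ ℂ, φ p = ψ p) (f : MvPowerSeries σ ℂ) :
    φ f = ψ f := by
  classical
  obtain ⟨D, hD⟩ := hφ
  obtain ⟨E, hE⟩ := hψ
  have key : ∀ d ∈ D ∪ E, MvPowerSeries.coeff d f =
      MvPowerSeries.coeff d (MvPowerSeries.truncFinset ℂ (D ∪ E) f : MvPowerSeries σ ℂ) := by
    intro d hd
    rw [MvPolynomial.coeff_coe, MvPowerSeries.coeff_truncFinset_of_mem _ hd]
  rw [hD f _ fun d hd => key d (Finset.mem_union_left _ hd), h,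
    ← hE f _ fun d hd => key d (Finset.mem_union_right _ hd)]

theorem Finitary.sum {σ : Type} {α : Type} {s : Finset α} {φ : α → MvPowerSeries σ ℂ → ℂ}
    (h : ∀ a ∈ s, Finitary (φ a)) : Finitary fun f => ∑ a ∈ s, φ a f := by
  classical
  choose! D hD using h
  refine ⟨s.biUnion D, fun f g hfg => Finset.sum_congr rfl fun a ha => hD a ha f g fun d hd => ?_⟩
  exact hfg d (Finset.mem_biUnion.2 ⟨a, ha, hd⟩)

theorem Finitary.const_mul {σ : Type} {φ : MvPowerSeries σ ℂ → ℂ} (h : Finitary φ) (c : ℂ) :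
    Finitary fun f => c * φ f := by
  obtain ⟨D, hD⟩ := h
  exact ⟨D, fun f g hfg => congrArg (c * ·) (hD f g hfg)⟩

theorem Finitary.comp_pderiv {σ : Type} {φ : MvPowerSeries σ ℂ → ℂ} (h : Finitary φ) (k : σ) :
    Finitary fun f => φ (pderiv ℂ k f) := by
  classical
  obtain ⟨D, hD⟩ := h
  refine ⟨D.image fun d => d + Finsupp.single k 1, fun f g hfg => hD _ _ fun d hd => ?_⟩
  rw [MvPowerSeries.coeff_pderiv, MvPowerSeries.coeff_pderiv,
    hfg _ (Finset.mem_image_of_mem _ hd)]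

theorem finitary_coeff_subst {σ τ : Type} {a : σ → MvPowerSeries τ ℂ}
    (ha : MvPowerSeries.HasSubst a) (e : τ →₀ ℕ) :
    Finitary fun f : MvPowerSeries σ ℂ => MvPowerSeries.coeff e (MvPowerSeries.subst a f) := by
  obtain ⟨u, hu⟩ : ∃ u : MvPowerSeries σ ℂ, ∀ d, MvPowerSeries.coeff d u = 1 :=
    ⟨fun _ => (1 : ℂ), fun _ => rfl⟩
  have h : (Function.support _).Finite := MvPowerSeries.coeff_subst_finite ha u e
  refine ⟨h.toFinset, fun f g hfg => ?_⟩
  simp only [MvPowerSeries.coeff_subst ha]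
  refine finsum_congr fun d => ?_
  by_cases hd : MvPowerSeries.coeff e (d.prod fun s e => (a s) ^ e) = 0
  · rw [hd, smul_zero, smul_zero]
  · rw [hfg d]
    rw [Set.Finite.mem_toFinset, Function.mem_support, hu, one_smul]
    exact hd

section MiwaHom

variable {σ : Type}

/-- The shift `f ↦ f(x + s[u])` as a homomorphism into power series in `u`. -/
def miwaHom (s : ℂ) {x : ℕ+ → σ} (hx : Function.Injective x) :
    TSeries →ₐ[ℂ] PowerSeries (MvPowerSeries σ ℂ) :=
  (MvPowerSeries.optionEquivLeft σ ℂ).toAlgHom.comp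
    (MvPowerSeries.substAlgHom (miwaPoint_hasSubst s hx))

theorem miwaHom_apply (s : ℂ) {x : ℕ+ → σ} (hx : Function.Injective x) (f : TSeries) :
    miwaHom s hx f = MvPowerSeries.optionEquivLeft σ ℂ (miwa s x f) := by
  simp [miwaHom, miwa, MvPowerSeries.coe_substAlgHom]

theorem miwaHom_X (s : ℂ) {x : ℕ+ → σ} (hx : Function.Injective x) (k : ℕ+) :
    miwaHom s hx (MvPowerSeries.X k) = PowerSeries.C (MvPowerSeries.X (x k)) +
      PowerSeries.C (MvPowerSeries.C (s / (k : ℂ))) * PowerSeries.X ^ (k : ℕ) := by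
  rw [miwaHom_apply, miwa, MvPowerSeries.subst_X (miwaPoint_hasSubst s hx), miwaPoint, map_add,
    map_mul, map_pow, MvPowerSeries.optionEquivLeft_X_some, MvPowerSeries.optionEquivLeft_X_none,
    MvPowerSeries.optionEquivLeft_C]

theorem miwaHom_C (s : ℂ) {x : ℕ+ → σ} (hx : Function.Injective x) (a : ℂ) :
    miwaHom s hx (MvPowerSeries.C a) = PowerSeries.C (MvPowerSeries.C a) := by
  rw [miwaHom_apply, miwa, MvPowerSeries.subst_C, MvPowerSeries.optionEquivLeft_C]

theorem finitary_coeff_miwaHom (s : ℂ) {x : ℕ+ → σ} (hx : Function.Injective x) (i : ℕ)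
    (e : σ →₀ ℕ) : Finitary fun f : TSeries =>
      MvPowerSeries.coeff e (PowerSeries.coeff i (miwaHom s hx f)) := by
  simp only [miwaHom_apply, MvPowerSeries.coeff_coeff_optionEquivLeft]
  exact finitary_coeff_subst (miwaPoint_hasSubst s hx) _

/-- For a polynomial in `t`, the chain rule
`d/du f(x + s[u]) = ∑_k s u^{k-1} (∂_k f)(x + s[u])` with any large enough finite set of `k`. -/
theorem derivative_miwaHom_coe (s : ℂ) {x : ℕ+ → σ} (hx : Function.Injective x)
    (p : MvPolynomial ℕ+ ℂ) : ∃ K₀ : Finset ℕ+, ∀ K, K₀ ⊆ K →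
      PowerSeries.derivative _ (miwaHom s hx p) = ∑ k ∈ K, PowerSeries.C (MvPowerSeries.C s) *
        PowerSeries.X ^ ((k : ℕ) - 1) * miwaHom s hx (pderiv ℂ k (p : TSeries)) := by
  classical
  induction p using MvPolynomial.induction_on with
  | C a =>
    refine ⟨∅, fun K _ => ?_⟩
    have h1 : miwaHom s hx ((MvPolynomial.C a : MvPolynomial ℕ+ ℂ) : TSeries) =
        PowerSeries.C (MvPowerSeries.C a) := by
      rw [MvPolynomial.coe_C, miwaHom_C]
    rw [h1, PowerSeries.derivative_C, MvPolynomial.coe_C]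
    simp
  | add p q hp hq =>
    obtain ⟨K₁, h₁⟩ := hp
    obtain ⟨K₂, h₂⟩ := hq
    refine ⟨K₁ ∪ K₂, fun K hK => ?_⟩
    rw [MvPolynomial.coe_add, map_add, map_add, h₁ K (Finset.union_subset_left hK),
      h₂ K (Finset.union_subset_right hK), ← Finset.sum_add_distrib]
    refine Finset.sum_congr rfl fun k _ => ?_
    rw [map_add, map_add, mul_add]
  | mul_X p n hp =>
    obtain ⟨K₁, h₁⟩ := hp
    refine ⟨insert n K₁, fun K hK => ?_⟩
    have hn : n ∈ K := hK (Finset.mem_insert_self _ _)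
    have hX : PowerSeries.derivative _ (miwaHom s hx (MvPowerSeries.X n)) =
        PowerSeries.C (MvPowerSeries.C s) * PowerSeries.X ^ ((n : ℕ) - 1) := by
      rw [miwaHom_X, map_add, PowerSeries.derivative_C, zero_add, Derivation.leibniz,
        PowerSeries.derivative_C, PowerSeries.derivative_pow, PowerSeries.derivative_X]
      have hn0 : (n : ℂ) ≠ 0 := by exact_mod_cast n.ne_zero
      have : ((n : ℕ) : PowerSeries (MvPowerSeries σ ℂ)) =
          PowerSeries.C (MvPowerSeries.C (n : ℂ)) := by simp
      rw [smul_zero, add_zero, smul_eq_mul, mul_one, this, ← mul_assoc, ← map_mul, ← map_mul,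
        div_mul_cancel₀ _ hn0]
    rw [MvPolynomial.coe_mul, MvPolynomial.coe_X, map_mul, Derivation.leibniz,
      h₁ K ((Finset.subset_insert _ _).trans hK), hX]
    simp only [Derivation.leibniz, map_add, smul_eq_mul, map_mul, mul_add, Finset.sum_add_distrib]
    congr 1
    · rw [Finset.sum_eq_single_of_mem n hn]
      · rw [MvPowerSeries.pderiv_X_self, map_one, mul_one]; ring
      · intro k _ hk
        rw [MvPowerSeries.pderiv_X_of_ne (Ne.symm hk), map_zero, mul_zero, mul_zero]
    · rw [Finset.mul_sum]
      refine Finset.sum_congr rfl fun k _ => ?_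
      ring

/-- The chain rule for the Miwa shift, coefficient by coefficient in `u`. -/
theorem coeff_miwaHom_succ (s : ℂ) {x : ℕ+ → σ} (hx : Function.Injective x) (f : TSeries)
    (i : ℕ) : ((i : ℂ) + 1) • PowerSeries.coeff (i + 1) (miwaHom s hx f) =
      s • ∑ p ∈ antidiagonal i,
        PowerSeries.coeff p.2 (miwaHom s hx (pderiv ℂ p.1.succPNat f)) := by
  classical
  ext e
  simp only [map_smul, smul_eq_mul, map_sum]
  refine Finitary.ext (φ := fun f : TSeries => ((i : ℂ) + 1) *
      MvPowerSeries.coeff e (PowerSeries.coeff (i + 1) (miwaHom s hx f)))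
    (ψ := fun f : TSeries => s * ∑ p ∈ antidiagonal i,
      MvPowerSeries.coeff e (PowerSeries.coeff p.2 (miwaHom s hx (pderiv ℂ p.1.succPNat f))))
    ((finitary_coeff_miwaHom s hx _ e).const_mul _)
    ((Finitary.sum fun p _ => (finitary_coeff_miwaHom s hx p.2 e).comp_pderiv _).const_mul _)
    (fun p => ?_) f
  obtain ⟨K₀, h⟩ := derivative_miwaHom_coe s hx p
  set T : Finset ℕ+ := (Finset.range (i + 1)).map ⟨Nat.succPNat, Nat.succPNat_injective⟩ with hT
  have h1 := congrArg (PowerSeries.coeff i) (h (K₀ ∪ T) Finset.subset_union_left)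
  rw [PowerSeries.coeff_derivative, map_sum,
    ← Finset.sum_subset (s₁ := T) Finset.subset_union_right, hT, Finset.sum_map] at h1
  · have h2 := congrArg (MvPowerSeries.coeff e) h1
    rw [map_sum] at h2
    have h3 : MvPowerSeries.coeff e (PowerSeries.coeff (i + 1) (miwaHom s hx p) *
        ((i : MvPowerSeries σ ℂ) + 1)) =
        ((i : ℂ) + 1) * MvPowerSeries.coeff e (PowerSeries.coeff (i + 1) (miwaHom s hx p)) := by
      have : ((i : MvPowerSeries σ ℂ) + 1) = MvPowerSeries.C ((i : ℂ) + 1) := by simp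
      rw [this, mul_comm, MvPowerSeries.coeff_C_mul]
    rw [h3] at h2
    rw [h2, Finset.mul_sum, Finset.Nat.sum_antidiagonal_eq_sum_range_succ_mk]
    refine Finset.sum_congr rfl fun k hk => ?_
    have hk' : k ≤ i := Nat.lt_succ_iff.1 (Finset.mem_range.1 hk)
    simp only [Function.Embedding.coeFn_mk, Nat.succPNat_coe, Nat.succ_eq_add_one,
      Nat.add_sub_cancel]
    rw [mul_assoc, PowerSeries.coeff_C_mul, MvPowerSeries.coeff_C_mul,
      PowerSeries.coeff_X_pow_mul', if_pos hk']
  · intro k _ hk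
    have : i < (k : ℕ) - 1 := by
      by_contra hcon
      apply hk
      rw [hT, Finset.mem_map]
      refine ⟨(k : ℕ) - 1, by simp; omega, ?_⟩
      apply PNat.eq
      have := k.pos
      simp; omega
    rw [mul_assoc, PowerSeries.coeff_C_mul, PowerSeries.coeff_X_pow_mul', if_neg (by omega),
      mul_zero]

theorem coeff_zero_miwaHom (s : ℂ) {x : ℕ+ → σ} (hx : Function.Injective x) (f : TSeries) :
    PowerSeries.coeff 0 (miwaHom s hx f) = MvPowerSeries.subst (MvPowerSeries.X ∘ x) f := by
  have hs : MvPowerSeries.HasSubst (MvPowerSeries.X ∘ x : ℕ+ → MvPowerSeries σ ℂ) := by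
    have : Filter.TendstoCofinite x := inferInstanceAs (Filter.TendstoCofinite (⟨x, hx⟩ : ℕ+ ↪ σ))
    exact MvPowerSeries.HasSubst.X_comp _
  ext e
  refine Finitary.ext (finitary_coeff_miwaHom s hx 0 e) (finitary_coeff_subst hs e) (fun p => ?_) f
  congr 1
  have h : ((PowerSeries.constantCoeff (R := MvPowerSeries σ ℂ)).comp
      (miwaHom s hx).toRingHom).comp (MvPolynomial.coeToMvPowerSeries.ringHom) =
      ((MvPowerSeries.substAlgHom hs : TSeries →ₐ[ℂ] _).toRingHom.comp
        MvPolynomial.coeToMvPowerSeries.ringHom) := by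
    refine MvPolynomial.ringHom_ext (fun a => ?_) fun k => ?_
    · simp [miwaHom_C, MvPowerSeries.coe_substAlgHom, MvPowerSeries.subst_C]
    · simp [miwaHom_X, MvPowerSeries.subst_X hs, MvPowerSeries.coe_substAlgHom]
  have := RingHom.congr_fun h p
  simpa [MvPowerSeries.coe_substAlgHom] using this

end MiwaHom

/-! ### The Miwa shift as a sequence of differential operators -/

section Antidiagonal

variable {A M : Type*} [AddCommMonoid A] [Finset.HasAntidiagonal A] [AddCommMonoid M]

theorem sum_antidiagonal_assoc (n : A) (f : A → A → A → M) :
    ∑ p ∈ antidiagonal n, ∑ q ∈ antidiagonal p.2, f p.1 q.1 q.2 =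
      ∑ p ∈ antidiagonal n, ∑ q ∈ antidiagonal p.1, f q.1 q.2 p.2 := by
  rw [Finset.sum_sigma', Finset.sum_sigma']
  refine Finset.sum_nbij' (fun x => ⟨(x.1.1 + x.2.1, x.2.2), (x.1.1, x.2.1)⟩)
    (fun x => ⟨(x.2.1, x.2.2 + x.1.2), (x.2.2, x.1.2)⟩) ?_ ?_ ?_ ?_ ?_
  · rintro ⟨⟨a, b⟩, ⟨c, d⟩⟩ h
    simp only [Finset.mem_sigma, Finset.HasAntidiagonal.mem_antidiagonal] at h ⊢
    exact ⟨by rw [add_assoc, h.2, h.1], trivial⟩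
  · rintro ⟨⟨a, b⟩, ⟨c, d⟩⟩ h
    simp only [Finset.mem_sigma, Finset.HasAntidiagonal.mem_antidiagonal] at h ⊢
    exact ⟨by rw [← add_assoc, h.2, h.1], trivial⟩
  · rintro ⟨⟨a, b⟩, ⟨c, d⟩⟩ h
    simp only [Finset.mem_sigma, Finset.HasAntidiagonal.mem_antidiagonal] at h
    simp only [h.2]
  · rintro ⟨⟨a, b⟩, ⟨c, d⟩⟩ h
    simp only [Finset.mem_sigma, Finset.HasAntidiagonal.mem_antidiagonal] at h
    simp only [h.2]
  · rintro ⟨⟨a, b⟩, ⟨c, d⟩⟩ _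
    rfl

theorem sum_antidiagonal_left_comm (n : A) (f : A → A → A → M) :
    ∑ p ∈ antidiagonal n, ∑ q ∈ antidiagonal p.2, f p.1 q.1 q.2 =
      ∑ p ∈ antidiagonal n, ∑ q ∈ antidiagonal p.2, f q.1 p.1 q.2 := by
  rw [Finset.sum_sigma', Finset.sum_sigma']
  refine Finset.sum_nbij' (fun x => ⟨(x.2.1, x.1.1 + x.2.2), (x.1.1, x.2.2)⟩)
    (fun x => ⟨(x.2.1, x.1.1 + x.2.2), (x.1.1, x.2.2)⟩) ?_ ?_ ?_ ?_ ?_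
  · rintro ⟨⟨a, b⟩, ⟨c, d⟩⟩ h
    simp only [Finset.mem_sigma, Finset.HasAntidiagonal.mem_antidiagonal] at h ⊢
    exact ⟨by rw [add_left_comm, h.2, h.1], trivial⟩
  · rintro ⟨⟨a, b⟩, ⟨c, d⟩⟩ h
    simp only [Finset.mem_sigma, Finset.HasAntidiagonal.mem_antidiagonal] at h ⊢
    exact ⟨by rw [add_left_comm, h.2, h.1], trivial⟩
  · rintro ⟨⟨a, b⟩, ⟨c, d⟩⟩ h
    simp only [Finset.mem_sigma, Finset.HasAntidiagonal.mem_antidiagonal] at h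
    simp only [h.2]
  · rintro ⟨⟨a, b⟩, ⟨c, d⟩⟩ h
    simp only [Finset.mem_sigma, Finset.HasAntidiagonal.mem_antidiagonal] at h
    simp only [h.2]
  · rintro ⟨⟨a, b⟩, ⟨c, d⟩⟩ _
    rfl

end Antidiagonal

/-- The shift `f ↦ f(t + s[u])`, as a power series in `u` with coefficients in the series in `t`. -/
def shiftHom (s : ℂ) : TSeries →ₐ[ℂ] PowerSeries TSeries := miwaHom s Function.injective_id

/-- The coefficient of `u^i` in `f(t + s[u])`, which is `S_i(s ∂̃) f`. -/
def shiftCoeff (s : ℂ) (i : ℕ) (f : TSeries) : TSeries := PowerSeries.coeff i (shiftHom s f)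

theorem shiftCoeff_zero (s : ℂ) (f : TSeries) : shiftCoeff s 0 f = f := by
  rw [shiftCoeff, shiftHom, coeff_zero_miwaHom, Function.comp_id, MvPowerSeries.subst_self, id]

/-- The chain rule `d/du f(t + s[u]) = s ∑_k u^{k-1} (∂_k f)(t + s[u])`. -/
theorem shiftCoeff_succ (s : ℂ) (i : ℕ) (f : TSeries) :
    ((i : ℂ) + 1) • shiftCoeff s (i + 1) f =
      s • ∑ p ∈ antidiagonal i, shiftCoeff s p.2 (pderiv ℂ p.1.succPNat f) :=
  coeff_miwaHom_succ s Function.injective_id f i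

theorem coeff_shiftHom (s : ℂ) (i : ℕ) (f : TSeries) :
    PowerSeries.coeff i (shiftHom s f) = shiftCoeff s i f := rfl

theorem shiftCoeff_add (s : ℂ) (i : ℕ) (f g : TSeries) :
    shiftCoeff s i (f + g) = shiftCoeff s i f + shiftCoeff s i g := by
  simp [shiftCoeff]

@[simp] theorem shiftCoeff_map_zero (s : ℂ) (i : ℕ) : shiftCoeff s i 0 = 0 := by
  simp [shiftCoeff]

theorem shiftCoeff_smul (s : ℂ) (i : ℕ) (c : ℂ) (f : TSeries) :
    shiftCoeff s i (c • f) = c • shiftCoeff s i f := by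
  simp [shiftCoeff]

theorem shiftCoeff_sum {α : Type*} (s : ℂ) (i : ℕ) (S : Finset α) (f : α → TSeries) :
    shiftCoeff s i (∑ a ∈ S, f a) = ∑ a ∈ S, shiftCoeff s i (f a) := by
  simp [shiftCoeff]

theorem shiftCoeff_mul (s : ℂ) (i : ℕ) (f g : TSeries) : shiftCoeff s i (f * g) =
    ∑ p ∈ antidiagonal i, shiftCoeff s p.1 f * shiftCoeff s p.2 g := by
  simp [shiftCoeff, PowerSeries.coeff_mul]

theorem evalZ_apply {σ : Type} (F : MvPowerSeries (Option σ) ℂ) (N : ℤ) : evalZ F N =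
    if 0 ≤ N then PowerSeries.coeff N.toNat (MvPowerSeries.optionEquivLeft σ ℂ F) else 0 := by
  by_cases h : 0 ≤ N
  · have h1 : evalZ F N = fun d => MvPowerSeries.coeff (d.optionElim N.toNat) F := if_pos h
    rw [if_pos h, h1]
    ext d
    rw [MvPowerSeries.coeff_coeff_optionEquivLeft]
    rfl
  · rw [if_neg h]
    exact if_neg h

theorem shiftPlus_apply (f : TSeries) (N : ℤ) :
    shiftPlus f N = if 0 ≤ N then shiftCoeff 1 N.toNat f else 0 := by
  rw [shiftPlus, evalZ_apply, ← miwaHom_apply 1 Function.injective_id]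
  simp only [shiftCoeff, shiftHom]

theorem shiftMinus_apply (f : TSeries) (N : ℤ) :
    shiftMinus f N = if N ≤ 0 then shiftCoeff (-1) (-N).toNat f else 0 := by
  rw [shiftMinus, evalZinv, evalZ_apply, ← miwaHom_apply (-1) Function.injective_id]
  simp only [Int.neg_nonneg, shiftCoeff, shiftHom]

attribute [irreducible] shiftCoeff

theorem natCast_add_one_smul_right_injective {V : Type*} [AddCommGroup V] [Module ℂ V] (i : ℕ)
    {f g : V} (h : ((i : ℂ) + 1) • f = ((i : ℂ) + 1) • g) : f = g :=
  smul_right_injective V (by exact_mod_cast i.succ_ne_zero : ((i : ℂ) + 1) ≠ 0) h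

theorem pderiv_comm {σ : Type} (k l : σ) (f : MvPowerSeries σ ℂ) :
    pderiv ℂ k (pderiv ℂ l f) = pderiv ℂ l (pderiv ℂ k f) := by
  classical
  ext d
  simp only [MvPowerSeries.coeff_pderiv, Finsupp.add_apply, Finsupp.single_apply, Nat.cast_add]
  rw [add_right_comm d]
  by_cases h : k = l
  · subst h; ring
  · rw [if_neg h, if_neg (Ne.symm h)]
    push_cast; ring

theorem pderiv_shiftCoeff (s : ℂ) (i : ℕ) (k : ℕ+) (f : TSeries) :
    pderiv ℂ k (shiftCoeff s i f) = shiftCoeff s i (pderiv ℂ k f) := by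
  induction i using Nat.strong_induction_on generalizing f with
  | _ i ih =>
    rcases i with _ | i
    · rw [shiftCoeff_zero, shiftCoeff_zero]
    · apply natCast_add_one_smul_right_injective i
      rw [← Derivation.map_smul, shiftCoeff_succ, shiftCoeff_succ, Derivation.map_smul, map_sum]
      congr 1
      refine Finset.sum_congr rfl fun p hp => ?_
      rw [ih _ (Nat.lt_succ_of_le (Finset.HasAntidiagonal.antidiagonal.snd_le hp)), pderiv_comm]

theorem shiftCoeff_succ' (s : ℂ) (i : ℕ) (f : TSeries) :
    ((i : ℂ) + 1) • shiftCoeff s (i + 1) f =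
      s • ∑ p ∈ antidiagonal i, pderiv ℂ p.1.succPNat (shiftCoeff s p.2 f) := by
  simp_rw [shiftCoeff_succ, pderiv_shiftCoeff]

theorem shiftCoeff_comm (s s' : ℂ) (i j : ℕ) (f : TSeries) :
    shiftCoeff s i (shiftCoeff s' j f) = shiftCoeff s' j (shiftCoeff s i f) := by
  induction j using Nat.strong_induction_on generalizing f with
  | _ j ih =>
    rcases j with _ | j
    · rw [shiftCoeff_zero, shiftCoeff_zero]
    · apply natCast_add_one_smul_right_injective j
      rw [← shiftCoeff_smul, shiftCoeff_succ s' j f, shiftCoeff_succ s' j (shiftCoeff s i f),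
        shiftCoeff_smul, shiftCoeff_sum]
      congr 1
      refine Finset.sum_congr rfl fun p hp => ?_
      rw [ih _ (Nat.lt_succ_of_le (Finset.HasAntidiagonal.antidiagonal.snd_le hp)),
        pderiv_shiftCoeff]

theorem add_one_smul_sum_antidiagonal_succ {V : Type*} [AddCommGroup V] [Module ℂ V] (n : ℕ)
    (f : ℕ → ℕ → V) : ((n : ℂ) + 1) • ∑ p ∈ antidiagonal (n + 1), f p.1 p.2 =
      ∑ p ∈ antidiagonal n, ((p.1 : ℂ) + 1) • f (p.1 + 1) p.2 +
      ∑ p ∈ antidiagonal n, ((p.2 : ℂ) + 1) • f p.1 (p.2 + 1) := by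
  have h : ((n : ℂ) + 1) • ∑ p ∈ antidiagonal (n + 1), f p.1 p.2 =
      ∑ p ∈ antidiagonal (n + 1), ((p.1 : ℂ) • f p.1 p.2 + (p.2 : ℂ) • f p.1 p.2) := by
    rw [Finset.smul_sum]
    refine Finset.sum_congr rfl fun p hp => ?_
    rw [← add_smul]
    congr 1
    have := Finset.HasAntidiagonal.mem_antidiagonal.1 hp
    exact_mod_cast this.symm
  rw [h, Finset.sum_add_distrib, Finset.Nat.sum_antidiagonal_succ]
  conv_lhs => rw [Finset.Nat.sum_antidiagonal_succ' (f := fun p => (p.2 : ℂ) • f p.1 p.2)]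
  simp

/-- The shifts by `s[u]` and `-s[u]` cancel. -/
theorem sum_shiftCoeff_neg (s : ℂ) (n : ℕ) (f : TSeries) :
    ∑ p ∈ antidiagonal (n + 1), shiftCoeff s p.1 (shiftCoeff (-s) p.2 f) = 0 := by
  refine natCast_add_one_smul_right_injective (V := TSeries) n ?_
  have h1 (p : ℕ × ℕ) : ((p.1 : ℂ) + 1) • shiftCoeff s (p.1 + 1) (shiftCoeff (-s) p.2 f) =
      s • ∑ q ∈ antidiagonal p.1,
        pderiv ℂ q.1.succPNat (shiftCoeff s q.2 (shiftCoeff (-s) p.2 f)) := shiftCoeff_succ' _ _ _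
  have h2 (p : ℕ × ℕ) : ((p.2 : ℂ) + 1) • shiftCoeff s p.1 (shiftCoeff (-s) (p.2 + 1) f) =
      -(s • ∑ q ∈ antidiagonal p.2,
        pderiv ℂ q.1.succPNat (shiftCoeff s p.1 (shiftCoeff (-s) q.2 f))) := by
    rw [← shiftCoeff_smul, shiftCoeff_succ' (-s) p.2 f, shiftCoeff_smul, shiftCoeff_sum, neg_smul]
    simp only [pderiv_shiftCoeff]
  rw [smul_zero,
    add_one_smul_sum_antidiagonal_succ n fun a b => shiftCoeff s a (shiftCoeff (-s) b f),
    Finset.sum_congr rfl fun p _ => h1 p, Finset.sum_congr rfl fun p _ => h2 p,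
    Finset.sum_neg_distrib, ← Finset.smul_sum, ← Finset.smul_sum,
    ← sum_antidiagonal_assoc n fun i j k =>
      pderiv ℂ i.succPNat (shiftCoeff s j (shiftCoeff (-s) k f)),
    sum_antidiagonal_left_comm n fun j i k =>
      pderiv ℂ i.succPNat (shiftCoeff s j (shiftCoeff (-s) k f)), add_neg_cancel]

theorem shiftCoeff_one (s : ℂ) (f : TSeries) : shiftCoeff s 1 f = s • pderiv ℂ 1 f := by
  have h := shiftCoeff_succ s 0 f
  have h01 : Nat.succPNat 0 = 1 := rfl
  simpa [shiftCoeff_zero, h01] using h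

theorem shiftCoeff_two (s : ℂ) (f : TSeries) : shiftCoeff s 2 f = schurTwo s f := by
  have h := shiftCoeff_succ s 1 f
  have h01 : Nat.succPNat 0 = 1 := rfl
  have h12 : Nat.succPNat 1 = 2 := rfl
  simp only [Finset.Nat.antidiagonal_succ, Finset.Nat.antidiagonal_zero, Finset.map_singleton,
    Finset.sum_cons, Finset.sum_singleton, Function.Embedding.prodMap, Function.Embedding.coeFn_mk,
    Prod.map, Function.Embedding.refl_apply, Nat.succ_eq_add_one, shiftCoeff_zero, shiftCoeff_one,
    zero_add, h01, h12] at h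
  apply natCast_add_one_smul_right_injective 1
  rw [h, schurTwo, dOne, dOne, smul_add, smul_add, smul_smul, smul_smul, smul_smul, add_comm]
  congr 2 <;> push_cast <;> ring

theorem coeff_miwaHom {σ : Type} (s : ℂ) {x : ℕ+ → σ} (hx : Function.Injective x) (f : TSeries)
    (i : ℕ) : PowerSeries.coeff i (miwaHom s hx f) =
      MvPowerSeries.subst (MvPowerSeries.X ∘ x) (shiftCoeff s i f) := by
  have hs : MvPowerSeries.HasSubst (MvPowerSeries.X ∘ x : ℕ+ → MvPowerSeries σ ℂ) := by
    have : Filter.TendstoCofinite x := inferInstanceAs (Filter.TendstoCofinite (⟨x, hx⟩ : ℕ+ ↪ σ))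
    exact MvPowerSeries.HasSubst.X_comp _
  induction i using Nat.strong_induction_on generalizing f with
  | _ i ih =>
    rcases i with _ | i
    · rw [shiftCoeff_zero, coeff_zero_miwaHom]
    · apply natCast_add_one_smul_right_injective i
      rw [coeff_miwaHom_succ, ← MvPowerSeries.coe_substAlgHom hs, ← map_smul, shiftCoeff_succ,
        map_smul, map_sum]
      congr 1
      refine Finset.sum_congr rfl fun p hp => ?_
      rw [ih _ (Nat.lt_succ_of_le (Finset.HasAntidiagonal.antidiagonal.snd_le hp)),
        MvPowerSeries.coe_substAlgHom]

/-! ### Integration of a multiplicative cocycle -/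

section FlowDeriv

variable {K K' : Type*} [CommRing K] [Algebra ℂ K] [CommRing K'] [Algebra ℂ K']

/-- A derivation of `K`, applied to the coefficients of power series over `K`. -/
def coeffDeriv (d : Derivation ℂ K K) : Derivation ℂ (PowerSeries K) (PowerSeries K) :=
  Derivation.mk'
    { toFun := fun F => PowerSeries.mk fun n => d (PowerSeries.coeff n F)
      map_add' := fun F G => by ext n; simp
      map_smul' := fun c F => by ext n; simp } fun F G => by
    ext n
    simp only [LinearMap.coe_mk, AddHom.coe_mk, smul_eq_mul, map_add, PowerSeries.coeff_mul,
      PowerSeries.coeff_mk, map_sum, Derivation.leibniz, Finset.sum_add_distrib]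
    rw [← Finset.Nat.sum_antidiagonal_swap (n := n)
      (f := fun q => PowerSeries.coeff q.2 G * d (PowerSeries.coeff q.1 F))]
    rfl

@[simp] theorem coeff_coeffDeriv (d : Derivation ℂ K K) (F : PowerSeries K) (n : ℕ) :
    PowerSeries.coeff n (coeffDeriv d F) = d (PowerSeries.coeff n F) := by
  simp [coeffDeriv]

/-- The derivation `∑_k x^k δ_k` of `K⟦x⟧`, where `δ_k` acts on coefficients. -/
def gradDeriv (δ : ℕ → Derivation ℂ K K) : Derivation ℂ (PowerSeries K) (PowerSeries K) :=
  Derivation.mk'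
    { toFun := fun F => PowerSeries.mk fun n =>
        ∑ p ∈ antidiagonal n, δ p.1 (PowerSeries.coeff p.2 F)
      map_add' := fun F G => by ext n; simp [Finset.sum_add_distrib]
      map_smul' := fun c F => by ext n; simp [Finset.smul_sum] } fun F G => by
    have key (F G : PowerSeries K) (n : ℕ) : ∑ p ∈ antidiagonal n, ∑ q ∈ antidiagonal p.2,
        PowerSeries.coeff q.1 F * δ p.1 (PowerSeries.coeff q.2 G) =
        PowerSeries.coeff n (F * PowerSeries.mk fun n =>
          ∑ p ∈ antidiagonal n, δ p.1 (PowerSeries.coeff p.2 G)) := by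
      rw [sum_antidiagonal_left_comm n fun a i j =>
        PowerSeries.coeff i F * δ a (PowerSeries.coeff j G)]
      simp [PowerSeries.coeff_mul, Finset.mul_sum]
    ext n
    simp only [LinearMap.coe_mk, AddHom.coe_mk, smul_eq_mul, map_add]
    rw [← key F G n, ← key G F n, ← Finset.sum_add_distrib, PowerSeries.coeff_mk]
    refine Finset.sum_congr rfl fun p _ => ?_
    rw [PowerSeries.coeff_mul, map_sum]
    simp only [Derivation.leibniz, smul_eq_mul]
    rw [Finset.sum_add_distrib, ← Finset.Nat.sum_antidiagonal_swap (n := p.2)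
      (f := fun q => PowerSeries.coeff q.2 G * δ p.1 (PowerSeries.coeff q.1 F))]
    rfl

theorem coeff_gradDeriv (δ : ℕ → Derivation ℂ K K) (F : PowerSeries K) (n : ℕ) :
    PowerSeries.coeff n (gradDeriv δ F) =
      ∑ p ∈ antidiagonal n, δ p.1 (PowerSeries.coeff p.2 F) := by
  simp [gradDeriv]

/-- The derivation `d/dx + ∑_k x^k δ_k` of `K⟦x⟧`. For `δ_k = ∂/∂t_{k+1}` it annihilates every
series of the form `f(t - [x])`. -/
def flowDeriv (δ : ℕ → Derivation ℂ K K) : Derivation ℂ (PowerSeries K) (PowerSeries K) :=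
  (PowerSeries.derivative K).restrictScalars ℂ + gradDeriv δ

theorem coeff_flowDeriv (δ : ℕ → Derivation ℂ K K) (F : PowerSeries K) (n : ℕ) :
    PowerSeries.coeff n (flowDeriv δ F) = PowerSeries.coeff (n + 1) F * ((n : K) + 1) +
      ∑ p ∈ antidiagonal n, δ p.1 (PowerSeries.coeff p.2 F) := by
  simp [flowDeriv, coeff_gradDeriv, PowerSeries.coeff_derivative]

theorem flowDeriv_C (δ : ℕ → Derivation ℂ K K) (c : K) :
    flowDeriv δ (PowerSeries.C c) = PowerSeries.mk fun n => δ n c := by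
  ext n
  rw [coeff_flowDeriv, PowerSeries.coeff_C, if_neg n.succ_ne_zero, zero_mul, zero_add,
    PowerSeries.coeff_mk, Finset.sum_eq_single (n, 0)]
  · simp
  · rintro ⟨a, b⟩ h hne
    have hb : b ≠ 0 := by
      rintro rfl
      simp at h
      exact hne (by rw [h])
    rw [PowerSeries.coeff_C, if_neg hb, map_zero]
  · simp

theorem flowDeriv_map {δ : ℕ → Derivation ℂ K K} {δ' : ℕ → Derivation ℂ K' K'} (φ : K →+* K')
    (h : ∀ a f, δ' a (φ f) = φ (δ a f)) (F : PowerSeries K) :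
    flowDeriv δ' (PowerSeries.map φ F) = PowerSeries.map φ (flowDeriv δ F) := by
  ext n
  simp [coeff_flowDeriv, h]

theorem flowDeriv_coeffDeriv {δ : ℕ → Derivation ℂ K K} (d : Derivation ℂ K K)
    (h : ∀ a f, δ a (d f) = d (δ a f)) (F : PowerSeries K) :
    flowDeriv δ (coeffDeriv d F) = coeffDeriv d (flowDeriv δ F) := by
  ext n
  simp only [coeff_flowDeriv, coeff_coeffDeriv, h, map_add, map_sum]
  congr 1
  have : ((n : K) + 1) = ((n + 1 : ℕ) : K) := by push_cast; rfl
  rw [this, Derivation.leibniz, Derivation.map_natCast]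
  simp [mul_comm]

end FlowDeriv

/-- The derivation `∂/∂t_{a+1}`. -/
def timeDeriv (a : ℕ) : Derivation ℂ TSeries TSeries :=
  pderiv ℂ a.succPNat

theorem timeDeriv_apply (a : ℕ) (f : TSeries) : timeDeriv a f = pderiv ℂ a.succPNat f := rfl

theorem timeDeriv_comm (a b : ℕ) (f : TSeries) :
    timeDeriv a (timeDeriv b f) = timeDeriv b (timeDeriv a f) := pderiv_comm _ _ _

theorem flowDeriv_shiftHom (f : TSeries) : flowDeriv timeDeriv (shiftHom (-1) f) = 0 := by
  ext1 n
  have h := shiftCoeff_succ' (-1) n f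
  have h2 : ((n : TSeries) + 1) = MvPowerSeries.C ((n : ℂ) + 1) := by simp
  rw [coeff_flowDeriv, map_zero, mul_comm, h2, ← MvPowerSeries.smul_eq_C_mul]
  simp only [coeff_shiftHom, timeDeriv_apply]
  rw [h, neg_one_smul, neg_add_cancel]

/-- A series annihilated by `d/dx + ∑_k x^{k-1} ∂_k` is determined by its value at `x = 0`. -/
theorem eq_of_flowDeriv_eq_zero {F G : PowerSeries TSeries} (hF : flowDeriv timeDeriv F = 0)
    (hG : flowDeriv timeDeriv G = 0) (h0 : PowerSeries.coeff 0 F = PowerSeries.coeff 0 G) :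
    F = G := by
  rw [← sub_eq_zero]
  have h0' : PowerSeries.coeff 0 (F - G) = 0 := by rw [map_sub, h0, sub_self]
  have hD : flowDeriv timeDeriv (F - G) = 0 := by rw [map_sub, hF, hG, sub_self]
  generalize F - G = H at h0' hD
  ext1 n
  induction n using Nat.strong_induction_on with
  | _ n ih =>
    rcases n with _ | n
    · exact h0'
    · have h := congrArg (PowerSeries.coeff n) hD
      rw [coeff_flowDeriv, map_zero, Finset.sum_eq_zero, add_zero] at h
      · have h2 : ((n : TSeries) + 1) ≠ 0 := by
          intro h3
          have h4 := congrArg MvPowerSeries.constantCoeff h3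
          simp only [map_add, map_natCast, map_one, map_zero] at h4
          exact Nat.cast_add_one_ne_zero n h4
        rw [map_zero]
        exact (mul_eq_zero.1 h).resolve_right h2
      · intro p hp
        rw [ih p.2 (Nat.lt_succ_of_le (Finset.HasAntidiagonal.antidiagonal.snd_le hp)), map_zero,
          map_zero]

/-- The Poincaré lemma for formal one-forms `∑_k a_k dt_k`. -/
theorem exists_pderiv_eq {a : ℕ+ → TSeries} (h : ∀ j k, pderiv ℂ j (a k) = pderiv ℂ k (a j)) :
    ∃ g : TSeries, MvPowerSeries.constantCoeff g = 0 ∧ ∀ k, pderiv ℂ k g = a k := by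
  classical
  let sel : (ℕ+ →₀ ℕ) → ℕ+ := fun d => if h : ∃ k, d k ≠ 0 then h.choose else 1
  have hsel : ∀ d : ℕ+ →₀ ℕ, d ≠ 0 → d (sel d) ≠ 0 := by
    intro d hd
    have hex : ∃ k, d k ≠ 0 := by
      by_contra hcon
      push Not at hcon
      exact hd (Finsupp.ext hcon)
    simp only [sel, dif_pos hex]
    exact hex.choose_spec
  obtain ⟨g, hg⟩ : ∃ g : TSeries, ∀ d, MvPowerSeries.coeff d g = if d = 0 then 0 else
      MvPowerSeries.coeff (d - Finsupp.single (sel d) 1) (a (sel d)) / (d (sel d) : ℂ) :=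
    ⟨fun d => _, fun d => rfl⟩
  refine ⟨g, by rw [← MvPowerSeries.coeff_zero_eq_constantCoeff_apply, hg, if_pos rfl],
    fun k => ?_⟩
  ext d
  have hne : d + Finsupp.single k 1 ≠ 0 := by
    intro h0
    simpa using DFunLike.congr_fun h0 k
  rw [MvPowerSeries.coeff_pderiv, hg, if_neg hne]
  have hj := hsel _ hne
  generalize sel (d + Finsupp.single k 1) = j at hj
  have hk1 : ((d k : ℂ) + 1) ≠ 0 := by exact_mod_cast (d k).succ_ne_zero
  by_cases hjk : j = k
  · subst hjk
    rw [add_tsub_cancel_right, Finsupp.add_apply, Finsupp.single_eq_same]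
    push_cast
    rw [div_mul_cancel₀ _ hk1]
  · have hdj : (d + Finsupp.single k 1 : ℕ+ →₀ ℕ) j = d j := by
      rw [Finsupp.add_apply, Finsupp.single_eq_of_ne hjk, add_zero]
    rw [hdj] at hj ⊢
    have hle : Finsupp.single j 1 ≤ d := by
      rw [Finsupp.single_le_iff]; omega
    obtain ⟨e, rfl⟩ : ∃ e, d = e + Finsupp.single j 1 := ⟨_, (tsub_add_cancel_of_le hle).symm⟩
    have h1 := congrArg (MvPowerSeries.coeff e) (h k j)
    rw [MvPowerSeries.coeff_pderiv, MvPowerSeries.coeff_pderiv] at h1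
    have hek : (e + Finsupp.single j 1 : ℕ+ →₀ ℕ) k = e k := by
      rw [Finsupp.add_apply, Finsupp.single_eq_of_ne (Ne.symm hjk), add_zero]
    rw [hek, add_right_comm, add_tsub_cancel_right, div_mul_eq_mul_div, h1, Finsupp.add_apply,
      Finsupp.single_eq_same]
    have : ((e j : ℂ) + 1) ≠ 0 := by exact_mod_cast (e j).succ_ne_zero
    push_cast
    rw [mul_div_cancel_right₀ _ this]

/-- The exponential of a formal power series without constant term solves `∂_k τ = (∂_k g) τ`. -/
theorem exists_pderiv_eq_mul {g : TSeries} (hg : MvPowerSeries.constantCoeff g = 0) :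
    ∃ τ : TSeries, MvPowerSeries.constantCoeff τ = 1 ∧
      ∀ k, pderiv ℂ k τ = pderiv ℂ k g * τ := by
  classical
  let S : ℕ → TSeries := fun N => ∑ n ∈ Finset.range N, ((n.factorial : ℂ)⁻¹) • g ^ n
  obtain ⟨τ, hτ⟩ : ∃ τ : TSeries, ∀ d, MvPowerSeries.coeff d τ =
      MvPowerSeries.coeff d (S (d.degree + 1)) := ⟨fun d => _, fun d => rfl⟩
  have hS : ∀ (d : ℕ+ →₀ ℕ) (N : ℕ), d.degree < N →
      MvPowerSeries.coeff d τ = MvPowerSeries.coeff d (S N) := by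
    intro d N hN
    rw [hτ]
    simp only [S, map_sum]
    refine Finset.sum_subset (Finset.range_mono hN) fun n _ hn => ?_
    rw [Finset.mem_range, not_lt] at hn
    rw [map_smul, MvPowerSeries.coeff_eq_zero_of_constantCoeff_nilpotent (m := 1)
      (by rw [hg, pow_one]) (by omega), smul_zero]
  have hD : ∀ (k : ℕ+) (N : ℕ), pderiv ℂ k (S (N + 1)) = pderiv ℂ k g * S N := by
    intro k N
    simp only [S]
    rw [Finset.sum_range_succ', map_add, map_sum, Finset.mul_sum]
    simp only [pow_zero, Derivation.map_smul, MvPowerSeries.pderiv_one, smul_zero, add_zero]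
    refine Finset.sum_congr rfl fun n _ => ?_
    rw [MvPowerSeries.pderiv_pow, Nat.add_sub_cancel, Nat.factorial_succ, mul_smul_comm,
      mul_comm (pderiv ℂ k g)]
    have h1 : ((n + 1 : ℕ) : TSeries) = MvPowerSeries.C ((n : ℂ) + 1) := by simp
    rw [h1, mul_assoc, ← MvPowerSeries.smul_eq_C_mul, smul_smul]
    congr 1
    have : ((n : ℂ) + 1) ≠ 0 := by exact_mod_cast n.succ_ne_zero
    push_cast
    rw [mul_inv, mul_comm, ← mul_assoc, mul_inv_cancel₀ this, one_mul]
  refine ⟨τ, ?_, fun k => ?_⟩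
  · rw [← MvPowerSeries.coeff_zero_eq_constantCoeff_apply, hτ]
    simp [S]
  · ext d
    rw [MvPowerSeries.coeff_pderiv, hS _ (d.degree + 1 + 1) (by simp), ← MvPowerSeries.coeff_pderiv,
      hD, MvPowerSeries.coeff_mul, MvPowerSeries.coeff_mul]
    refine Finset.sum_congr rfl fun p hp => ?_
    rw [hS p.2]
    have h1 := Finset.HasAntidiagonal.mem_antidiagonal.1 hp
    have h2 := congrArg Finsupp.degree h1
    rw [map_add] at h2
    omega

/-- If `u(t,x) / u(t-[y],x)` is symmetric in `x` and `y`, where `u(t,0) = 1`, then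
`u(t,x) = τ(t-[x]) / τ(t)` for some `τ`. In the statement `w = 1/u`, and the symmetry is that of the
coefficient of `x^i y^j`. -/
theorem exists_tau {u w : PowerSeries TSeries} (hu : PowerSeries.coeff 0 u = 1) (huw : u * w = 1)
    (hsymm : ∀ i j, ∑ p ∈ antidiagonal i,
        PowerSeries.coeff p.1 u * shiftCoeff (-1) j (PowerSeries.coeff p.2 w) =
      ∑ p ∈ antidiagonal j,
        PowerSeries.coeff p.1 u * shiftCoeff (-1) i (PowerSeries.coeff p.2 w)) :
    ∃ τ : TSeries, MvPowerSeries.constantCoeff τ = 1 ∧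
      shiftHom (-1) τ = PowerSeries.C τ * u := by
  classical
  set M : TSeries →+* PowerSeries TSeries := (shiftHom (-1)).toRingHom with hM
  have hMc : ∀ i f, PowerSeries.coeff i (M f) = shiftCoeff (-1) i f := fun i f =>
    coeff_shiftHom _ _ _
  set D := flowDeriv timeDeriv with hDdef
  set δ : ℕ → Derivation ℂ (PowerSeries TSeries) (PowerSeries TSeries) := fun a =>
    coeffDeriv (timeDeriv a) with hδ
  have hDM : ∀ f, D (M f) = 0 := flowDeriv_shiftHom
  -- `D` annihilates `τ(t - [x])`, so `A = -D log u` has to be `∑_a x^a ∂_{a+1} log τ`.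
  obtain ⟨A, hA⟩ : ∃ A : PowerSeries TSeries, A = -(D u) * w := ⟨_, rfl⟩
  have hDu : D u = -(A * u) := by
    rw [hA, neg_mul, neg_mul, neg_neg, mul_assoc, mul_comm w, huw, mul_one]
  have hDw : D w = A * w := by
    have h := D.leibniz_of_mul_eq_one (by rw [mul_comm, huw] : w * u = 1)
    rw [h, hA, smul_eq_mul]; ring
  -- `Z(x,y) = u(t,x) / u(t-[y],x)`, as a power series in `x` over the power series in `y`
  obtain ⟨Z, hZ⟩ : ∃ Z : PowerSeries (PowerSeries TSeries),
    Z = PowerSeries.map PowerSeries.C u * PowerSeries.map M w := ⟨_, rfl⟩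
  set T : ℕ → PowerSeries TSeries := fun i =>
    PowerSeries.mk fun j => shiftCoeff (-1) i (PowerSeries.coeff j w) with hT
  have hZT : ∀ i, PowerSeries.coeff i Z = u * T i := by
    intro i
    ext1 j
    rw [hZ, PowerSeries.coeff_mul, map_sum, PowerSeries.coeff_mul]
    simp only [PowerSeries.coeff_map, PowerSeries.coeff_C_mul, hMc, hT, PowerSeries.coeff_mk]
    exact hsymm i j
  have hT0 : T 0 = w := by
    ext1 j; simp [hT, shiftCoeff_zero]
  have hTs : ∀ i, T (i + 1) * ((i : PowerSeries TSeries) + 1) =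
      -∑ p ∈ antidiagonal i, δ p.1 (T p.2) := by
    intro i
    ext1 j
    have h2 : ((i : PowerSeries TSeries) + 1) = PowerSeries.C (MvPowerSeries.C ((i : ℂ) + 1)) := by
      simp
    rw [h2, PowerSeries.coeff_mul_C, mul_comm, ← MvPowerSeries.smul_eq_C_mul, map_neg, map_sum]
    simp only [hT, hδ, PowerSeries.coeff_mk, coeff_coeffDeriv, timeDeriv_apply]
    rw [shiftCoeff_succ', neg_one_smul]
  -- The logarithmic derivative of `Z` along `x`, from its definition.
  have hflow1 : flowDeriv δ Z = (PowerSeries.map M A - PowerSeries.map PowerSeries.C A) * Z := by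
    have h1 : flowDeriv δ (PowerSeries.map PowerSeries.C u) = PowerSeries.map PowerSeries.C (D u) :=
      flowDeriv_map _ (fun a f => by
        ext1 n
        by_cases hn : n = 0 <;> simp [hδ, PowerSeries.coeff_C, hn]) u
    have h2 : flowDeriv δ (PowerSeries.map M w) = PowerSeries.map M (D w) :=
      flowDeriv_map _ (fun a f => by
        ext1 n
        simp only [hδ, coeff_coeffDeriv, hMc, timeDeriv_apply, pderiv_shiftCoeff]) w
    rw [hZ, Derivation.leibniz, h1, h2, hDu, hDw, map_neg, map_mul, map_mul, smul_eq_mul,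
      smul_eq_mul]
    ring
  -- The same derivative, from the symmetric expression `Z(x,y) = u(t,y) / u(t-[x],y)`.
  obtain ⟨B, hB⟩ : ∃ B : PowerSeries (PowerSeries TSeries),
    B = PowerSeries.mk fun a => δ a u * w := ⟨_, rfl⟩
  have hflow2 : flowDeriv δ Z = B * Z := by
    ext1 i
    rw [coeff_flowDeriv, PowerSeries.coeff_mul, hZT (i + 1), mul_assoc, hTs, mul_neg, Finset.mul_sum,
      ← Finset.sum_neg_distrib, ← Finset.sum_add_distrib]
    refine Finset.sum_congr rfl fun p _ => ?_
    rw [hZT, hB, PowerSeries.coeff_mk, Derivation.leibniz, smul_eq_mul, smul_eq_mul]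
    linear_combination (-(δ p.1 u) * T p.2) * huw
  have hZunit : IsUnit Z := by
    rw [PowerSeries.isUnit_iff_constantCoeff, ← PowerSeries.coeff_zero_eq_constantCoeff_apply, hZT,
      hT0, huw]
    exact isUnit_one
  have hstar : B = PowerSeries.map M A - PowerSeries.map PowerSeries.C A :=
    hZunit.mul_left_injective (hflow2.symm.trans hflow1)
  -- `∂_{a+1} log u(t,x) = A_a(t-[x]) - A_a(t)`.
  have hstar' : ∀ a, δ a u * w =
      M (PowerSeries.coeff a A) - PowerSeries.C (PowerSeries.coeff a A) := by
    intro a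
    have := congrArg (PowerSeries.coeff a) hstar
    simpa [hB] using this
  -- Applying `D` to this equation removes the term `A_a(t-[x])`; what remains says that the one-form
  -- `∑_a A_a dt_{a+1}` is closed.
  have hclosed : ∀ a b, timeDeriv a (PowerSeries.coeff b A) =
      timeDeriv b (PowerSeries.coeff a A) := by
    intro a b
    have h1 := congrArg D (hstar' a)
    rw [map_sub, hDM, hDdef, flowDeriv_C, ← hDdef, Derivation.leibniz, hDw, hDdef,
      flowDeriv_coeffDeriv _ (fun c f => timeDeriv_comm c a f), ← hDdef, hDu, map_neg,
      Derivation.leibniz] at h1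
    have h2 : δ a A = PowerSeries.mk fun n => timeDeriv n (PowerSeries.coeff a A) := by
      simp only [smul_eq_mul] at h1
      linear_combination (-1 : PowerSeries TSeries) * h1 - (δ a A) * huw
    have h3 := congrArg (PowerSeries.coeff b) h2
    simpa [hδ] using h3
  obtain ⟨g, hg0, hg⟩ := exists_pderiv_eq (a := fun k => PowerSeries.coeff k.natPred A)
    fun j k => by
      have h := hclosed j.natPred k.natPred
      rwa [timeDeriv_apply, timeDeriv_apply, PNat.succPNat_natPred, PNat.succPNat_natPred] at h
  obtain ⟨τ, hτ0, hτ⟩ := exists_pderiv_eq_mul hg0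
  refine ⟨τ, hτ0, eq_of_flowDeriv_eq_zero (hDM τ) ?_ ?_⟩
  · rw [Derivation.leibniz, ← hDdef, hDu, hDdef, flowDeriv_C, smul_eq_mul, smul_eq_mul]
    have h1 : (PowerSeries.mk fun n => timeDeriv n τ) = PowerSeries.C τ * A := by
      ext1 n
      rw [PowerSeries.coeff_mk, timeDeriv_apply, hτ, hg, Nat.natPred_succPNat,
        PowerSeries.coeff_C_mul, mul_comm]
    rw [h1]; ring
  · rw [coeff_shiftHom, shiftCoeff_zero, PowerSeries.coeff_C_mul, hu, mul_one]

/-! ### Isotropic spaces of pairs of wave functions -/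

/-- The pairing `∑_a f_a g_a` of two sequences; it is used where finitely many terms are nonzero. -/
def zPair {σ : Type} (f g : ZSeries σ) : MvPowerSeries σ ℂ := ∑ᶠ a, f a * g a

/-- The sequence vanishes above the index `N`. -/
def UpTo {σ : Type} (N : ℤ) (f : ZSeries σ) : Prop := ∀ a, N < a → f a = 0

/-- The sequence vanishes below the index `N`. -/
def StartsAt {σ : Type} (N : ℤ) (f : ZSeries σ) : Prop := ∀ a, a < N → f a = 0

section

variable {σ : Type}

theorem UpTo.mono {N N' : ℤ} {f : ZSeries σ} (h : UpTo N f) (hN : N ≤ N') : UpTo N' f :=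
  fun a ha => h a (by omega)

theorem StartsAt.mono {N N' : ℤ} {f : ZSeries σ} (h : StartsAt N f) (hN : N' ≤ N) :
    StartsAt N' f := fun a ha => h a (by omega)

theorem zPair_comm (f g : ZSeries σ) : zPair f g = zPair g f := by
  simp only [zPair, mul_comm]

theorem zPair_eq_sum {N N' : ℤ} {f g : ZSeries σ} (hf : UpTo N f) (hg : StartsAt N' g) :
    zPair f g = ∑ a ∈ Finset.Icc N' N, f a * g a := by
  apply finsum_eq_sum_of_support_subset
  intro a ha
  rw [Function.mem_support] at ha
  rw [Finset.coe_Icc, Set.mem_Icc]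
  constructor
  · by_contra hcon
    exact ha (by rw [hg a (not_le.1 hcon), mul_zero])
  · by_contra hcon
    exact ha (by rw [hf a (not_le.1 hcon), zero_mul])

theorem zPair_eq_zero {N N' : ℤ} {f g : ZSeries σ} (hf : UpTo N f) (hg : StartsAt N' g)
    (h : N < N') : zPair f g = 0 := by
  rw [zPair_eq_sum hf hg, Finset.Icc_eq_empty (not_le.2 h), Finset.sum_empty]

theorem zPair_eq_antidiagonal {N N' : ℤ} {f g : ZSeries σ} (hf : UpTo N f) (hg : StartsAt N' g)
    (m : ℕ) (h : N = N' + m) :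
    zPair f g = ∑ p ∈ antidiagonal m, f (N - p.1) * g (N' + p.2) := by
  subst h
  rw [zPair_eq_sum hf hg]
  symm
  refine Finset.sum_nbij' (fun p => N' + p.2) (fun a => ((N' + m - a).toNat, (a - N').toNat))
    ?_ ?_ ?_ ?_ ?_
  · rintro ⟨i, j⟩ hp
    simp only [Finset.HasAntidiagonal.mem_antidiagonal] at hp
    simp only [Finset.mem_Icc]
    omega
  · intro a ha
    simp only [Finset.mem_Icc] at ha
    simp only [Finset.HasAntidiagonal.mem_antidiagonal]
    omega
  · rintro ⟨i, j⟩ hp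
    simp only [Finset.HasAntidiagonal.mem_antidiagonal] at hp
    ext <;> simp only <;> omega
  · intro a ha
    simp only [Finset.mem_Icc] at ha
    simp only
    omega
  · rintro ⟨i, j⟩ hp
    simp only [Finset.HasAntidiagonal.mem_antidiagonal] at hp
    congr 2
    simp only
    omega

theorem zPair_sum_right {N N' : ℤ} {α : Type*} {f : ZSeries σ} (hf : UpTo N f) (S : Finset α)
    {g : α → ZSeries σ} (hg : ∀ i ∈ S, StartsAt N' (g i)) :
    zPair f (∑ i ∈ S, g i) = ∑ i ∈ S, zPair f (g i) := by
  have h : StartsAt N' (∑ i ∈ S, g i) := fun a ha => by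
    rw [Finset.sum_apply]
    exact Finset.sum_eq_zero fun i hi => hg i hi a ha
  rw [zPair_eq_sum hf h, Finset.sum_congr rfl fun i hi => zPair_eq_sum hf (hg i hi),
    Finset.sum_comm]
  refine Finset.sum_congr rfl fun a _ => ?_
  rw [Finset.sum_apply, Finset.mul_sum]

theorem zPair_sum_left {N N' : ℤ} {α : Type*} {g : ZSeries σ} (hg : StartsAt N' g) (S : Finset α)
    {f : α → ZSeries σ} (hf : ∀ i ∈ S, UpTo N (f i)) :
    zPair (∑ i ∈ S, f i) g = ∑ i ∈ S, zPair (f i) g := by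
  have h : UpTo N (∑ i ∈ S, f i) := fun a ha => by
    rw [Finset.sum_apply]
    exact Finset.sum_eq_zero fun i hi => hf i hi a ha
  rw [zPair_eq_sum h hg, Finset.sum_congr rfl fun i hi => zPair_eq_sum (hf i hi) hg,
    Finset.sum_comm]
  refine Finset.sum_congr rfl fun a _ => ?_
  rw [Finset.sum_apply, Finset.sum_mul]

theorem zPair_sub_right {N N' : ℤ} {f g g' : ZSeries σ} (hf : UpTo N f) (hg : StartsAt N' g)
    (hg' : StartsAt N' g') : zPair f (g - g') = zPair f g - zPair f g' := by
  have h : StartsAt N' (g - g') := fun a ha => by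
    rw [Pi.sub_apply, hg a ha, hg' a ha, sub_zero]
  rw [zPair_eq_sum hf h, zPair_eq_sum hf hg, zPair_eq_sum hf hg', ← Finset.sum_sub_distrib]
  refine Finset.sum_congr rfl fun a _ => ?_
  rw [Pi.sub_apply, mul_sub]

end

section

variable {σ : Type} {N N' : ℤ} {f f' g g' : ZSeries σ}

theorem UpTo.add (hf : UpTo N f) (hf' : UpTo N' f') : UpTo (max N N') (f + f') := fun a ha => by
  rw [Pi.add_apply, hf a (by omega), hf' a (by omega), add_zero]

theorem StartsAt.add (hg : StartsAt N g) (hg' : StartsAt N' g') : StartsAt (min N N') (g + g') :=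
  fun a ha => by rw [Pi.add_apply, hg a (by omega), hg' a (by omega), add_zero]

theorem UpTo.smul (hf : UpTo N f) (c : MvPowerSeries σ ℂ) : UpTo N (c • f) := fun a ha => by
  rw [Pi.smul_apply, hf a ha, smul_zero]

theorem StartsAt.smul (hg : StartsAt N g) (c : MvPowerSeries σ ℂ) : StartsAt N (c • g) :=
  fun a ha => by rw [Pi.smul_apply, hg a ha, smul_zero]

theorem zPair_add_left {M : ℤ} (hf : UpTo N f) (hf' : UpTo N' f') (hg : StartsAt M g) :
    zPair (f + f') g = zPair f g + zPair f' g := by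
  rw [zPair_eq_sum (hf.add hf') hg, zPair_eq_sum (hf.mono (le_max_left N N')) hg,
    zPair_eq_sum (hf'.mono (le_max_right N N')) hg, ← Finset.sum_add_distrib]
  simp only [Pi.add_apply, add_mul]

theorem zPair_add_right {M : ℤ} (hf : UpTo M f) (hg : StartsAt N g) (hg' : StartsAt N' g') :
    zPair f (g + g') = zPair f g + zPair f g' := by
  rw [zPair_eq_sum hf (hg.add hg'), zPair_eq_sum hf (hg.mono (min_le_left N N')),
    zPair_eq_sum hf (hg'.mono (min_le_right N N')), ← Finset.sum_add_distrib]
  simp only [Pi.add_apply, mul_add]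

theorem zPair_smul_left (hf : UpTo N f) (hg : StartsAt N' g) (c : MvPowerSeries σ ℂ) :
    zPair (c • f) g = c * zPair f g := by
  rw [zPair_eq_sum (hf.smul c) hg, zPair_eq_sum hf hg, Finset.mul_sum]
  simp only [Pi.smul_apply, smul_eq_mul, mul_assoc]

theorem zPair_smul_right (hf : UpTo N f) (hg : StartsAt N' g) (c : MvPowerSeries σ ℂ) :
    zPair f (c • g) = c * zPair f g := by
  rw [zPair_eq_sum hf (hg.smul c), zPair_eq_sum hf hg, Finset.mul_sum]
  simp only [Pi.smul_apply, smul_eq_mul, mul_left_comm]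

theorem pderiv_zPair (hf : UpTo N f) (hg : StartsAt N' g) (k : σ) : pderiv ℂ k (zPair f g) =
    zPair (fun a => pderiv ℂ k (f a)) g + zPair f fun a => pderiv ℂ k (g a) := by
  have hf' : UpTo N fun a => pderiv ℂ k (f a) := fun a ha => by simp only [hf a ha, map_zero]
  have hg' : StartsAt N' fun a => pderiv ℂ k (g a) := fun a ha => by
    simp only [hg a ha, map_zero]
  rw [zPair_eq_sum hf hg, zPair_eq_sum hf' hg, zPair_eq_sum hf hg', map_sum,
    ← Finset.sum_add_distrib]
  refine Finset.sum_congr rfl fun a _ => ?_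
  rw [Derivation.leibniz, smul_eq_mul, smul_eq_mul]
  ring

theorem zPair_shift (k : ℤ) : zPair f (fun a => g (a + k)) = zPair (fun a => f (a - k)) g := by
  rw [zPair, zPair]
  refine finsum_eq_of_bijective (fun a => a + k) (Equiv.addRight k).bijective fun a => ?_
  rw [add_sub_cancel_right]

end

/-- The operators `∂_k + z^k` and `∂_k - z^{-k}` by which `∂_k` acts on the coefficients of
`e^{-∑ t_k z^k} Ψ_1` and `e^{∑ t_k z^{-k}} Ψ_2`. -/
def flowOp (k : ℕ+) (v : ZSeries ℕ+ × ZSeries ℕ+) : ZSeries ℕ+ × ZSeries ℕ+ :=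
  (fun a => pderiv ℂ k (v.1 a) + v.1 (a - k), fun a => pderiv ℂ k (v.2 a) - v.2 (a + k))

theorem flowOp_add (k : ℕ+) (v w : ZSeries ℕ+ × ZSeries ℕ+) :
    flowOp k (v + w) = flowOp k v + flowOp k w := by
  ext1 <;> funext a <;> simp only [flowOp, Prod.fst_add, Prod.snd_add, Pi.add_apply, map_add] <;>
    ring

theorem flowOp_smul (k : ℕ+) (c : TSeries) (v : ZSeries ℕ+ × ZSeries ℕ+) :
    flowOp k (c • v) = c • flowOp k v + pderiv ℂ k c • v := by
  ext1 <;> funext a <;> simp only [flowOp, Prod.fst_add, Prod.snd_add, Pi.add_apply, Prod.smul_fst,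
    Prod.smul_snd, Pi.smul_apply, smul_eq_mul, Derivation.leibniz] <;> ring

theorem flowOp_zero (k : ℕ+) : flowOp k 0 = 0 := by
  ext1 <;> funext a <;> simp [flowOp]

/-- A space of pairs `(f, f')`, with `f` a series in `z^{-1}` and `f'` a series in `z` up to finitely
many terms, that is stable under the flows and isotropic for the symmetric form
`((f, f'), (g, g')) ↦ ⟨f, g'⟩ + ⟨f', g⟩`. -/
structure IsWaveSpace (V : Submodule TSeries (ZSeries ℕ+ × ZSeries ℕ+)) : Prop where
  upTo : ∀ v ∈ V, ∃ N, UpTo N v.1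
  startsAt : ∀ v ∈ V, ∃ N, StartsAt N v.2
  isotropic : ∀ v ∈ V, ∀ w ∈ V, zPair v.1 w.2 + zPair w.1 v.2 = 0
  flow : ∀ v ∈ V, ∀ k, flowOp k v ∈ V

/-- The coefficient of `x^j` in `f(t + s[x]) / (1 - x E)`, where `(E f)_a = f_{a+ε}`. -/
def geomShift (s : ℂ) (ε : ℤ) (j : ℕ) (f : ZSeries ℕ+) : ZSeries ℕ+ :=
  fun a => ∑ p ∈ antidiagonal j, shiftCoeff s p.2 (f (a + ε * p.1))

/-- The coefficient of `x^j` in `(1 - x E) f(t + s[x])`, where `(E f)_a = f_{a+ε}`. -/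
def linShift (s : ℂ) (ε : ℤ) : ℕ → ZSeries ℕ+ → ZSeries ℕ+
  | 0, f => f
  | j + 1, f => fun a => shiftCoeff s (j + 1) (f a) - shiftCoeff s j (f (a + ε))

theorem geomShift_zero (s : ℂ) (ε : ℤ) (f : ZSeries ℕ+) : geomShift s ε 0 f = f := by
  funext a
  simp [geomShift, shiftCoeff_zero]

theorem geomShift_succ (s : ℂ) (ε : ℤ) (j : ℕ) (f : ZSeries ℕ+) (a : ℤ) :
    geomShift s ε (j + 1) f a = shiftCoeff s (j + 1) (f a) + geomShift s ε j f (a + ε) := by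
  rw [geomShift, Finset.Nat.sum_antidiagonal_succ, geomShift]
  congr 1
  · simp
  · refine Finset.sum_congr rfl fun p _ => ?_
    congr 2
    push_cast; ring

/-- `geomShift` is the solution of `dX/dx = s ∑_k x^{k-1} (∂_k + s E^k) X` with `X(0) = f`. -/
theorem geomShift_flow {s : ℂ} (hs : s * s = 1) (ε : ℤ) (j : ℕ) (f : ZSeries ℕ+) (a : ℤ) :
    ((j : ℂ) + 1) • geomShift s ε (j + 1) f a = s • ∑ p ∈ antidiagonal j,
      (pderiv ℂ p.1.succPNat (geomShift s ε p.2 f a) +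
        s • geomShift s ε p.2 f (a + ε * (p.1 + 1))) := by
  rw [geomShift, add_one_smul_sum_antidiagonal_succ j
    fun b r => shiftCoeff s r (f (a + ε * b)), Finset.sum_add_distrib, smul_add, add_comm]
  congr 1
  · simp only [geomShift, map_sum, shiftCoeff_succ', ← Finset.smul_sum]
    rw [sum_antidiagonal_left_comm j fun b k r =>
      pderiv ℂ k.succPNat (shiftCoeff s r (f (a + ε * b)))]
  · rw [← Finset.smul_sum, smul_smul, hs, one_smul]
    simp only [geomShift]
    rw [sum_antidiagonal_assoc j fun k b r => shiftCoeff s r (f (a + ε * (k + 1) + ε * b))]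
    refine Finset.sum_congr rfl fun p _ => ?_
    rw [Finset.sum_congr rfl (g := fun _ => shiftCoeff s p.2 (f (a + ε * ((p.1 + 1 : ℕ) : ℤ)))),
      Finset.sum_const, Finset.Nat.card_antidiagonal, ← Nat.cast_smul_eq_nsmul ℂ]
    · push_cast; rfl
    · intro q hq
      have := Finset.HasAntidiagonal.mem_antidiagonal.1 hq
      congr 2
      rw [← this]
      push_cast; ring

theorem sum_linShift (s : ℂ) (ε : ℤ) (j : ℕ) (f : ZSeries ℕ+) (a : ℤ) :
    ∑ p ∈ antidiagonal j, linShift s ε p.2 f (a + ε * (p.1 + 1)) = shiftCoeff s j (f (a + ε)) := by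
  induction j generalizing a with
  | zero => simp [linShift, shiftCoeff_zero]
  | succ j ih =>
    rw [Finset.Nat.sum_antidiagonal_succ]
    have h := ih (a + ε)
    have h2 : ∑ p ∈ antidiagonal j, linShift s ε p.2 f (a + ε * (((p.1 + 1 : ℕ) : ℤ) + 1)) =
        ∑ p ∈ antidiagonal j, linShift s ε p.2 f (a + ε + ε * (p.1 + 1)) := by
      refine Finset.sum_congr rfl fun p _ => ?_
      congr 1
      push_cast; ring
    simp only at h2 ⊢
    rw [h2, h]
    simp [linShift]

/-- `linShift` is the solution of `dX/dx = s ∑_k x^{k-1} (∂_k - s E^k) X` with `X(0) = f`. -/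
theorem linShift_flow {s : ℂ} (hs : s * s = 1) (ε : ℤ) (j : ℕ) (f : ZSeries ℕ+) (a : ℤ) :
    ((j : ℂ) + 1) • linShift s ε (j + 1) f a = s • ∑ p ∈ antidiagonal j,
      (pderiv ℂ p.1.succPNat (linShift s ε p.2 f a) -
        s • linShift s ε p.2 f (a + ε * (p.1 + 1))) := by
  rw [Finset.sum_sub_distrib, ← Finset.smul_sum, sum_linShift, smul_sub, smul_smul, hs, one_smul,
    linShift, smul_sub, shiftCoeff_succ']
  rcases j with _ | j
  · simp [linShift, shiftCoeff_zero]
  · rw [Finset.Nat.sum_antidiagonal_succ', Finset.Nat.sum_antidiagonal_succ']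
    simp only [linShift, map_sub, Finset.sum_sub_distrib, shiftCoeff_zero]
    have h := shiftCoeff_succ' s j (f (a + ε))
    rw [smul_add, smul_add, smul_sub, ← h]
    push_cast
    module

/-- A formal solution of `dX/dx = s ∑_k x^{k-1} flowOp_k X` that starts in a wave space stays in it. -/
theorem IsWaveSpace.mem_of_flow {V : Submodule TSeries (ZSeries ℕ+ × ZSeries ℕ+)}
    (hV : IsWaveSpace V) (s : ℂ) (X : ℕ → ZSeries ℕ+ × ZSeries ℕ+) (h0 : X 0 ∈ V)
    (hX : ∀ j : ℕ, ((j : ℂ) + 1) • X (j + 1) =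
      s • ∑ p ∈ antidiagonal j, flowOp p.1.succPNat (X p.2)) (j : ℕ) : X j ∈ V := by
  induction j using Nat.strong_induction_on with
  | _ j ih =>
    rcases j with _ | j
    · exact h0
    · have hne : ((j : ℂ) + 1) ≠ 0 := by exact_mod_cast j.succ_ne_zero
      have h : X (j + 1) = ((j : ℂ) + 1)⁻¹ • (((j : ℂ) + 1) • X (j + 1)) := by
        rw [smul_smul, inv_mul_cancel₀ hne, one_smul]
      rw [h, hX]
      refine V.smul_of_tower_mem _ (V.smul_of_tower_mem _ (V.sum_mem fun p hp => hV.flow _ ?_ _))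
      exact ih _ (Nat.lt_succ_of_le (Finset.HasAntidiagonal.antidiagonal.snd_le hp))

/-- A wave space is stable under the shift of `e^{∑ t_k z^k} f` and `e^{-∑ t_k z^{-k}} f'` to
`t - [x]`. -/
theorem IsWaveSpace.shiftMinus_mem {V : Submodule TSeries (ZSeries ℕ+ × ZSeries ℕ+)}
    (hV : IsWaveSpace V) {v : ZSeries ℕ+ × ZSeries ℕ+} (hv : v ∈ V) (j : ℕ) :
    (linShift (-1) (-1) j v.1, geomShift (-1) 1 j v.2) ∈ V := by
  refine hV.mem_of_flow (-1) (fun j => (linShift (-1) (-1) j v.1, geomShift (-1) 1 j v.2)) ?_ ?_ j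
  · rw [geomShift_zero]
    exact hv
  · intro j
    ext1
    · funext a
      have h := linShift_flow (s := -1) (by norm_num) (-1) j v.1 a
      simp only [Prod.smul_fst, Pi.smul_apply, Prod.fst_sum, Finset.sum_apply, flowOp]
      rw [h]
      congr 1
      refine Finset.sum_congr rfl fun p _ => ?_
      rw [neg_one_smul, sub_neg_eq_add]
      congr 2
      push_cast [Nat.succPNat_coe]; ring
    · funext a
      have h := geomShift_flow (s := -1) (by norm_num) 1 j v.2 a
      simp only [Prod.smul_snd, Pi.smul_apply, Prod.snd_sum, Finset.sum_apply, flowOp]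
      rw [h]
      congr 1
      refine Finset.sum_congr rfl fun p _ => ?_
      rw [neg_one_smul, ← sub_eq_add_neg]
      congr 2
      push_cast [Nat.succPNat_coe]; ring

/-- A wave space is stable under the shift of `e^{∑ t_k z^k} f` and `e^{-∑ t_k z^{-k}} f'` to
`t + [x]`. -/
theorem IsWaveSpace.shiftPlus_mem {V : Submodule TSeries (ZSeries ℕ+ × ZSeries ℕ+)}
    (hV : IsWaveSpace V) {v : ZSeries ℕ+ × ZSeries ℕ+} (hv : v ∈ V) (j : ℕ) :
    (geomShift 1 (-1) j v.1, linShift 1 1 j v.2) ∈ V := by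
  refine hV.mem_of_flow 1 (fun j => (geomShift 1 (-1) j v.1, linShift 1 1 j v.2)) ?_ ?_ j
  · rw [geomShift_zero]
    exact hv
  · intro j
    ext1
    · funext a
      have h := geomShift_flow (s := 1) (by norm_num) (-1) j v.1 a
      simp only [Prod.smul_fst, Pi.smul_apply, Prod.fst_sum, Finset.sum_apply, flowOp]
      rw [h]
      congr 1
      refine Finset.sum_congr rfl fun p _ => ?_
      rw [one_smul]
      congr 2
      push_cast [Nat.succPNat_coe]; ring
    · funext a
      have h := linShift_flow (s := 1) (by norm_num) 1 j v.2 a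
      simp only [Prod.smul_snd, Pi.smul_apply, Prod.snd_sum, Finset.sum_apply, flowOp]
      rw [h]
      congr 1
      refine Finset.sum_congr rfl fun p _ => ?_
      rw [one_smul]
      congr 2
      push_cast [Nat.succPNat_coe]; ring

/-! ### The shift along the diagonal -/

/-- The power series `F(t + s[x], x)`, for `F = F(t, x)`. -/
def diagShift (s : ℂ) (F : PowerSeries TSeries) : PowerSeries TSeries :=
  PowerSeries.mk fun n => ∑ p ∈ antidiagonal n, shiftCoeff s p.2 (PowerSeries.coeff p.1 F)

theorem diagShift_mul_C (s : ℂ) (F : PowerSeries TSeries) (c : TSeries) :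
    diagShift s (F * PowerSeries.C c) = diagShift s F * shiftHom s c := by
  ext1 n
  rw [PowerSeries.coeff_mul]
  simp only [diagShift, PowerSeries.coeff_mk, PowerSeries.coeff_mul_C, shiftCoeff_mul,
    coeff_shiftHom]
  rw [sum_antidiagonal_assoc n fun l i r =>
    shiftCoeff s i (PowerSeries.coeff l F) * shiftCoeff s r c]
  simp only [Finset.sum_mul]

/-- `f(t - s[x])` becomes `f(t)` when `t` is shifted by `s[x]`. -/
theorem diagShift_shiftHom_neg (s : ℂ) (f : TSeries) :
    diagShift s (shiftHom (-s) f) = PowerSeries.C f := by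
  ext1 n
  rw [diagShift, PowerSeries.coeff_mk, PowerSeries.coeff_C]
  simp only [coeff_shiftHom]
  rcases n with _ | n
  · simp [shiftCoeff_zero]
  · rw [if_neg n.succ_ne_zero, ← sum_shiftCoeff_neg s n f, ← Finset.Nat.sum_antidiagonal_swap]
    rfl

theorem coeff_mul_diagShift (s : ℂ) (u F : PowerSeries TSeries) (n : ℕ) :
    PowerSeries.coeff n (u * diagShift s F) = ∑ p ∈ antidiagonal n, ∑ q ∈ antidiagonal p.1,
      PowerSeries.coeff q.1 u * shiftCoeff s p.2 (PowerSeries.coeff q.2 F) := by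
  rw [← sum_antidiagonal_assoc n fun i l r =>
    PowerSeries.coeff i u * shiftCoeff s r (PowerSeries.coeff l F), PowerSeries.coeff_mul]
  simp [diagShift, Finset.mul_sum]

/-! ### Identities between wave functions from isotropy -/

/-- `z^{-N} f` for a series `f` in `z^{-1}` starting with `z^N`, as a power series in `z^{-1}`. -/
def upSeries (N : ℤ) (f : ZSeries ℕ+) : PowerSeries TSeries := PowerSeries.mk fun i => f (N - i)

/-- `z^{-N} f` for a series `f` in `z` starting with `z^N`, as a power series in `z`. -/
def downSeries (N : ℤ) (f : ZSeries ℕ+) : PowerSeries TSeries := PowerSeries.mk fun i => f (N + i)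

theorem coeff_upSeries (N : ℤ) (f : ZSeries ℕ+) (i : ℕ) :
    PowerSeries.coeff i (upSeries N f) = f (N - i) := PowerSeries.coeff_mk _ _

theorem coeff_downSeries (N : ℤ) (f : ZSeries ℕ+) (i : ℕ) :
    PowerSeries.coeff i (downSeries N f) = f (N + i) := PowerSeries.coeff_mk _ _

theorem linShift_succ_apply (s : ℂ) (ε : ℤ) (j : ℕ) (f : ZSeries ℕ+) (a : ℤ) :
    linShift s ε (j + 1) f a = shiftCoeff s (j + 1) (f a) - shiftCoeff s j (f (a + ε)) := rfl

theorem StartsAt.geomShift {N : ℤ} {g : ZSeries ℕ+} (hg : StartsAt N g) (s : ℂ) (j : ℕ) :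
    StartsAt (N - j) (geomShift s 1 j g) := by
  intro a ha
  refine Finset.sum_eq_zero fun p hp => ?_
  have := Finset.HasAntidiagonal.mem_antidiagonal.1 hp
  rw [hg _ (by omega), shiftCoeff_map_zero]

theorem UpTo.linShift {N : ℤ} {f : ZSeries ℕ+} (hf : UpTo N f) (s : ℂ) (j : ℕ) :
    UpTo (N + 1) (linShift s (-1) j f) := by
  intro a ha
  rcases j with _ | j
  · exact hf a (by omega)
  · rw [linShift_succ_apply, hf a (by omega), hf _ (by omega), shiftCoeff_map_zero,
      shiftCoeff_map_zero, sub_zero]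

theorem StartsAt.linShift {N : ℤ} {f : ZSeries ℕ+} (hf : StartsAt N f) (s : ℂ) (j : ℕ) :
    StartsAt (N - 1) (linShift s 1 j f) := by
  intro a ha
  rcases j with _ | j
  · exact hf a (by omega)
  · rw [linShift_succ_apply, hf a (by omega), hf _ (by omega), shiftCoeff_map_zero,
      shiftCoeff_map_zero, sub_zero]

/-- The pairing of `f` with the shifted sequence `g(t + s[x]) / (1 - x E)`, expanded. -/
theorem zPair_geomShift {N N' : ℤ} {f g : ZSeries ℕ+} (hf : UpTo N f) (hg : StartsAt N' g) (s : ℂ)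
    (j : ℕ) : zPair f (geomShift s 1 j g) =
      ∑ p ∈ antidiagonal j, zPair f (fun a => shiftCoeff s p.2 (g (a + p.1))) := by
  have h : geomShift s 1 j g =
      ∑ p ∈ antidiagonal j, fun a => shiftCoeff s p.2 (g (a + p.1)) := by
    funext a
    rw [geomShift, Finset.sum_apply]
    simp only [one_mul]
  rw [h]
  refine zPair_sum_right (N' := N' - j) hf _ fun p hp a ha => ?_
  have := Finset.HasAntidiagonal.mem_antidiagonal.1 hp
  rw [hg _ (by omega), shiftCoeff_map_zero]

/-- The pairing is the coefficient of `x^{j+1}` in `u(t, x) u'(t + s[x], x)` without the term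
`u_0(t) u'_0(t + s[x])`, for `u = z^{-N} f` and `u' = z^{1-N} g`. -/
theorem zPair_geomShift_adjacent {N : ℤ} {f g : ZSeries ℕ+} (hf : UpTo N f)
    (hg : StartsAt (N - 1) g) (s : ℂ) (j : ℕ) :
    zPair f (geomShift s 1 j g) =
      PowerSeries.coeff (j + 1) (upSeries N f * diagShift s (downSeries (N - 1) g)) -
        f N * shiftCoeff s (j + 1) (g (N - 1)) := by
  rw [zPair_geomShift hf hg, coeff_mul_diagShift, Finset.Nat.sum_antidiagonal_succ]
  simp only [Finset.Nat.antidiagonal_zero, Finset.sum_singleton, coeff_upSeries, coeff_downSeries]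
  have h0 : f (N - ((0 : ℕ) : ℤ)) * shiftCoeff s (j + 1) (g (N - 1 + ((0 : ℕ) : ℤ))) =
      f N * shiftCoeff s (j + 1) (g (N - 1)) := by simp
  rw [h0, add_sub_cancel_left]
  refine Finset.sum_congr rfl fun p _ => ?_
  rw [zPair_eq_antidiagonal (N' := N - 1 - p.1) hf
    (fun a ha => by rw [hg _ (by omega), shiftCoeff_map_zero]) (p.1 + 1) (by push_cast; ring)]
  refine Finset.sum_congr rfl fun q _ => ?_
  congr 3
  ring

theorem zPair_geomShift_same {N : ℤ} {f g : ZSeries ℕ+} (hf : UpTo N f)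
    (hg : StartsAt (N + 1) g) (s : ℂ) (j : ℕ) :
    zPair f (geomShift s 1 (j + 1) g) =
      PowerSeries.coeff j (upSeries N f * diagShift s (downSeries (N + 1) g)) := by
  rw [zPair_geomShift hf hg, coeff_mul_diagShift, Finset.Nat.sum_antidiagonal_succ]
  simp only [coeff_upSeries, coeff_downSeries]
  rw [zPair_eq_zero hf (N' := N + 1) (fun a ha => by
    rw [hg _ (by simpa using ha), shiftCoeff_map_zero]) (by omega), zero_add]
  refine Finset.sum_congr rfl fun p _ => ?_
  rw [zPair_eq_antidiagonal (N' := N - p.1) hf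
    (fun a ha => by rw [hg _ (by push_cast; omega), shiftCoeff_map_zero]) p.1 (by ring)]
  refine Finset.sum_congr rfl fun q _ => ?_
  congr 3
  push_cast; ring

section

variable {V : Submodule TSeries (ZSeries ℕ+ × ZSeries ℕ+)} {N : ℤ}
  {v w : ZSeries ℕ+ × ZSeries ℕ+}

/-- Isotropy of `v` and the shift of `w` by `-[x]`, for elements whose leading exponents differ by `2`:
only the pairing of `v.1` with the shift of `w.2` contributes. For `u = z^{-N} v.1` and
`u' = z^{1-N} w.2` it says `u(t, x) u'(t - [x], x) = u_0(t) u'_0(t - [x])`. -/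
theorem IsWaveSpace.mul_diagShift_adjacent (hV : IsWaveSpace V) (hv : v ∈ V) (hw : w ∈ V)
    (hv1 : UpTo N v.1) (hv2 : StartsAt (N + 1) v.2) (hw1 : UpTo (N - 2) w.1)
    (hw2 : StartsAt (N - 1) w.2) :
    upSeries N v.1 * diagShift (-1) (downSeries (N - 1) w.2) =
      PowerSeries.C (v.1 N) * shiftHom (-1) (w.2 (N - 1)) := by
  ext1 j
  rw [PowerSeries.coeff_C_mul, coeff_shiftHom]
  rcases j with _ | j
  · rw [coeff_mul_diagShift]
    simp [coeff_upSeries, coeff_downSeries]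
  · have h := hV.isotropic v hv _ (hV.shiftMinus_mem hw j)
    rw [zPair_eq_zero (hw1.linShift (-1) j) hv2 (by omega), add_zero,
      zPair_geomShift_adjacent hv1 hw2, sub_eq_zero] at h
    exact h

/-- The relation obtained by shifting `v` by `[x]` instead:
`u(t + [x], x) u'(t, x) = u_0(t + [x]) u'_0(t)`. -/
theorem IsWaveSpace.diagShift_mul_adjacent (hV : IsWaveSpace V) (hv : v ∈ V) (hw : w ∈ V)
    (hv1 : UpTo N v.1) (hv2 : StartsAt (N + 1) v.2) (hw1 : UpTo (N - 2) w.1)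
    (hw2 : StartsAt (N - 1) w.2) :
    diagShift 1 (upSeries N v.1) * downSeries (N - 1) w.2 =
      shiftHom 1 (v.1 N) * PowerSeries.C (w.2 (N - 1)) := by
  rw [mul_comm]
  ext1 j
  rw [PowerSeries.coeff_mul_C, coeff_shiftHom]
  rcases j with _ | j
  · rw [coeff_mul_diagShift]
    simp [coeff_upSeries, coeff_downSeries, mul_comm]
  · have h := hV.isotropic _ (hV.shiftPlus_mem hv j) w hw
    have e : geomShift 1 (-1) j v.1 =
        ∑ p ∈ antidiagonal j, fun a => shiftCoeff 1 p.2 (v.1 (a - p.1)) := by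
      funext a
      rw [geomShift, Finset.sum_apply]
      refine Finset.sum_congr rfl fun p _ => ?_
      congr 2
      exact congrArg v.1 (by ring)
    rw [zPair_eq_zero hw1 (hv2.linShift 1 j) (by omega), add_zero, e,
      zPair_sum_left (N := N + j) hw2] at h
    · rw [coeff_mul_diagShift, Finset.Nat.sum_antidiagonal_succ]
      simp only [Finset.Nat.antidiagonal_zero, Finset.sum_singleton, coeff_upSeries,
        coeff_downSeries]
      rw [add_eq_left.2]
      · simp [mul_comm]
      rw [← h]
      refine Finset.sum_congr rfl fun p _ => ?_
      rw [zPair_eq_antidiagonal (N := N + p.1) (fun a ha => by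
        rw [hv1 _ (by omega), shiftCoeff_map_zero]) hw2 (p.1 + 1) (by push_cast; ring),
        ← Finset.Nat.sum_antidiagonal_swap]
      refine Finset.sum_congr rfl fun q _ => ?_
      rw [mul_comm]
      simp only [Prod.fst_swap, Prod.snd_swap]
      congr 3
      exact congrArg v.1 (by ring)
    · intro p hp a ha
      have := Finset.HasAntidiagonal.mem_antidiagonal.1 hp
      simp only
      rw [hv1 _ (by omega), shiftCoeff_map_zero]

/-- Isotropy of `v` and the shift of `w` by `-[x]`, for elements with the same leading exponents: here
both pairings contribute, the second by a single term. -/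
theorem IsWaveSpace.mul_diagShift_same (hV : IsWaveSpace V) (hv : v ∈ V) (hw : w ∈ V)
    (hv1 : UpTo N v.1) (hv2 : StartsAt (N + 1) v.2) (hw1 : UpTo N w.1)
    (hw2 : StartsAt (N + 1) w.2) :
    upSeries N v.1 * diagShift (-1) (downSeries (N + 1) w.2) =
      PowerSeries.C (v.2 (N + 1)) * shiftHom (-1) (w.1 N) := by
  ext1 j
  have h := hV.isotropic v hv _ (hV.shiftMinus_mem hw (j + 1))
  rw [zPair_eq_antidiagonal (hw1.linShift (-1) (j + 1)) hv2 0 (by simp),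
    zPair_geomShift_same hv1 hw2] at h
  rw [eq_neg_of_add_eq_zero_left h, PowerSeries.coeff_C_mul, coeff_shiftHom]
  simp [linShift, hw1 (N + 1) (by omega), mul_comm]

/-- Isotropy for a shift of `w` by `-[x] - [y]`: the resulting expression is symmetric in
`x` and `y`. -/
theorem IsWaveSpace.symm_adjacent (hV : IsWaveSpace V) (hv : v ∈ V) (hw : w ∈ V)
    (hv1 : UpTo N v.1) (hv2 : StartsAt (N + 1) v.2) (hw1 : UpTo (N - 2) w.1)
    (hw2 : StartsAt (N - 1) w.2) (i j : ℕ) :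
    PowerSeries.coeff i (upSeries N v.1 *
        diagShift (-1) (downSeries (N - 1) fun a => shiftCoeff (-1) j (w.2 a))) =
      PowerSeries.coeff j (upSeries N v.1 *
        diagShift (-1) (downSeries (N - 1) fun a => shiftCoeff (-1) i (w.2 a))) := by
  have hpair : ∀ i j, zPair v.1 (geomShift (-1) 1 i (geomShift (-1) 1 j w.2)) = 0 := by
    intro i j
    have h := hV.isotropic v hv _ (hV.shiftMinus_mem (hV.shiftMinus_mem hw j) i)
    rwa [zPair_eq_zero ((hw1.linShift (-1) j).linShift (-1) i) hv2 (by omega), add_zero] at h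
  have h0 : ∀ j, PowerSeries.coeff 0 (upSeries N v.1 *
        diagShift (-1) (downSeries (N - 1) fun a => shiftCoeff (-1) j (w.2 a))) =
      PowerSeries.coeff j (upSeries N v.1 *
        diagShift (-1) (downSeries (N - 1) fun a => shiftCoeff (-1) 0 (w.2 a))) := by
    intro j
    simp only [shiftCoeff_zero]
    rw [hV.mul_diagShift_adjacent hv hw hv1 hv2 hw1 hw2, PowerSeries.coeff_C_mul, coeff_shiftHom,
      coeff_mul_diagShift]
    simp [coeff_upSeries, coeff_downSeries, shiftCoeff_zero]
  rcases i with _ | i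
  · exact h0 j
  rcases j with _ | j
  · exact (h0 (i + 1)).symm
  have hst : ∀ k, StartsAt (N - 1) fun a => shiftCoeff (-1) k (w.2 a) := fun k a ha => by
    simp only [hw2 a ha, shiftCoeff_map_zero]
  have hi := zPair_geomShift_adjacent hv1 (hst (j + 1)) (-1) i
  have hj := zPair_geomShift_adjacent hv1 (hst (i + 1)) (-1) j
  have hsub : geomShift (-1) 1 i (geomShift (-1) 1 (j + 1) w.2) -
        geomShift (-1) 1 (i + 1) (geomShift (-1) 1 j w.2) =
      geomShift (-1) 1 i (fun a => shiftCoeff (-1) (j + 1) (w.2 a)) -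
        geomShift (-1) 1 j (fun a => shiftCoeff (-1) (i + 1) (w.2 a)) := by
    funext a
    rw [Pi.sub_apply, Pi.sub_apply, geomShift_succ (-1) 1 i]
    have h1 : geomShift (-1) 1 i (geomShift (-1) 1 (j + 1) w.2) a =
        geomShift (-1) 1 i (fun a => shiftCoeff (-1) (j + 1) (w.2 a)) a +
          geomShift (-1) 1 i (geomShift (-1) 1 j w.2) (a + 1) := by
      simp only [geomShift.eq_def (-1) 1 i, ← Finset.sum_add_distrib]
      refine Finset.sum_congr rfl fun p _ => ?_
      rw [geomShift_succ, shiftCoeff_add, add_right_comm a]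
    have h2 : shiftCoeff (-1) (i + 1) (geomShift (-1) 1 j w.2 a) =
        geomShift (-1) 1 j (fun a => shiftCoeff (-1) (i + 1) (w.2 a)) a := by
      simp only [geomShift, shiftCoeff_sum]
      exact Finset.sum_congr rfl fun p _ => shiftCoeff_comm _ _ _ _ _
    rw [h1, h2]
    abel
  have hz := congrArg (zPair v.1) hsub
  rw [zPair_sub_right (N' := N - 1 - (i + 1 : ℕ) - (j + 1 : ℕ)) hv1
      (((hw2.geomShift (-1) (j + 1)).geomShift (-1) i).mono (by push_cast; omega))
      (((hw2.geomShift (-1) j).geomShift (-1) (i + 1)).mono (by push_cast; omega)),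
    zPair_sub_right (N' := N - 1 - (i + 1 : ℕ) - (j + 1 : ℕ)) hv1
      (((hst (j + 1)).geomShift (-1) i).mono (by push_cast; omega))
      (((hst (i + 1)).geomShift (-1) j).mono (by push_cast; omega)),
    hpair, hpair, hi, hj, shiftCoeff_comm (-1) (-1) (j + 1) (i + 1)] at hz
  linear_combination -hz

end

/-! ### Bilinear identities in two sets of times -/

section

variable {σ τ : Type}

/-- A family of power series that is stable under all derivatives and has no constant terms
consists of zeros. -/
theorem eq_zero_of_pderiv_mem (S : Set (MvPowerSeries σ ℂ))
    (h0 : ∀ f ∈ S, MvPowerSeries.constantCoeff f = 0) (hS : ∀ f ∈ S, ∀ i, pderiv ℂ i f ∈ S)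
    {f : MvPowerSeries σ ℂ} (hf : f ∈ S) : f = 0 := by
  classical
  suffices H : ∀ (n : ℕ) (d : σ →₀ ℕ), d.degree = n → ∀ f ∈ S, MvPowerSeries.coeff d f = 0 by
    ext d
    exact H _ d rfl f hf
  intro n
  induction n with
  | zero =>
    intro d hd f hf
    rw [(Finsupp.degree_eq_zero_iff d).1 hd, MvPowerSeries.coeff_zero_eq_constantCoeff]
    exact h0 f hf
  | succ n ih =>
    intro d hd f hf
    obtain ⟨i, hi⟩ : ∃ i, d i ≠ 0 := by
      by_contra hcon
      push Not at hcon
      have : d = 0 := Finsupp.ext hcon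
      simp [this] at hd
    obtain ⟨e, rfl⟩ : ∃ e, d = e + Finsupp.single i 1 := by
      refine ⟨d - Finsupp.single i 1, (tsub_add_cancel_of_le ?_).symm⟩
      rw [Finsupp.single_le_iff]
      omega
    have h := ih e (by simpa using hd) _ (hS f hf i)
    rw [MvPowerSeries.coeff_pderiv] at h
    exact (mul_eq_zero.1 h).resolve_right (by exact_mod_cast (e i).succ_ne_zero)

theorem pderiv_rename_apply (e : σ ↪ τ) (k : σ) (f : MvPowerSeries σ ℂ) :
    pderiv ℂ (e k) (MvPowerSeries.rename e f) = MvPowerSeries.rename e (pderiv ℂ k f) := by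
  classical
  ext d
  rw [MvPowerSeries.coeff_pderiv]
  by_cases hd : d ∈ Set.range (Finsupp.mapDomain (M := ℕ) e)
  · obtain ⟨c, rfl⟩ := hd
    have h : Finsupp.mapDomain e c + Finsupp.single (e k) 1 =
        Finsupp.embDomain e (c + Finsupp.single k 1) := by
      rw [Finsupp.embDomain_eq_mapDomain, Finsupp.mapDomain_add, Finsupp.mapDomain_single]
    rw [h, MvPowerSeries.coeff_embDomain_rename, ← Finsupp.embDomain_eq_mapDomain,
      MvPowerSeries.coeff_embDomain_rename, MvPowerSeries.coeff_pderiv,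
      Finsupp.embDomain_apply_self]
  · rw [MvPowerSeries.coeff_rename_eq_zero _ _ hd, MvPowerSeries.coeff_rename_eq_zero, zero_mul]
    rintro ⟨c, hc⟩
    have hck : c k ≠ 0 := by
      have := DFunLike.congr_fun hc (e k)
      rw [Finsupp.mapDomain_apply e.injective] at this
      simp at this
      omega
    apply hd
    refine ⟨c - Finsupp.single k 1, ?_⟩
    have hc' : c = (c - Finsupp.single k 1) + Finsupp.single k 1 := by
      refine (tsub_add_cancel_of_le ?_).symm
      rw [Finsupp.single_le_iff]; omega
    rw [hc', Finsupp.mapDomain_add, Finsupp.mapDomain_single] at hc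
    exact add_right_cancel hc

theorem pderiv_rename_eq_zero (e : σ ↪ τ) {k : τ} (hk : k ∉ Set.range e) (f : MvPowerSeries σ ℂ) :
    pderiv ℂ k (MvPowerSeries.rename e f) = 0 := by
  classical
  ext d
  rw [MvPowerSeries.coeff_pderiv, MvPowerSeries.coeff_rename_eq_zero, zero_mul, map_zero]
  rintro ⟨c, hc⟩
  have := DFunLike.congr_fun hc k
  rw [Finsupp.mapDomain_of_notMem_range _ _ hk] at this
  simp at this

section ExpMul

variable [DecidableEq σ]

theorem sum_antidiagonal_add_single (d : σ →₀ ℕ) (k : σ) (f : (σ →₀ ℕ) → (σ →₀ ℕ) → ℂ) :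
    ∑ p ∈ antidiagonal (d + Finsupp.single k 1 : σ →₀ ℕ), (p.1 k : ℂ) * f p.1 p.2 =
      ∑ p ∈ antidiagonal d, ((p.1 k : ℂ) + 1) * f (p.1 + Finsupp.single k 1) p.2 := by
  symm
  refine Finset.sum_of_injOn (fun p => (p.1 + Finsupp.single k 1, p.2)) ?_ ?_ ?_ ?_
  · rintro ⟨a, b⟩ - ⟨a', b'⟩ - h
    simp only [Prod.mk.injEq, add_left_inj] at h
    exact Prod.ext h.1 h.2
  · rintro ⟨a, b⟩ h
    simp only [Finset.mem_coe, Finset.HasAntidiagonal.mem_antidiagonal] at h ⊢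
    rw [← h]; abel
  · rintro ⟨a, b⟩ h hn
    have : a k = 0 := by
      by_contra hak
      apply hn
      have ha : a - Finsupp.single k 1 + Finsupp.single k 1 = a := by
        refine tsub_add_cancel_of_le ?_
        rw [Finsupp.single_le_iff]; omega
      refine ⟨(a - Finsupp.single k 1, b), ?_, ?_⟩
      · simp only [Finset.mem_coe, Finset.HasAntidiagonal.mem_antidiagonal] at h ⊢
        apply add_right_cancel (b := Finsupp.single k 1)
        rw [← h, add_right_comm, ha]
      · simp only [ha]
    simp [this]
  · rintro ⟨a, b⟩ -
    simp

theorem coeff_expMul (v : σ → ℂ) (w : σ → ℤ) (F : ZSeries σ) (N : ℤ) (d : σ →₀ ℕ) :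
    MvPowerSeries.coeff d (expMul v w F N) =
      ∑ p ∈ antidiagonal d, (p.1.prod fun i k => v i ^ k / (k.factorial : ℂ)) *
        MvPowerSeries.coeff p.2 (F (N - p.1.sum fun i k => (k : ℤ) * w i)) := rfl

/-- The product rule for multiplication by `exp(∑_i v_i x_i z^{w_i})`. -/
theorem pderiv_expMul (v : σ → ℂ) (w : σ → ℤ) (F : ZSeries σ) (k : σ) (N : ℤ) :
    pderiv ℂ k (expMul v w F N) = expMul v w (fun M => pderiv ℂ k (F M)) N +
      v k • expMul v w F (N - w k) := by
  ext d
  have hE : ∀ a : σ →₀ ℕ, ((a k : ℂ) + 1) *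
      ((a + Finsupp.single k 1).prod fun i k => v i ^ k / (k.factorial : ℂ)) =
      v k * a.prod fun i k => v i ^ k / (k.factorial : ℂ) := by
    intro a
    have h1 := Finsupp.mul_prod_erase' (a + Finsupp.single k 1) k
      (fun i k => v i ^ k / (k.factorial : ℂ)) (by simp)
    have h2 := Finsupp.mul_prod_erase' a k (fun i k => v i ^ k / (k.factorial : ℂ)) (by simp)
    have h3 : (a + Finsupp.single k 1).erase k = a.erase k := by
      rw [Finsupp.erase_add, Finsupp.erase_single, add_zero]
    rw [← h1, ← h2, h3]
    have h4 : (a + Finsupp.single k 1 : σ →₀ ℕ) k = a k + 1 := by simp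
    rw [h4, Nat.factorial_succ, pow_succ]
    have : ((a k : ℂ) + 1) ≠ 0 := by exact_mod_cast (a k).succ_ne_zero
    have : ((a k).factorial : ℂ) ≠ 0 := by exact_mod_cast (a k).factorial_ne_zero
    push_cast
    field_simp
  have hW : ∀ a : σ →₀ ℕ, ((a + Finsupp.single k 1).sum fun i k => (k : ℤ) * w i) =
      (a.sum fun i k => (k : ℤ) * w i) + w k := by
    intro a
    rw [Finsupp.sum_add_index' (by simp) (by intros; push_cast; ring),
      Finsupp.sum_single_index (by simp)]
    simp
  rw [MvPowerSeries.coeff_pderiv, coeff_expMul, Finset.sum_mul, map_add, map_smul, smul_eq_mul,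
    coeff_expMul, coeff_expMul]
  have hsplit : ∀ p ∈ antidiagonal (d + Finsupp.single k 1),
      (p.1.prod fun i k => v i ^ k / (k.factorial : ℂ)) *
        MvPowerSeries.coeff p.2 (F (N - p.1.sum fun i k => (k : ℤ) * w i)) * ((d k : ℂ) + 1) =
      (p.2 k : ℂ) * ((p.1.prod fun i k => v i ^ k / (k.factorial : ℂ)) *
        MvPowerSeries.coeff p.2 (F (N - p.1.sum fun i k => (k : ℤ) * w i))) +
      (p.1 k : ℂ) * ((p.1.prod fun i k => v i ^ k / (k.factorial : ℂ)) *
        MvPowerSeries.coeff p.2 (F (N - p.1.sum fun i k => (k : ℤ) * w i))) := by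
    intro p hp
    have := DFunLike.congr_fun (Finset.HasAntidiagonal.mem_antidiagonal.1 hp) k
    simp only [Finsupp.add_apply, Finsupp.single_eq_same] at this
    have h' : ((d k : ℂ) + 1) = p.1 k + p.2 k := by exact_mod_cast this.symm
    rw [h']; ring
  rw [Finset.sum_congr rfl hsplit, Finset.sum_add_distrib]
  congr 1
  · have hswap : ∀ c : σ →₀ ℕ, ∀ f : (σ →₀ ℕ) → (σ →₀ ℕ) → ℂ,
        ∑ p ∈ antidiagonal c, f p.1 p.2 = ∑ p ∈ antidiagonal c, f p.2 p.1 := fun c f =>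
      (Finset.sum_equiv (Equiv.prodComm _ _) (by
        intro p
        simp [Finset.HasAntidiagonal.mem_antidiagonal, add_comm]) (by intros; rfl))
    rw [hswap _ fun a b => (b k : ℂ) * ((a.prod fun i k => v i ^ k / (k.factorial : ℂ)) *
        MvPowerSeries.coeff b (F (N - a.sum fun i k => (k : ℤ) * w i))),
      sum_antidiagonal_add_single d k fun b a => ((a.prod fun i k => v i ^ k / (k.factorial : ℂ)) *
        MvPowerSeries.coeff b (F (N - a.sum fun i k => (k : ℤ) * w i))),
      hswap _ fun b a => ((b k : ℂ) + 1) * ((a.prod fun i k => v i ^ k / (k.factorial : ℂ)) *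
        MvPowerSeries.coeff (b + Finsupp.single k 1) (F (N - a.sum fun i k => (k : ℤ) * w i)))]
    refine Finset.sum_congr rfl fun p _ => ?_
    rw [MvPowerSeries.coeff_pderiv]
    ring
  · rw [sum_antidiagonal_add_single d k fun a b =>
      ((a.prod fun i k => v i ^ k / (k.factorial : ℂ)) *
        MvPowerSeries.coeff b (F (N - a.sum fun i k => (k : ℤ) * w i))), Finset.mul_sum]
    refine Finset.sum_congr rfl fun p _ => ?_
    rw [← mul_assoc, hE, hW, ← sub_sub, sub_right_comm, mul_assoc]

theorem expMul_add (v : σ → ℂ) (w : σ → ℤ) (F G : ZSeries σ) (N : ℤ) :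
    expMul v w (fun M => F M + G M) N = expMul v w F N + expMul v w G N := by
  ext d
  rw [map_add, coeff_expMul, coeff_expMul, coeff_expMul, ← Finset.sum_add_distrib]
  simp only [map_add, mul_add]

theorem expMul_smul (v : σ → ℂ) (w : σ → ℤ) (c : ℂ) (F : ZSeries σ) (N : ℤ) :
    expMul v w (fun M => c • F M) N = c • expMul v w F N := by
  ext d
  rw [map_smul, coeff_expMul, coeff_expMul, Finset.smul_sum]
  refine Finset.sum_congr rfl fun p _ => ?_
  rw [map_smul, smul_eq_mul, smul_eq_mul]
  ring

theorem expMul_sub_apply (v : σ → ℂ) (w : σ → ℤ) (c : ℤ) (F : ZSeries σ) (N : ℤ) :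
    expMul v w F (N - c) = expMul v w (fun M => F (M - c)) N := by
  ext d
  rw [coeff_expMul, coeff_expMul]
  refine Finset.sum_congr rfl fun p _ => ?_
  rw [sub_right_comm]

theorem constantCoeff_expMul (v : σ → ℂ) (w : σ → ℤ) (F : ZSeries σ) (N : ℤ) :
    MvPowerSeries.constantCoeff (expMul v w F N) = MvPowerSeries.constantCoeff (F N) := by
  rw [← MvPowerSeries.coeff_zero_eq_constantCoeff_apply,
    ← MvPowerSeries.coeff_zero_eq_constantCoeff_apply, coeff_expMul]
  simp

end ExpMul

end

/-- The coefficients of `f(t, z) g(t', z⁻¹)`, with `t` and `t'` independent. -/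
def crossProd (f g : ZSeries ℕ+) : ZSeries (ℕ+ ⊕ ℕ+) := fun N =>
  zPair (fun a => MvPowerSeries.rename (Function.Embedding.inl : ℕ+ ↪ ℕ+ ⊕ ℕ+) (f a))
    (fun a => MvPowerSeries.rename (Function.Embedding.inr : ℕ+ ↪ ℕ+ ⊕ ℕ+) (g (a - N)))

/-- All coefficients of `f(t, z) g(t', z⁻¹)` are finite sums. -/
def Pairable (f g : ZSeries ℕ+) : Prop := ∀ c, {a | f a ≠ 0 ∧ g (a - c) ≠ 0}.Finite

theorem Pairable.of_upTo {N N' : ℤ} {f g : ZSeries ℕ+} (hf : UpTo N f) (hg : StartsAt N' g) :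
    Pairable f g := fun c => (Set.finite_Icc (N' + c) N).subset fun a ha => by
  constructor
  · by_contra hcon
    exact ha.2 (hg _ (by omega))
  · by_contra hcon
    exact ha.1 (hf _ (by omega))

theorem Pairable.of_startsAt {N N' : ℤ} {f g : ZSeries ℕ+} (hf : StartsAt N f) (hg : UpTo N' g) :
    Pairable f g := fun c => (Set.finite_Icc N (N' + c)).subset fun a ha => by
  constructor
  · by_contra hcon
    exact ha.1 (hf _ (by omega))
  · by_contra hcon
    exact ha.2 (hg _ (by omega))

section

variable {f f' g g' : ZSeries ℕ+}

theorem Pairable.support_finite (h : Pairable f g) (N : ℤ) : (Function.support fun a =>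
    MvPowerSeries.rename (Function.Embedding.inl : ℕ+ ↪ ℕ+ ⊕ ℕ+) (f a) *
      MvPowerSeries.rename (Function.Embedding.inr : ℕ+ ↪ ℕ+ ⊕ ℕ+) (g (a - N))).Finite := by
  refine (h N).subset fun a ha => ?_
  rw [Function.mem_support] at ha
  constructor
  · intro h0
    exact ha (by rw [h0, map_zero, zero_mul])
  · intro h0
    exact ha (by rw [h0, map_zero, mul_zero])

theorem Pairable.pderiv_left (h : Pairable f g) (k : ℕ+) :
    Pairable (fun a => pderiv ℂ k (f a)) g := fun c => (h c).subset fun a ha =>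
  ⟨fun h0 => ha.1 (by simp only [h0, map_zero]), ha.2⟩

theorem Pairable.pderiv_right (h : Pairable f g) (k : ℕ+) :
    Pairable f (fun a => pderiv ℂ k (g a)) := fun c => (h c).subset fun a ha =>
  ⟨ha.1, fun h0 => ha.2 (by simp only [h0, map_zero])⟩

theorem Pairable.shift_left (h : Pairable f g) (k : ℤ) : Pairable (fun a => f (a + k)) g := by
  intro c
  refine ((h (c + k)).preimage (f := fun a => a + k)
    (add_left_injective k).injOn).subset fun a ha => ?_
  exact ⟨ha.1, by rw [add_sub_add_right_eq_sub]; exact ha.2⟩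

theorem Pairable.shift_right (h : Pairable f g) (k : ℤ) : Pairable f (fun a => g (a + k)) := by
  intro c
  refine (h (c - k)).subset fun a ha => ⟨ha.1, ?_⟩
  rw [← sub_add]
  exact ha.2

theorem crossProd_add_left (h : Pairable f g) (h' : Pairable f' g) (N : ℤ) :
    crossProd (fun a => f a + f' a) g N = crossProd f g N + crossProd f' g N := by
  simp only [crossProd, zPair, map_add, add_mul]
  exact finsum_add_distrib (h.support_finite N) (h'.support_finite N)

theorem crossProd_add_right (h : Pairable f g) (h' : Pairable f g') (N : ℤ) :
    crossProd f (fun a => g a + g' a) N = crossProd f g N + crossProd f g' N := by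
  simp only [crossProd, zPair, map_add, mul_add]
  exact finsum_add_distrib (h.support_finite N) (h'.support_finite N)

theorem crossProd_neg_left (N : ℤ) : crossProd (fun a => -f a) g N = -crossProd f g N := by
  simp only [crossProd, zPair, map_neg, neg_mul]
  exact finsum_neg_distrib _

theorem crossProd_neg_right (N : ℤ) : crossProd f (fun a => -g a) N = -crossProd f g N := by
  simp only [crossProd, zPair, map_neg, mul_neg]
  exact finsum_neg_distrib _

theorem crossProd_shift_left (k N : ℤ) :
    crossProd (fun a => f (a + k)) g N = crossProd f g (N + k) := by
  simp only [crossProd, zPair]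
  refine finsum_eq_of_bijective (fun a => a + k) (Equiv.addRight k).bijective fun a => ?_
  rw [add_sub_add_right_eq_sub]

theorem crossProd_shift_right (k N : ℤ) :
    crossProd f (fun a => g (a + k)) N = crossProd f g (N - k) := by
  simp only [crossProd, zPair, ← sub_add]

theorem pderiv_crossProd_inl (h : Pairable f g) (k : ℕ+) (N : ℤ) :
    pderiv ℂ (Sum.inl k) (crossProd f g N) = crossProd (fun a => pderiv ℂ k (f a)) g N := by
  rw [crossProd, zPair, map_finsum _ (h.support_finite N), crossProd, zPair]
  refine finsum_congr fun a => ?_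
  have h1 := pderiv_rename_apply (Function.Embedding.inl : ℕ+ ↪ ℕ+ ⊕ ℕ+) k (f a)
  have h2 := pderiv_rename_eq_zero (Function.Embedding.inr : ℕ+ ↪ ℕ+ ⊕ ℕ+) (k := Sum.inl k)
    (by simp) (g (a - N))
  rw [Function.Embedding.inl_apply] at h1
  rw [Derivation.leibniz, h2, h1, smul_zero, zero_add, smul_eq_mul, mul_comm]

theorem pderiv_crossProd_inr (h : Pairable f g) (k : ℕ+) (N : ℤ) :
    pderiv ℂ (Sum.inr k) (crossProd f g N) = crossProd f (fun a => pderiv ℂ k (g a)) N := by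
  rw [crossProd, zPair, map_finsum _ (h.support_finite N), crossProd, zPair]
  refine finsum_congr fun a => ?_
  have h1 := pderiv_rename_apply (Function.Embedding.inr : ℕ+ ↪ ℕ+ ⊕ ℕ+) k (g (a - N))
  have h2 := pderiv_rename_eq_zero (Function.Embedding.inl : ℕ+ ↪ ℕ+ ⊕ ℕ+) (k := Sum.inr k)
    (by simp) (f a)
  rw [Function.Embedding.inr_apply] at h1
  rw [Derivation.leibniz, h2, h1, smul_zero, add_zero, smul_eq_mul]

theorem constantCoeff_crossProd (h : Pairable f g) :
    MvPowerSeries.constantCoeff (crossProd f g 0) = MvPowerSeries.constantCoeff (zPair f g) := by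
  have h' : (Function.support fun a => f a * g a).Finite := by
    refine (h 0).subset fun a ha => ?_
    rw [Function.mem_support] at ha
    rw [Set.mem_ofPred_eq, sub_zero]
    exact ⟨left_ne_zero_of_mul ha, right_ne_zero_of_mul ha⟩
  rw [crossProd, zPair, zPair, map_finsum _ (h.support_finite 0), map_finsum _ h']
  refine finsum_congr fun a => ?_
  rw [map_mul, map_mul, sub_zero, MvPowerSeries.constantCoeff_rename,
    MvPowerSeries.constantCoeff_rename]

end

/-- The sum of the two residues in the bilinear identity for the wave functions `v` and `w`. -/
def crossForm (v w : ZSeries ℕ+ × ZSeries ℕ+) : MvPowerSeries (ℕ+ ⊕ ℕ+) ℂ :=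
  expMul (Sum.elim (fun _ => 1) fun _ => -1)
      (Sum.elim (fun k : ℕ+ => (k : ℤ)) fun k : ℕ+ => (k : ℤ)) (crossProd v.1 w.2) 0 +
    expMul (Sum.elim (fun _ => -1) fun _ => 1)
      (Sum.elim (fun k : ℕ+ => -(k : ℤ)) fun k : ℕ+ => -(k : ℤ)) (crossProd v.2 w.1) 0

section

variable {v w : ZSeries ℕ+ × ZSeries ℕ+}

theorem pderiv_crossForm_inl (h1 : Pairable v.1 w.2) (h2 : Pairable v.2 w.1) (k : ℕ+) :
    pderiv ℂ (Sum.inl k) (crossForm v w) = crossForm (flowOp k v) w := by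
  rw [crossForm, map_add, pderiv_expMul, pderiv_expMul, expMul_sub_apply, expMul_sub_apply,
    ← expMul_smul, ← expMul_smul, ← expMul_add, ← expMul_add, crossForm]
  congr 2
  · funext N
    simp only [Sum.elim_inl, one_smul, flowOp, pderiv_crossProd_inl h1]
    simp only [sub_eq_add_neg]
    rw [crossProd_add_left (h1.pderiv_left k) (h1.shift_left (-k)), crossProd_shift_left]
  · funext N
    simp only [Sum.elim_inl, neg_one_smul, flowOp, pderiv_crossProd_inl h2, sub_neg_eq_add]
    simp only [sub_eq_add_neg]
    rw [crossProd_add_left (f' := fun a => -v.2 (a + k)) (h2.pderiv_left k), crossProd_neg_left,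
      crossProd_shift_left]
    intro c
    simpa using h2.shift_left k c

theorem pderiv_crossForm_inr (h1 : Pairable v.1 w.2) (h2 : Pairable v.2 w.1) (k : ℕ+) :
    pderiv ℂ (Sum.inr k) (crossForm v w) = crossForm v (flowOp k w) := by
  rw [crossForm, map_add, pderiv_expMul, pderiv_expMul, expMul_sub_apply, expMul_sub_apply,
    ← expMul_smul, ← expMul_smul, ← expMul_add, ← expMul_add, crossForm]
  congr 2
  · funext N
    simp only [Sum.elim_inr, neg_one_smul, flowOp, pderiv_crossProd_inr h1]
    simp only [sub_eq_add_neg]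
    rw [crossProd_add_right (g' := fun a => -w.2 (a + k)) (h1.pderiv_right k),
      crossProd_neg_right, crossProd_shift_right, sub_eq_add_neg]
    intro c
    simpa using h1.shift_right k c
  · funext N
    simp only [Sum.elim_inr, one_smul, flowOp, pderiv_crossProd_inr h2, sub_neg_eq_add]
    simp only [sub_eq_add_neg]
    rw [crossProd_add_right (h2.pderiv_right k) (h2.shift_right (-k)), crossProd_shift_right,
      sub_neg_eq_add]

end

/-- The bilinear identity: isotropy and stability under the flows allow independent times. -/
theorem IsWaveSpace.crossForm_eq_zero {V : Submodule TSeries (ZSeries ℕ+ × ZSeries ℕ+)}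
    (hV : IsWaveSpace V) {v w : ZSeries ℕ+ × ZSeries ℕ+} (hv : v ∈ V) (hw : w ∈ V) :
    crossForm v w = 0 := by
  have hp : ∀ v ∈ V, ∀ w ∈ V, Pairable v.1 w.2 ∧ Pairable v.2 w.1 := by
    intro v hv w hw
    obtain ⟨_, h1⟩ := hV.upTo v hv
    obtain ⟨_, h2⟩ := hV.upTo w hw
    obtain ⟨_, h3⟩ := hV.startsAt v hv
    obtain ⟨_, h4⟩ := hV.startsAt w hw
    exact ⟨Pairable.of_upTo h1 h4, Pairable.of_startsAt h3 h2⟩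
  refine eq_zero_of_pderiv_mem {F | ∃ v ∈ V, ∃ w ∈ V, F = crossForm v w} ?_ ?_ ⟨v, hv, w, hw, rfl⟩
  · rintro _ ⟨v, hv, w, hw, rfl⟩
    rw [crossForm, map_add, constantCoeff_expMul, constantCoeff_expMul]
    rw [constantCoeff_crossProd (hp v hv w hw).1, constantCoeff_crossProd (hp v hv w hw).2,
      ← map_add, zPair_comm v.2, hV.isotropic v hv w hw, map_zero]
  · rintro _ ⟨v, hv, w, hw, rfl⟩ (k | k)
    · exact ⟨_, hV.flow v hv k, w, hw, pderiv_crossForm_inl (hp v hv w hw).1 (hp v hv w hw).2 k⟩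
    · exact ⟨v, hv, _, hV.flow w hw k, pderiv_crossForm_inr (hp v hv w hw).1 (hp v hv w hw).2 k⟩

theorem shiftPlus_natCast (f : TSeries) (i : ℕ) : shiftPlus f i = shiftCoeff 1 i f := by
  simp [shiftPlus_apply]

theorem shiftMinus_neg_natCast (f : TSeries) (i : ℕ) : shiftMinus f (-i) = shiftCoeff (-1) i f := by
  simp [shiftMinus_apply]

theorem startsAt_shiftPlus (N : ℤ) (f : TSeries) : StartsAt N (zMul N (shiftPlus f)) := by
  intro a ha
  rw [zMul, shiftPlus_apply, if_neg (by omega)]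

theorem upTo_shiftMinus (N : ℤ) (f : TSeries) : UpTo N (zMul N (shiftMinus f)) := by
  intro a ha
  rw [zMul, shiftMinus_apply, if_neg (by omega)]

theorem coeff_miwaHom_inl (s : ℂ) (f : TSeries) (i : ℕ) :
    PowerSeries.coeff i (MvPowerSeries.optionEquivLeft (ℕ+ ⊕ ℕ+) ℂ (miwa s Sum.inl f)) =
      MvPowerSeries.rename (Function.Embedding.inl : ℕ+ ↪ ℕ+ ⊕ ℕ+) (shiftCoeff s i f) := by
  rw [← miwaHom_apply s Sum.inl_injective, coeff_miwaHom, MvPowerSeries.rename_eq_subst]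
  rfl

theorem coeff_miwaHom_inr (s : ℂ) (f : TSeries) (i : ℕ) :
    PowerSeries.coeff i (MvPowerSeries.optionEquivLeft (ℕ+ ⊕ ℕ+) ℂ (miwa s Sum.inr f)) =
      MvPowerSeries.rename (Function.Embedding.inr : ℕ+ ↪ ℕ+ ⊕ ℕ+) (shiftCoeff s i f) := by
  rw [← miwaHom_apply s Sum.inr_injective, coeff_miwaHom, MvPowerSeries.rename_eq_subst]
  rfl

theorem crossProd_shiftMinus_shiftPlus (α β N : ℤ) (F G : TSeries) :
    crossProd (zMul α (shiftMinus F)) (zMul β (shiftPlus G)) N =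
      evalZinv (miwa (-1) Sum.inl F * miwa 1 Sum.inr G) (N - (α - β)) := by
  have hf : UpTo α fun a => MvPowerSeries.rename (Function.Embedding.inl : ℕ+ ↪ ℕ+ ⊕ ℕ+)
      (zMul α (shiftMinus F) a) := fun a ha => by
    simp only [upTo_shiftMinus α F a ha, map_zero]
  have hg : StartsAt (β + N) fun a => MvPowerSeries.rename
      (Function.Embedding.inr : ℕ+ ↪ ℕ+ ⊕ ℕ+) (zMul β (shiftPlus G) (a - N)) := fun a ha => by
    simp only [startsAt_shiftPlus β G (a - N) (by omega), map_zero]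
  rw [crossProd, evalZinv, evalZ_apply]
  split_ifs with h
  · obtain ⟨k, hk⟩ := Int.eq_ofNat_of_zero_le h
    rw [zPair_eq_antidiagonal hf hg k (by omega), hk, Int.toNat_natCast, map_mul,
      PowerSeries.coeff_mul]
    refine Finset.sum_congr rfl fun p _ => ?_
    rw [coeff_miwaHom_inl, coeff_miwaHom_inr, ← shiftMinus_neg_natCast, ← shiftPlus_natCast]
    simp only [zMul]
    congr 3 <;> ring
  · exact zPair_eq_zero hf hg (by omega)

theorem crossProd_shiftPlus_shiftMinus (α β N : ℤ) (F G : TSeries) :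
    crossProd (zMul α (shiftPlus F)) (zMul β (shiftMinus G)) N =
      evalZ (miwa 1 Sum.inl F * miwa (-1) Sum.inr G) (N - (α - β)) := by
  have hf : StartsAt α fun a => MvPowerSeries.rename (Function.Embedding.inl : ℕ+ ↪ ℕ+ ⊕ ℕ+)
      (zMul α (shiftPlus F) a) := fun a ha => by
    simp only [startsAt_shiftPlus α F a ha, map_zero]
  have hg : UpTo (β + N) fun a => MvPowerSeries.rename
      (Function.Embedding.inr : ℕ+ ↪ ℕ+ ⊕ ℕ+) (zMul β (shiftMinus G) (a - N)) := fun a ha => by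
    simp only [upTo_shiftMinus β G (a - N) (by omega), map_zero]
  rw [crossProd, zPair_comm, evalZ_apply]
  split_ifs with h
  · obtain ⟨k, hk⟩ := Int.eq_ofNat_of_zero_le h
    rw [zPair_eq_antidiagonal hg hf k (by omega), hk, Int.toNat_natCast, map_mul,
      PowerSeries.coeff_mul, ← Finset.Nat.sum_antidiagonal_swap]
    refine Finset.sum_congr rfl fun p _ => ?_
    rw [coeff_miwaHom_inl, coeff_miwaHom_inr, ← shiftMinus_neg_natCast, ← shiftPlus_natCast,
      mul_comm]
    simp only [zMul, Prod.fst_swap, Prod.snd_swap]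
    congr 3 <;> ring
  · exact zPair_eq_zero hg hf (by omega)

theorem residue_expMul_zMul {σ : Type} [DecidableEq σ] (v : σ → ℂ) (w : σ → ℤ) (c : ℤ)
    (F : ZSeries σ) :
    residue (expMul v w (zMul c F)) = expMul v w (fun M => F (M - (c + 1))) 0 := by
  rw [residue, ← zero_sub, expMul_sub_apply]
  simp only [zMul, sub_sub, add_comm]

theorem crossForm_tau {ι : Type} [CommSemiring ι] [LinearOrder ι] [Div ι] [Algebra ι ℤ]
    (τ : ι → TSeries) (n m : ι) :
    crossForm (zMul (2 * algebraMap ι ℤ n) (shiftMinus (τ n)),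
        zMul (2 * algebraMap ι ℤ n + 1) (shiftPlus (τ (n + 1))))
      (zMul (2 * algebraMap ι ℤ m) (shiftMinus (τ m)),
        zMul (2 * algebraMap ι ℤ m + 1) (shiftPlus (τ (m + 1)))) = bilinear τ n m := by
  rw [crossForm, bilinear, residue_expMul_zMul, residue_expMul_zMul]
  congr 2
  · funext N
    rw [crossProd_shiftMinus_shiftPlus]
    congr 1; ring
  · funext N
    rw [crossProd_shiftPlus_shiftMinus]
    congr 1; ring

/-! ### Rows and columns of infinite matrices -/

/-- The index set is a half-line or a line of integers: its order and its floor division by `2` come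
from `ℤ`, and it contains every integer above one of its elements. -/
class IntIndex (ι : Type) [CommSemiring ι] [LinearOrder ι] [Div ι] [Algebra ι ℤ] : Prop where
  algebraMap_strictMono : StrictMono (algebraMap ι ℤ)
  algebraMap_div_two : ∀ i : ι, algebraMap ι ℤ (i / 2) = algebraMap ι ℤ i / 2
  exists_algebraMap_eq : ∀ (i : ι) (N : ℤ), algebraMap ι ℤ i ≤ N → ∃ j, algebraMap ι ℤ j = N

instance : IntIndex ℕ where
  algebraMap_strictMono i j h := by simpa using h
  algebraMap_div_two i := by simp
  exists_algebraMap_eq i N h := ⟨N.toNat, by simp at h ⊢; omega⟩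

instance : IntIndex ℤ where
  algebraMap_strictMono i j h := by simpa using h
  algebraMap_div_two i := by simp
  exists_algebraMap_eq i N h := ⟨N, by simp⟩

section

set_option linter.unusedSectionVars false

variable {ι : Type} [CommSemiring ι] [LinearOrder ι] [Div ι] [Algebra ι ℤ]

theorem algebraMap_two_mul (n : ι) : algebraMap ι ℤ (2 * n) = 2 * algebraMap ι ℤ n := by
  rw [map_mul, map_ofNat]

theorem algebraMap_two_mul_add_one (n : ι) :
    algebraMap ι ℤ (2 * n + 1) = 2 * algebraMap ι ℤ n + 1 := by
  rw [map_add, map_one, algebraMap_two_mul]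

theorem algebraMap_add_one (n : ι) : algebraMap ι ℤ (n + 1) = algebraMap ι ℤ n + 1 := by
  rw [map_add, map_one]

variable [IntIndex ι]

theorem algebraMap_int_injective : Function.Injective (algebraMap ι ℤ) :=
  IntIndex.algebraMap_strictMono.injective

theorem algebraMap_int_lt {i j : ι} : algebraMap ι ℤ i < algebraMap ι ℤ j ↔ i < j :=
  IntIndex.algebraMap_strictMono.lt_iff_lt

theorem two_mul_div_two (n : ι) : 2 * n / 2 = n := by
  apply algebraMap_int_injective
  rw [IntIndex.algebraMap_div_two, algebraMap_two_mul]
  omega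

theorem two_mul_add_one_div_two (n : ι) : (2 * n + 1) / 2 = n := by
  apply algebraMap_int_injective
  rw [IntIndex.algebraMap_div_two, algebraMap_two_mul_add_one]
  omega

theorem exists_eq_two_mul_or (i : ι) : ∃ n, i = 2 * n ∨ i = 2 * n + 1 := by
  refine ⟨i / 2, ?_⟩
  rcases Int.emod_two_eq (algebraMap ι ℤ i) with h | h
  · left
    apply algebraMap_int_injective
    rw [algebraMap_two_mul, IntIndex.algebraMap_div_two]
    omega
  · right
    apply algebraMap_int_injective
    rw [algebraMap_two_mul_add_one, IntIndex.algebraMap_div_two]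
    omega

theorem even_two_mul' (n : ι) : Even (2 * n) := ⟨n, two_mul n⟩

theorem not_even_two_mul_add_one (n : ι) : ¬Even (2 * n + 1) := by
  rintro ⟨m, hm⟩
  have := congrArg (algebraMap ι ℤ) hm
  rw [algebraMap_two_mul_add_one, map_add] at this
  omega

theorem rowZ_algebraMap (A : Matrix ι ι TSeries) (i a : ι) : rowZ A i (algebraMap ι ℤ a) = A i a := by
  rw [rowZ, finsum_eq_single _ a, if_pos rfl]
  intro b hb
  rw [if_neg fun h => hb (algebraMap_int_injective h)]

theorem rowZ_of_notMem (A : Matrix ι ι TSeries) (i : ι) {N : ℤ}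
    (hN : N ∉ Set.range (algebraMap ι ℤ)) : rowZ A i N = 0 := by
  rw [rowZ, finsum_eq_zero_of_forall_eq_zero]
  intro a
  rw [if_neg fun h => hN ⟨a, h⟩]

theorem zPair_rowZ (A B : Matrix ι ι TSeries) (i j : ι) :
    zPair (rowZ A i) (rowZ B j) = ∑ᶠ k, A i k * B j k := by
  rw [zPair, ← finsum_mem_univ, ← finsum_mem_inter_support, ← finsum_mem_univ (M := TSeries)]
  have h : ∑ᶠ a ∈ Set.range (algebraMap ι ℤ), rowZ A i a * rowZ B j a =
      ∑ᶠ k, rowZ A i (algebraMap ι ℤ k) * rowZ B j (algebraMap ι ℤ k) :=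
    finsum_mem_range algebraMap_int_injective
  simp only [rowZ_algebraMap] at h
  rw [finsum_mem_univ, ← h, ← finsum_mem_inter_support _ (Set.range _)]
  congr 1
  funext a
  by_cases ha : a ∈ Set.range (algebraMap ι ℤ)
  · simp [ha]
  · simp [rowZ_of_notMem A i ha]

theorem infMul_apply_eq_zPair (A B : Matrix ι ι TSeries) (i j : ι) :
    (A ⊡ B) i j = zPair (rowZ A i) (rowZ Bᵀ j) := by
  rw [zPair_rowZ]
  rfl

theorem skewJ_two_mul (n l : ι) : (skewJ : Matrix ι ι TSeries) (2 * n) l =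
    if l = 2 * n + 1 then 1 else 0 := by
  rw [skewJ]
  simp only [even_two_mul', true_and]
  split_ifs with h1 h2
  · rfl
  · exact absurd (h2.2 ▸ even_two_mul' n) (by
      obtain ⟨⟨m, rfl⟩, -⟩ := h2
      rw [← two_mul]
      exact not_even_two_mul_add_one m)
  · rfl

theorem skewJ_two_mul_add_one (n l : ι) : (skewJ : Matrix ι ι TSeries) (2 * n + 1) l =
    if l = 2 * n then -1 else 0 := by
  rw [skewJ, if_neg fun h => not_even_two_mul_add_one n h.1]
  have h : (Even l ∧ 2 * n + 1 = l + 1) ↔ l = 2 * n := by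
    constructor
    · rintro ⟨-, h⟩
      apply algebraMap_int_injective
      have := congrArg (algebraMap ι ℤ) h
      rw [map_add, map_add] at this
      omega
    · rintro rfl
      exact ⟨even_two_mul' n, rfl⟩
  simp only [h]

theorem secondQ_two_mul (P : Matrix ι ι TSeries) (n k : ι) :
    secondQ P (2 * n) k = P k (2 * n + 1) := by
  rw [secondQ, infMul, finsum_eq_single _ (2 * n + 1), skewJ_two_mul, if_pos rfl, one_mul,
    Matrix.transpose_apply]
  intro l hl
  rw [skewJ_two_mul, if_neg hl, zero_mul]

theorem secondQ_two_mul_add_one (P : Matrix ι ι TSeries) (n k : ι) :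
    secondQ P (2 * n + 1) k = -P k (2 * n) := by
  rw [secondQ, infMul, finsum_eq_single _ (2 * n), skewJ_two_mul_add_one, if_pos rfl, neg_one_mul,
    Matrix.transpose_apply]
  intro l hl
  rw [skewJ_two_mul_add_one, if_neg hl, zero_mul]

theorem rowZ_congr {A B : Matrix ι ι TSeries} {i j : ι} (h : ∀ k, A i k = B j k) :
    rowZ A i = rowZ B j := by
  funext N
  simp only [rowZ, h]

theorem rowZ_transpose_odd (P : Matrix ι ι TSeries) (n : ι) :
    rowZ Pᵀ (2 * n + 1) = rowZ (secondQ P) (2 * n) :=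
  rowZ_congr fun k => (secondQ_two_mul P n k).symm

theorem rowZ_transpose_even (P : Matrix ι ι TSeries) (n : ι) :
    rowZ Pᵀ (2 * n) = -rowZ (secondQ P) (2 * n + 1) := by
  funext N
  by_cases hN : N ∈ Set.range (algebraMap ι ℤ)
  · obtain ⟨a, rfl⟩ := hN
    rw [Pi.neg_apply, rowZ_algebraMap, rowZ_algebraMap, secondQ_two_mul_add_one, neg_neg,
      Matrix.transpose_apply]
  · rw [Pi.neg_apply, rowZ_of_notMem _ _ hN, rowZ_of_notMem _ _ hN, neg_zero]

/-- The matrix is lower triangular. -/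
def IsLower (A : Matrix ι ι TSeries) : Prop := ∀ i j, i < j → A i j = 0

theorem IsLower.upTo_rowZ {A : Matrix ι ι TSeries} (hA : IsLower A) (i : ι) :
    UpTo (algebraMap ι ℤ i) (rowZ A i) := by
  intro N hN
  obtain ⟨j, rfl⟩ := IntIndex.exists_algebraMap_eq i N hN.le
  rw [rowZ_algebraMap]
  exact hA i j (algebraMap_int_lt.1 hN)

theorem IsLower.startsAt_rowZ_transpose {A : Matrix ι ι TSeries} (hA : IsLower A) (j : ι) :
    StartsAt (algebraMap ι ℤ j) (rowZ Aᵀ j) := by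
  intro N hN
  by_cases h : N ∈ Set.range (algebraMap ι ℤ)
  · obtain ⟨i, rfl⟩ := h
    rw [rowZ_algebraMap, Matrix.transpose_apply]
    exact hA i j (algebraMap_int_lt.1 hN)
  · exact rowZ_of_notMem _ _ h

theorem rowZ_infMul_shiftMat (A : Matrix ι ι TSeries) (i : ι) (N : ℤ) :
    rowZ (A ⊡ shiftMat) i (N + 1) = rowZ A i N := by
  by_cases h : N ∈ Set.range (algebraMap ι ℤ)
  · obtain ⟨k, rfl⟩ := h
    rw [← algebraMap_add_one, rowZ_algebraMap, rowZ_algebraMap, infMul, finsum_eq_single _ k]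
    · simp [shiftMat]
    · intro l hl
      rw [shiftMat, if_neg, mul_zero]
      intro h
      apply hl
      apply algebraMap_int_injective
      have := congrArg (algebraMap ι ℤ) h
      rw [map_add, map_add] at this
      omega
  · rw [rowZ_of_notMem _ _ h]
    by_cases h' : N + 1 ∈ Set.range (algebraMap ι ℤ)
    · obtain ⟨k, hk⟩ := h'
      rw [← hk, rowZ_algebraMap, infMul, finsum_eq_zero_of_forall_eq_zero]
      intro l
      rw [shiftMat, if_neg, mul_zero]
      rintro rfl
      apply h
      rw [algebraMap_add_one] at hk
      exact ⟨l, by omega⟩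
    · exact rowZ_of_notMem _ _ h'

end

/-! ### The τ-functions of a wave space -/

section

set_option linter.unusedSectionVars false

variable {ι : Type} [CommSemiring ι] [LinearOrder ι] [Div ι] [Algebra ι ℤ]

/-- The pair of rows of `Q` and `Q_2`, the coefficients of `Ψ_{1,i}` and `Ψ_{2,i}`. -/
def waveRow (Q P : Matrix ι ι TSeries) (i : ι) : ZSeries ℕ+ × ZSeries ℕ+ :=
  (rowZ Q i, rowZ (secondQ P) i)

/-- The condition `τ(t - [z⁻¹]) / τ(t) = ψ_{1,2n}`, cleared of denominators. -/
def IsTauFor (Q : Matrix ι ι TSeries) (n : ι) (τ : TSeries) : Prop :=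
  shiftHom (-1) τ * PowerSeries.C (Q (2 * n) (2 * n)) =
    PowerSeries.C τ * upSeries (2 * algebraMap ι ℤ n) (rowZ Q (2 * n))

/-- `τ n`, standing for `τ_{2n}`, describe the rows `2n` of `Q`, and `r n = τ_{2n} / c_{2n}` is a
square root of `τ_{2n} τ_{2n+2}`. -/
structure IsTauFamily (Q : Matrix ι ι TSeries) (τ r : ι → TSeries) : Prop where
  constantCoeff_ne : ∀ n, MvPowerSeries.constantCoeff (τ n) ≠ 0
  isTauFor : ∀ n, IsTauFor Q n (τ n)
  succ_mul : ∀ n, τ (n + 1) * Q (2 * n) (2 * n) ^ 2 = τ n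
  root_mul : ∀ n, r n * Q (2 * n) (2 * n) = τ n

variable [IntIndex ι] {Q P : Matrix ι ι TSeries}

theorem IsGkInverse.diag_mul (hQ : InGk Q) (hP : IsGkInverse Q P) (n : ι) :
    Q (2 * n) (2 * n) * P (2 * n) (2 * n) = 1 := by
  have h := congrFun (congrFun hP.mul_inv (2 * n)) (2 * n)
  rw [infMul, finsum_eq_single _ (2 * n), Matrix.one_apply_eq] at h
  · exact h
  · intro k hk
    rcases lt_or_gt_of_ne hk with hk | hk
    · rw [hP.mem.lower _ _ hk, mul_zero]
    · rw [hQ.lower _ _ hk, zero_mul]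

section rows

variable (hQ : InGk Q) (hP : InGk P) (n : ι)

include hQ in
theorem InGk.upTo_even : UpTo (2 * algebraMap ι ℤ n) (waveRow Q P (2 * n)).1 := by
  have h := IsLower.upTo_rowZ hQ.lower (2 * n)
  rwa [algebraMap_two_mul] at h

include hQ in
theorem InGk.upTo_odd : UpTo (2 * algebraMap ι ℤ n + 1) (waveRow Q P (2 * n + 1)).1 := by
  have h := IsLower.upTo_rowZ hQ.lower (2 * n + 1)
  rwa [algebraMap_two_mul_add_one] at h

include hP in
theorem InGk.startsAt_even :
    StartsAt (2 * algebraMap ι ℤ n + 1) (waveRow Q P (2 * n)).2 := by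
  have h := IsLower.startsAt_rowZ_transpose hP.lower (2 * n + 1)
  rwa [algebraMap_two_mul_add_one, rowZ_transpose_odd] at h

include hP in
theorem InGk.startsAt_odd :
    StartsAt (2 * algebraMap ι ℤ n) (waveRow Q P (2 * n + 1)).2 := by
  have h := IsLower.startsAt_rowZ_transpose hP.lower (2 * n)
  rw [algebraMap_two_mul, rowZ_transpose_even] at h
  intro a ha
  exact neg_eq_zero.1 (h a ha)

theorem waveRow_even_fst :
    (waveRow Q P (2 * n)).1 (2 * algebraMap ι ℤ n) = Q (2 * n) (2 * n) := by
  rw [← algebraMap_two_mul]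
  exact rowZ_algebraMap Q _ _

include hQ in
theorem InGk.waveRow_odd_fst :
    (waveRow Q P (2 * n + 1)).1 (2 * algebraMap ι ℤ n + 1) = Q (2 * n) (2 * n) := by
  rw [← algebraMap_two_mul_add_one, ← hQ.diag_eq]
  exact rowZ_algebraMap Q _ _

include hQ in
theorem InGk.waveRow_odd_fst_zero :
    (waveRow Q P (2 * n + 1)).1 (2 * algebraMap ι ℤ n) = 0 := by
  rw [← algebraMap_two_mul, ← hQ.offdiag n]
  exact rowZ_algebraMap Q _ _

include hP in
theorem InGk.waveRow_even_snd :
    (waveRow Q P (2 * n)).2 (2 * algebraMap ι ℤ n + 1) = P (2 * n) (2 * n) := by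
  rw [← algebraMap_two_mul_add_one, ← hP.diag_eq, waveRow, ← rowZ_transpose_odd]
  exact rowZ_algebraMap _ _ _

theorem waveRow_odd_snd :
    (waveRow Q P (2 * n + 1)).2 (2 * algebraMap ι ℤ n) = -P (2 * n) (2 * n) := by
  rw [← algebraMap_two_mul, ← secondQ_two_mul_add_one]
  exact rowZ_algebraMap _ _ _

end rows

variable {V : Submodule TSeries (ZSeries ℕ+ × ZSeries ℕ+)} (hQ : InGk Q) (hP : IsGkInverse Q P)
  (hV : IsWaveSpace V) (hmem : ∀ i, waveRow Q P i ∈ V)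

include hQ hP hV hmem

/-- The form is nondegenerate: an element whose first component has exponents below `2n` only, and
whose second component has exponents above `2n` only, vanishes. Pairing with the rows `i < 2n` removes
the first component from the top down, since the first components of these rows have too small
exponents to meet the second one; the rows `i ≥ 2n` then remove the second component. -/
theorem IsWaveSpace.eq_zero_of_upTo_startsAt {v : ZSeries ℕ+ × ZSeries ℕ+} (hv : v ∈ V) (n : ι)
    (h1 : UpTo (2 * algebraMap ι ℤ n - 1) v.1) (h2 : StartsAt (2 * algebraMap ι ℤ n + 1) v.2)
    (hsupp : ∀ N ∉ Set.range (algebraMap ι ℤ), v.1 N = 0) : v = 0 := by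
  have key1 : ∀ k : ℕ, UpTo (2 * algebraMap ι ℤ n - 1 - k) v.1 := by
    intro k
    induction k with
    | zero => simpa using h1
    | succ k ih =>
      intro N hN
      by_cases hN' : 2 * algebraMap ι ℤ n - 1 - k < N
      · exact ih N hN'
      obtain rfl : N = 2 * algebraMap ι ℤ n - 1 - k := by push_cast at hN; omega
      by_cases hr : 2 * algebraMap ι ℤ n - 1 - k ∈ Set.range (algebraMap ι ℤ)
      · obtain ⟨i, hi⟩ := hr
        obtain ⟨l, rfl | rfl⟩ := exists_eq_two_mul_or i
        · rw [algebraMap_two_mul] at hi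
          have h := hV.isotropic v hv _ (hmem (2 * l + 1))
          rw [zPair_eq_zero (InGk.upTo_odd hQ l) h2 (by omega), add_zero,
            zPair_eq_antidiagonal (N' := 2 * algebraMap ι ℤ l) ih (InGk.startsAt_odd hP.mem l) 0
              (by simp [hi])] at h
          simp only [Finset.Nat.antidiagonal_zero, Finset.sum_singleton, Nat.cast_zero, sub_zero,
            add_zero, waveRow_odd_snd] at h
          linear_combination -Q (2 * l) (2 * l) * h -
            v.1 (2 * algebraMap ι ℤ n - 1 - k) * hP.diag_mul hQ l
        · rw [algebraMap_two_mul_add_one] at hi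
          have h := hV.isotropic v hv _ (hmem (2 * l))
          rw [zPair_eq_zero (InGk.upTo_even hQ l) h2 (by omega), add_zero,
            zPair_eq_antidiagonal (N' := 2 * algebraMap ι ℤ l + 1) ih (InGk.startsAt_even hP.mem l)
              0 (by simp [hi])] at h
          simp only [Finset.Nat.antidiagonal_zero, Finset.sum_singleton, Nat.cast_zero, sub_zero,
            add_zero, hP.mem.waveRow_even_snd] at h
          linear_combination Q (2 * l) (2 * l) * h -
            v.1 (2 * algebraMap ι ℤ n - 1 - k) * hP.diag_mul hQ l
      · exact hsupp _ hr
  have hz1 : v.1 = 0 := by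
    funext N
    exact key1 (2 * algebraMap ι ℤ n - N).toNat N (by omega)
  have hpair : ∀ i, zPair (waveRow Q P i).1 v.2 = 0 := by
    intro i
    have h := hV.isotropic v hv _ (hmem i)
    rw [hz1] at h
    simpa [zPair] using h
  have key2 : ∀ k : ℕ, StartsAt (2 * algebraMap ι ℤ n + 1 + k) v.2 := by
    intro k
    induction k with
    | zero => simpa using h2
    | succ k ih =>
      intro N hN
      by_cases hN' : N < 2 * algebraMap ι ℤ n + 1 + k
      · exact ih N hN'
      obtain rfl : N = 2 * algebraMap ι ℤ n + 1 + k := by push_cast at hN; omega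
      obtain ⟨i, hi⟩ := IntIndex.exists_algebraMap_eq (2 * n) (2 * algebraMap ι ℤ n + 1 + k)
        (by rw [algebraMap_two_mul]; omega)
      obtain ⟨l, rfl | rfl⟩ := exists_eq_two_mul_or i
      · rw [algebraMap_two_mul] at hi
        have h := hpair (2 * l)
        rw [zPair_eq_antidiagonal (InGk.upTo_even hQ l) ih 0 (by simp [hi])] at h
        simp only [Finset.Nat.antidiagonal_zero, Finset.sum_singleton, Nat.cast_zero, sub_zero,
          add_zero, waveRow_even_fst] at h
        linear_combination P (2 * l) (2 * l) * h -
          v.2 (2 * algebraMap ι ℤ n + 1 + k) * hP.diag_mul hQ l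
      · rw [algebraMap_two_mul_add_one] at hi
        have h := hpair (2 * l + 1)
        rw [zPair_eq_antidiagonal (InGk.upTo_odd hQ l) ih 0 (by simp [hi])] at h
        simp only [Finset.Nat.antidiagonal_zero, Finset.sum_singleton, Nat.cast_zero, sub_zero,
          add_zero, hQ.waveRow_odd_fst] at h
        linear_combination P (2 * l) (2 * l) * h -
          v.2 (2 * algebraMap ι ℤ n + 1 + k) * hP.diag_mul hQ l
  ext1
  · exact hz1
  · funext N
    exact key2 (N - 2 * algebraMap ι ℤ n).toNat N (by omega)

/-- If `τ_{2n}` solves the shift equation for the row `2n`, then `τ_{2n+2} = c_{2n}^{-2} τ_{2n}` solves it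
for the row `2n + 2`, and conversely. Eliminating `ψ_{2,2n}(t - [x])` from the relations for adjacent
and for equal rows gives `ψ_{1,2n+2} / ψ_{1,2n} = c_{2n}(t)^2 / c_{2n}(t - [x])^2`. -/
theorem IsWaveSpace.isTauFor_succ (n : ι) {τ τ' : TSeries}
    (hτ : τ' * Q (2 * n) (2 * n) ^ 2 = τ) : IsTauFor Q n τ ↔ IsTauFor Q (n + 1) τ' := by
  have hN : 2 * algebraMap ι ℤ (n + 1) = 2 * algebraMap ι ℤ n + 2 := by
    rw [algebraMap_add_one]; ring
  have hv1 := InGk.upTo_even (P := P) hQ (n + 1)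
  have hv2 := InGk.startsAt_even (Q := Q) hP.mem (n + 1)
  have hw1 := InGk.upTo_even (P := P) hQ n
  have hw2 := InGk.startsAt_even (Q := Q) hP.mem n
  have hadj := hV.mul_diagShift_adjacent (hmem (2 * (n + 1))) (hmem (2 * n)) hv1 hv2
    (hw1.mono (by omega)) (hw2.mono (by omega))
  have hsame := hV.mul_diagShift_same (hmem (2 * n)) (hmem (2 * n)) hw1 hw2 hw1 hw2
  have hN' : 2 * algebraMap ι ℤ (n + 1) - 1 = 2 * algebraMap ι ℤ n + 1 := by omega
  rw [hN', waveRow_even_fst, hP.mem.waveRow_even_snd] at hadj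
  rw [waveRow_even_fst, hP.mem.waveRow_even_snd] at hsame
  rw [IsTauFor, IsTauFor]
  change _ = _ * upSeries _ (waveRow Q P (2 * n)).1 ↔
    _ = _ * upSeries _ (waveRow Q P (2 * (n + 1))).1
  have hc := hP.diag_mul hQ n
  have hc' := hP.diag_mul hQ (n + 1)
  generalize upSeries _ (waveRow Q P (2 * n)).1 = U at *
  generalize upSeries _ (waveRow Q P (2 * (n + 1))).1 = U' at *
  generalize diagShift _ (downSeries _ (waveRow Q P (2 * n)).2) = D at *
  generalize Q (2 * n) (2 * n) = c at *
  generalize P (2 * n) (2 * n) = p at *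
  generalize Q (2 * (n + 1)) (2 * (n + 1)) = c' at *
  generalize P (2 * (n + 1)) (2 * (n + 1)) = p' at *
  have e1 := congrArg (shiftHom (-1)) hτ
  have e2 := congrArg (PowerSeries.C (R := TSeries)) hτ
  have e3 := congrArg (shiftHom (-1)) hc
  have e4 := congrArg (PowerSeries.C (R := TSeries)) hc
  have e5 := congrArg (PowerSeries.C (R := TSeries)) hc'
  rw [map_mul, map_pow] at e1 e2
  rw [map_mul, map_one] at e3 e4 e5
  generalize shiftHom (-1) τ = Mτ at *
  generalize shiftHom (-1) τ' = Mτ' at *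
  generalize shiftHom (-1) c = Mc at *
  generalize shiftHom (-1) p = Mp at *
  generalize PowerSeries.C τ = Cτ at *
  generalize PowerSeries.C τ' = Cτ' at *
  generalize PowerSeries.C c = Cc at *
  generalize PowerSeries.C p = Cp at *
  generalize PowerSeries.C c' = Cc' at *
  generalize PowerSeries.C p' = Cp' at *
  -- The two relations, with `D` eliminated.
  have hU : U' * Cp * Mc = U * Cc' * Mp := by
    linear_combination U * hadj - U' * hsame
  subst e1 e2
  constructor
  · intro h
    linear_combination Cp * Mp ^ 2 * Cc' * h - Cτ' * Mp * Cc * hU -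
      Mτ' * Cc' * ((Mc * Mp + 1) * Cc * Cp * e3 + e4) + Cτ' * U' * (Cc * Cp * e3 + e4) +
      Cτ' * U * Mp ^ 2 * Cc' * Cc * e4
  · intro h
    grind

omit hQ hP hV hmem

section

variable {τ r : ι → TSeries} (hτ : IsTauFamily Q τ r) (n : ι)

include hτ

theorem IsTauFamily.mul_inv : τ n * (τ n)⁻¹ = 1 :=
  MvPowerSeries.mul_inv_cancel _ (hτ.constantCoeff_ne n)

theorem IsTauFamily.constantCoeff_root_ne : MvPowerSeries.constantCoeff (r n) ≠ 0 := by
  intro h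
  apply hτ.constantCoeff_ne n
  rw [← hτ.root_mul, map_mul, h, zero_mul]

theorem IsTauFamily.root_mul_inv : r n * (r n)⁻¹ = 1 :=
  MvPowerSeries.mul_inv_cancel _ (hτ.constantCoeff_root_ne n)

theorem IsTauFamily.diag_eq : Q (2 * n) (2 * n) = τ n * (r n)⁻¹ := by
  rw [← hτ.root_mul, mul_right_comm, hτ.root_mul_inv, one_mul]

include hQ hP in
theorem IsTauFamily.inv_diag_eq : P (2 * n) (2 * n) = r n * (τ n)⁻¹ := by
  linear_combination (-P (2 * n) (2 * n)) * hτ.mul_inv n -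
    (τ n)⁻¹ * P (2 * n) (2 * n) * hτ.root_mul n + r n * (τ n)⁻¹ * hP.diag_mul hQ n

include hQ hP in
theorem IsTauFamily.root_sq : r n ^ 2 = τ n * τ (n + 1) := by
  have hc := hP.diag_mul hQ n
  have h1 := hτ.succ_mul n
  have h2 := hτ.root_mul n
  generalize Q (2 * n) (2 * n) = c at *
  generalize P (2 * n) (2 * n) = p at *
  have h3 : r n = τ (n + 1) * c := by
    linear_combination (-r n + τ (n + 1) * c) * hc + p * h2 - p * h1
  linear_combination (r n) * h3 + τ (n + 1) * h2

include hQ in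
theorem IsTauFamily.rowZ_even : rowZ Q (2 * n) =
    zMul (2 * algebraMap ι ℤ n) (tMul (r n)⁻¹ (shiftMinus (τ n))) := by
  funext N
  by_cases hN : 2 * algebraMap ι ℤ n < N
  · rw [zMul, tMul, shiftMinus_apply, if_neg (by omega), mul_zero]
    exact InGk.upTo_even (P := Q) hQ n N hN
  obtain ⟨i, hi⟩ := Int.eq_ofNat_of_zero_le (a := 2 * algebraMap ι ℤ n - N) (by omega)
  obtain rfl : N = 2 * algebraMap ι ℤ n - i := by omega
  have h := congrArg (PowerSeries.coeff i) (hτ.isTauFor n)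
  rw [PowerSeries.coeff_mul_C, PowerSeries.coeff_C_mul, coeff_upSeries, coeff_shiftHom,
    hτ.diag_eq] at h
  rw [zMul, tMul, sub_sub_cancel_left, shiftMinus_neg_natCast]
  linear_combination (-(τ n)⁻¹) * h + (shiftCoeff (-1) i (τ n) * (r n)⁻¹ -
    rowZ Q (2 * n) (2 * algebraMap ι ℤ n - i)) * hτ.mul_inv n

include hQ hP hV hmem in
/-- The row `2n` of `Q_2`, from the relation between the rows `2n + 2` of `Q` and `2n` of `Q_2`. -/
theorem IsTauFamily.rowZ_secondQ_even : rowZ (secondQ P) (2 * n) =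
    zMul (2 * algebraMap ι ℤ n + 1) (tMul (r n)⁻¹ (shiftPlus (τ (n + 1)))) := by
  have hN : 2 * algebraMap ι ℤ (n + 1) = 2 * algebraMap ι ℤ n + 2 := by
    rw [algebraMap_add_one]; ring
  have hN' : 2 * algebraMap ι ℤ (n + 1) - 1 = 2 * algebraMap ι ℤ n + 1 := by omega
  have hadj := hV.diagShift_mul_adjacent (hmem (2 * (n + 1))) (hmem (2 * n))
    (InGk.upTo_even hQ (n + 1)) (InGk.startsAt_even hP.mem (n + 1))
    ((InGk.upTo_even hQ n).mono (by omega)) ((InGk.startsAt_even hP.mem n).mono (by omega))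
  rw [hN', waveRow_even_fst, hP.mem.waveRow_even_snd] at hadj
  have hup : upSeries (2 * algebraMap ι ℤ (n + 1)) (waveRow Q P (2 * (n + 1))).1 =
      shiftHom (-1) (τ (n + 1)) * PowerSeries.C (r (n + 1))⁻¹ := by
    ext1 i
    simp only [coeff_upSeries, waveRow]
    rw [hτ.rowZ_even hQ, PowerSeries.coeff_mul_C, coeff_shiftHom, zMul, tMul,
      sub_sub_cancel_left, shiftMinus_neg_natCast, mul_comm]
  have hd := diagShift_shiftHom_neg 1 (τ (n + 1))
  rw [hup, diagShift_mul_C, hd, hτ.diag_eq, map_mul, hτ.inv_diag_eq hQ hP] at hadj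
  have hroot : shiftHom 1 (r (n + 1)) * shiftHom 1 (r (n + 1))⁻¹ = 1 := by
    rw [← map_mul, hτ.root_mul_inv, map_one]
  have hC : PowerSeries.C (τ (n + 1)) * PowerSeries.C (τ (n + 1))⁻¹ = 1 := by
    rw [← map_mul, hτ.mul_inv, map_one]
  have hrt : r n * (τ n)⁻¹ * (τ (n + 1))⁻¹ = (r n)⁻¹ := by
    linear_combination (-(r n * (τ n)⁻¹ * (τ (n + 1))⁻¹)) * hτ.root_mul_inv n +
      (r n)⁻¹ * (τ n)⁻¹ * (τ (n + 1))⁻¹ * hτ.root_sq hQ hP n +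
      (r n)⁻¹ * τ (n + 1) * (τ (n + 1))⁻¹ * hτ.mul_inv n + (r n)⁻¹ * hτ.mul_inv (n + 1)
  have hC2 := congrArg (PowerSeries.C (R := TSeries)) hrt
  rw [map_mul] at hC2
  have hdown : downSeries (2 * algebraMap ι ℤ n + 1) (waveRow Q P (2 * n)).2 =
      shiftHom 1 (τ (n + 1)) * PowerSeries.C (r n)⁻¹ := by
    rw [← hC2]
    generalize PowerSeries.C (r n * (τ n)⁻¹) = x at *
    generalize downSeries _ (waveRow Q P (2 * n)).2 = D at *
    generalize shiftHom 1 (r (n + 1))⁻¹ = a at *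
    generalize shiftHom 1 (r (n + 1)) = b at *
    generalize PowerSeries.C (τ (n + 1)) = t at *
    generalize PowerSeries.C (τ (n + 1))⁻¹ = t' at *
    generalize shiftHom 1 (τ (n + 1)) = S at *
    grind
  funext N
  by_cases hN : N < 2 * algebraMap ι ℤ n + 1
  · rw [zMul, tMul, shiftPlus_apply, if_neg (by omega), mul_zero]
    exact InGk.startsAt_even (Q := Q) hP.mem n N hN
  obtain ⟨i, hi⟩ := Int.eq_ofNat_of_zero_le (a := N - (2 * algebraMap ι ℤ n + 1)) (by omega)
  obtain rfl : N = 2 * algebraMap ι ℤ n + 1 + i := by omega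
  have h := congrArg (PowerSeries.coeff i) hdown
  rw [PowerSeries.coeff_mul_C, coeff_downSeries, coeff_shiftHom] at h
  rw [zMul, tMul, add_sub_cancel_left, shiftPlus_natCast, mul_comm (r n)⁻¹]
  exact h

include hQ hP hV hmem in
theorem IsTauFamily.waveRow_even : waveRow Q P (2 * n) =
    (r n)⁻¹ • (zMul (2 * algebraMap ι ℤ n) (shiftMinus (τ n)),
      zMul (2 * algebraMap ι ℤ n + 1) (shiftPlus (τ (n + 1)))) := by
  rw [waveRow, hτ.rowZ_even hQ, hτ.rowZ_secondQ_even hQ hP hV hmem]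
  rfl

include hQ hP hV hmem in
/-- The odd rows are the flow of `∂_1 + z` and `∂_1 - z^{-1}` on the even ones: the difference of the
two sides lies in the wave space and its leading coefficients cancel, so it vanishes by
nondegeneracy. -/
theorem IsTauFamily.waveRow_odd : waveRow Q P (2 * n + 1) =
    (r n)⁻¹ • flowOp 1 (zMul (2 * algebraMap ι ℤ n) (shiftMinus (τ n)),
      zMul (2 * algebraMap ι ℤ n + 1) (shiftPlus (τ (n + 1)))) := by
  set E : ZSeries ℕ+ × ZSeries ℕ+ := (zMul (2 * algebraMap ι ℤ n) (shiftMinus (τ n)),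
      zMul (2 * algebraMap ι ℤ n + 1) (shiftPlus (τ (n + 1)))) with hE
  have heven := hτ.waveRow_even hQ hP hV hmem n
  rw [← hE] at heven
  have hEmem : E ∈ V := by
    have : E = r n • waveRow Q P (2 * n) := by
      rw [heven, smul_smul, hτ.root_mul_inv, one_smul]
    rw [this]
    exact V.smul_mem _ (hmem _)
  have hEup : UpTo (2 * algebraMap ι ℤ n) E.1 := upTo_shiftMinus _ _
  have hEst : StartsAt (2 * algebraMap ι ℤ n + 1) E.2 := startsAt_shiftPlus _ _
  have hc := hτ.diag_eq n
  have hp := hτ.inv_diag_eq hQ hP n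
  have hE0 : E.1 (2 * algebraMap ι ℤ n) = τ n := by
    have := shiftMinus_neg_natCast (τ n) 0
    simpa [hE, zMul, shiftCoeff_zero] using this
  have hE1 : E.1 (2 * algebraMap ι ℤ n - 1) = -pderiv ℂ 1 (τ n) := by
    have := shiftMinus_neg_natCast (τ n) 1
    rw [shiftCoeff_one, neg_one_smul] at this
    simp only [hE, zMul, ← this]
    congr 1
    push_cast; ring
  have hE2 : E.2 (2 * algebraMap ι ℤ n + 1) = τ (n + 1) := by
    have := shiftPlus_natCast (τ (n + 1)) 0
    simpa [hE, zMul, shiftCoeff_zero] using this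
  have hodd1 : ∀ N, 2 * algebraMap ι ℤ n + 1 < N → (waveRow Q P (2 * n + 1)).1 N = 0 :=
    InGk.upTo_odd hQ n
  have hodd2 := InGk.startsAt_odd (Q := Q) hP.mem n
  rw [eq_comm, ← sub_eq_zero]
  refine hV.eq_zero_of_upTo_startsAt hQ hP hmem
    (V.sub_mem (V.smul_mem _ (hV.flow _ hEmem 1)) (hmem _)) n ?_ ?_ ?_
  · intro N hN
    change (r n)⁻¹ * (pderiv ℂ 1 (E.1 N) + E.1 (N - 1)) - (waveRow Q P (2 * n + 1)).1 N = 0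
    by_cases h0 : N = 2 * algebraMap ι ℤ n
    · subst h0
      rw [hE0, hE1, hQ.waveRow_odd_fst_zero]
      ring
    by_cases h1 : N = 2 * algebraMap ι ℤ n + 1
    · subst h1
      rw [hEup _ (by omega), add_sub_cancel_right, hE0, hQ.waveRow_odd_fst, hc, map_zero]
      ring
    rw [hEup _ (by omega), hEup _ (by omega), hodd1 _ (by omega), map_zero]
    ring
  · intro N hN
    change (r n)⁻¹ * (pderiv ℂ 1 (E.2 N) - E.2 (N + 1)) - (waveRow Q P (2 * n + 1)).2 N = 0
    by_cases h0 : N = 2 * algebraMap ι ℤ n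
    · subst h0
      rw [hEst _ (by omega), hE2, waveRow_odd_snd, hp, map_zero]
      linear_combination (r n)⁻¹ * τ (n + 1) * hτ.mul_inv n +
        (r n)⁻¹ * (τ n)⁻¹ * hτ.root_sq hQ hP n - r n * (τ n)⁻¹ * hτ.root_mul_inv n
    rw [hEst _ (by omega), hEst _ (by omega), hodd2 _ (by omega), map_zero]
    ring
  · intro N hN
    change (r n)⁻¹ * (pderiv ℂ 1 (E.1 N) + E.1 (N - 1)) - (waveRow Q P (2 * n + 1)).1 N = 0
    have hz : ∀ M ∉ Set.range (algebraMap ι ℤ), E.1 M = 0 := by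
      intro M hM
      have h : (waveRow Q P (2 * n)).1 M = 0 := rowZ_of_notMem _ _ hM
      rw [heven] at h
      change (r n)⁻¹ * E.1 M = 0 at h
      linear_combination r n * h - E.1 M * hτ.root_mul_inv n
    have hN1 : N - 1 ∉ Set.range (algebraMap ι ℤ) := by
      rintro ⟨i, hi⟩
      exact hN ⟨i + 1, by rw [algebraMap_add_one, hi]; ring⟩
    have hodd : (waveRow Q P (2 * n + 1)).1 N = 0 := rowZ_of_notMem _ _ hN
    rw [hz N hN, hz _ hN1, hodd, map_zero]
    ring

end

end

/-! ### The entries of the Lax matrix -/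

theorem dOne_mul (f g : TSeries) : dOne (f * g) = f * dOne g + g * dOne f :=
  Derivation.leibniz _ _ _

theorem dOne_inv {f : TSeries} (hf : MvPowerSeries.constantCoeff f ≠ 0) :
    dOne f⁻¹ = -(f⁻¹ * f⁻¹ * dOne f) := by
  have h := congrArg dOne (MvPowerSeries.mul_inv_cancel f hf)
  have h1 : dOne 1 = 0 := MvPowerSeries.pderiv_one
  rw [dOne_mul, h1] at h
  linear_combination f⁻¹ * h - dOne f⁻¹ * MvPowerSeries.mul_inv_cancel f hf

theorem MvPowerSeries.inv_eq_of_mul_eq_one {σ : Type} {f g : MvPowerSeries σ ℂ} (h : f * g = 1) :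
    f⁻¹ = g := by
  rw [MvPowerSeries.inv_eq_iff_mul_eq_one, mul_comm, h]
  intro h0
  have := congrArg MvPowerSeries.constantCoeff h
  rw [map_mul, h0, zero_mul, map_one] at this
  exact zero_ne_one this

section

set_option linter.unusedSectionVars false

variable {ι : Type} [CommSemiring ι] [LinearOrder ι] [Div ι] [Algebra ι ℤ] [IntIndex ι]
  {Q P : Matrix ι ι TSeries}

theorem UpTo.zMul_one {σ : Type} {N : ℤ} {f : ZSeries σ} (hf : UpTo N f) : UpTo (N + 1) (zMul 1 f) :=
  fun a ha => hf (a - 1) (by omega)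

section

variable {σ : Type} {N : ℤ} {f g : ZSeries σ}

theorem zPair_zMul_one_succ (hf : UpTo N f) (hg : StartsAt (N + 1) g) :
    zPair (zMul 1 f) g = f N * g (N + 1) := by
  rw [zPair_eq_antidiagonal hf.zMul_one hg 0 (by simp)]
  simp [zMul]

theorem zPair_zMul_one_same (hf : UpTo N f) (hg : StartsAt N g) :
    zPair (zMul 1 f) g = f (N - 1) * g N + f N * g (N + 1) := by
  rw [zPair_eq_antidiagonal hf.zMul_one hg 1 (by simp)]
  simp [zMul, Finset.Nat.antidiagonal_succ, add_comm]

theorem zPair_zMul_one_pred (hf : UpTo N f) (hg : StartsAt (N - 1) g) :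
    zPair (zMul 1 f) g = f (N - 2) * g (N - 1) + f (N - 1) * g N + f N * g (N + 1) := by
  rw [zPair_eq_antidiagonal hf.zMul_one hg 2 (by push_cast; ring)]
  simp only [zMul, Finset.Nat.antidiagonal_succ]
  simp
  ring_nf

end

theorem rowZ_infMul_shiftMat_eq (A : Matrix ι ι TSeries) (i : ι) :
    rowZ (A ⊡ shiftMat) i = zMul 1 (rowZ A i) := by
  funext N
  rw [zMul, ← rowZ_infMul_shiftMat A i (N - 1), sub_add_cancel]

/-- The entries of `L = Q Λ Q^{-1}` are pairings of rows of `Q`, multiplied by `z`, with columns of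
`Q^{-1}`, which are rows of `Q_2` up to order and sign. -/
theorem laxL_apply (i j : ι) : laxL Q P i j = zPair (zMul 1 (rowZ Q i)) (rowZ Pᵀ j) := by
  rw [laxL, infMul_apply_eq_zPair, rowZ_infMul_shiftMat_eq]

theorem laxL_apply_odd (i m : ι) :
    laxL Q P i (2 * m + 1) = zPair (zMul 1 (waveRow Q P i).1) (waveRow Q P (2 * m)).2 := by
  rw [laxL_apply, rowZ_transpose_odd]
  rfl

theorem laxL_apply_even (i m : ι) :
    laxL Q P i (2 * m) = -zPair (zMul 1 (waveRow Q P i).1) (waveRow Q P (2 * m + 1)).2 := by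
  rw [laxL_apply, rowZ_transpose_even, zPair, zPair, ← finsum_neg_distrib]
  simp only [Pi.neg_apply, mul_neg]
  rfl

theorem blockDiag_infMul (g : ι → TSeries) (A : Matrix ι ι TSeries) (i j : ι) :
    (blockDiag g ⊡ A) i j = g (i / 2) * A i j := by
  rw [infMul, finsum_eq_single _ i, blockDiag, Matrix.diagonal_apply_eq]
  intro k hk
  rw [blockDiag, Matrix.diagonal_apply_ne _ hk.symm, zero_mul]

theorem infMul_blockDiag (g : ι → TSeries) (A : Matrix ι ι TSeries) (i j : ι) :
    (A ⊡ blockDiag g) i j = A i j * g (j / 2) := by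
  rw [infMul, finsum_eq_single _ j, blockDiag, Matrix.diagonal_apply_eq]
  intro k hk
  rw [blockDiag, Matrix.diagonal_apply_ne _ hk, mul_zero]

theorem zMul_shiftMinus_sub (N : ℤ) (f : TSeries) (k : ℕ) :
    zMul N (shiftMinus f) (N - k) = shiftCoeff (-1) k f := by
  rw [zMul, sub_sub_cancel_left, shiftMinus_neg_natCast]

theorem zMul_shiftPlus_add (N : ℤ) (f : TSeries) (k : ℕ) :
    zMul N (shiftPlus f) (N + k) = shiftCoeff 1 k f := by
  rw [zMul, add_sub_cancel_left, shiftPlus_natCast]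

variable {V : Submodule TSeries (ZSeries ℕ+ × ZSeries ℕ+)} (hQ : InGk Q) (hP : IsGkInverse Q P)
  (hV : IsWaveSpace V) (hmem : ∀ i, waveRow Q P i ∈ V) {τ r : ι → TSeries}
  (hτ : IsTauFamily Q τ r) (n : ι)

include hτ in
theorem IsTauFamily.hatL_apply (i j : ι) : hatL Q P τ r i j =
    r (i / 2) * (τ (i / 2))⁻¹ * laxL Q P i j * (τ (j / 2) * (r (j / 2))⁻¹) := by
  have hinv : (r (j / 2) * (τ (j / 2))⁻¹)⁻¹ = τ (j / 2) * (r (j / 2))⁻¹ := by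
    apply MvPowerSeries.inv_eq_of_mul_eq_one
    linear_combination (r (j / 2) * (r (j / 2))⁻¹) * hτ.mul_inv (j / 2) + hτ.root_mul_inv (j / 2)
  rw [hatL, infMul_blockDiag, blockDiag_infMul, hinv]

include hQ hP hV hmem hτ

theorem IsTauFamily.waveRow_even_fst_sub (k : ℕ) :
    (waveRow Q P (2 * n)).1 (2 * algebraMap ι ℤ n - k) = (r n)⁻¹ * shiftCoeff (-1) k (τ n) := by
  rw [hτ.waveRow_even hQ hP hV hmem, ← zMul_shiftMinus_sub (2 * algebraMap ι ℤ n)]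
  rfl

theorem IsTauFamily.waveRow_even_snd_add (k : ℕ) :
    (waveRow Q P (2 * n)).2 (2 * algebraMap ι ℤ n + 1 + k) =
      (r n)⁻¹ * shiftCoeff 1 k (τ (n + 1)) := by
  rw [hτ.waveRow_even hQ hP hV hmem, ← zMul_shiftPlus_add (2 * algebraMap ι ℤ n + 1)]
  rfl

theorem IsTauFamily.waveRow_odd_fst_sub (k : ℕ) :
    (waveRow Q P (2 * n + 1)).1 (2 * algebraMap ι ℤ n - k) =
      (r n)⁻¹ * (pderiv ℂ 1 (shiftCoeff (-1) k (τ n)) + shiftCoeff (-1) (k + 1) (τ n)) := by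
  rw [hτ.waveRow_odd hQ hP hV hmem, ← zMul_shiftMinus_sub (2 * algebraMap ι ℤ n),
    ← zMul_shiftMinus_sub (2 * algebraMap ι ℤ n) _ (k + 1), Nat.cast_add, Nat.cast_one, ← sub_sub]
  rfl

theorem IsTauFamily.waveRow_odd_snd_add (k : ℕ) :
    (waveRow Q P (2 * n + 1)).2 (2 * algebraMap ι ℤ n + 1 + k) =
      (r n)⁻¹ * (pderiv ℂ 1 (shiftCoeff 1 k (τ (n + 1))) - shiftCoeff 1 (k + 1) (τ (n + 1))) := by
  rw [hτ.waveRow_odd hQ hP hV hmem, ← zMul_shiftPlus_add (2 * algebraMap ι ℤ n + 1),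
    ← zMul_shiftPlus_add (2 * algebraMap ι ℤ n + 1) _ (k + 1), Nat.cast_add, Nat.cast_one,
    ← add_assoc (2 * algebraMap ι ℤ n + 1)]
  rfl

theorem IsTauFamily.inv_root_sq : (r n)⁻¹ * (r n)⁻¹ * τ n * τ (n + 1) = 1 := by
  linear_combination (-(r n)⁻¹ * (r n)⁻¹) * hτ.root_sq hQ hP n +
    (1 + r n * (r n)⁻¹) * hτ.root_mul_inv n

theorem IsTauFamily.waveRow_even_fst_zero :
    (waveRow Q P (2 * n)).1 (2 * algebraMap ι ℤ n) = (r n)⁻¹ * τ n := by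
  simpa [shiftCoeff_zero] using hτ.waveRow_even_fst_sub hQ hP hV hmem n 0

theorem IsTauFamily.waveRow_even_fst_one :
    (waveRow Q P (2 * n)).1 (2 * algebraMap ι ℤ n - 1) = -(r n)⁻¹ * dOne (τ n) := by
  simpa [shiftCoeff_one, dOne] using hτ.waveRow_even_fst_sub hQ hP hV hmem n 1

theorem IsTauFamily.waveRow_even_snd_zero :
    (waveRow Q P (2 * n)).2 (2 * algebraMap ι ℤ n + 1) = (r n)⁻¹ * τ (n + 1) := by
  simpa [shiftCoeff_zero] using hτ.waveRow_even_snd_add hQ hP hV hmem n 0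

theorem IsTauFamily.waveRow_even_snd_one :
    (waveRow Q P (2 * n)).2 (2 * algebraMap ι ℤ n + 1 + 1) = (r n)⁻¹ * dOne (τ (n + 1)) := by
  simpa [shiftCoeff_one, dOne] using hτ.waveRow_even_snd_add hQ hP hV hmem n 1

theorem IsTauFamily.waveRow_odd_fst_one :
    (waveRow Q P (2 * n + 1)).1 (2 * algebraMap ι ℤ n - 1) = -(r n)⁻¹ * schurTwo 1 (τ n) := by
  have h := hτ.waveRow_odd_fst_sub hQ hP hV hmem n 1
  rw [Nat.cast_one] at h
  rw [h, shiftCoeff_one, shiftCoeff_two, schurTwo, schurTwo, Derivation.map_smul, neg_mul, ← mul_neg]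
  congr 1
  simp only [dOne]
  module

theorem IsTauFamily.waveRow_odd_snd_one :
    (waveRow Q P (2 * n + 1)).2 (2 * algebraMap ι ℤ n + 1 + 1) =
      (r n)⁻¹ * schurTwo (-1) (τ (n + 1)) := by
  have h := hτ.waveRow_odd_snd_add hQ hP hV hmem n 1
  rw [Nat.cast_one] at h
  rw [h, shiftCoeff_one, shiftCoeff_two, schurTwo, schurTwo, Derivation.map_smul]
  congr 1
  simp only [dOne]
  module

theorem IsTauFamily.waveRow_odd_fst_top :
    (waveRow Q P (2 * n + 1)).1 (2 * algebraMap ι ℤ n + 1) = (r n)⁻¹ * τ n := by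
  rw [hQ.waveRow_odd_fst, hτ.diag_eq, mul_comm]

theorem IsTauFamily.waveRow_odd_snd_bot :
    (waveRow Q P (2 * n + 1)).2 (2 * algebraMap ι ℤ n) = -(r n)⁻¹ * τ (n + 1) := by
  have h := hτ.waveRow_even_snd_zero hQ hP hV hmem n
  rw [hP.mem.waveRow_even_snd] at h
  rw [waveRow_odd_snd, h, neg_mul]

theorem IsTauFamily.waveRow_odd_snd_zero :
    (waveRow Q P (2 * n + 1)).2 (2 * algebraMap ι ℤ n + 1) = 0 := by
  simpa [shiftCoeff_zero, shiftCoeff_one] using hτ.waveRow_odd_snd_add hQ hP hV hmem n 0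

theorem IsTauFamily.laxL_even_even : laxL Q P (2 * n) (2 * n) = -dLog (τ n) := by
  rw [laxL_apply_even, zPair_zMul_one_same (InGk.upTo_even hQ n) (InGk.startsAt_odd hP.mem n),
    hτ.waveRow_even_fst_one hQ hP hV hmem, hτ.waveRow_odd_snd_bot hQ hP hV hmem,
    hτ.waveRow_odd_snd_zero hQ hP hV hmem, dLog]
  linear_combination (-(τ n)⁻¹ * dOne (τ n)) * hτ.inv_root_sq hQ hP hV hmem n +
    ((r n)⁻¹ * (r n)⁻¹ * τ (n + 1) * dOne (τ n)) * hτ.mul_inv n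

theorem IsTauFamily.laxL_even_odd : laxL Q P (2 * n) (2 * n + 1) = 1 := by
  rw [laxL_apply_odd, zPair_zMul_one_succ (InGk.upTo_even hQ n) (InGk.startsAt_even hP.mem n),
    hτ.waveRow_even_fst_zero hQ hP hV hmem, hτ.waveRow_even_snd_zero hQ hP hV hmem]
  linear_combination hτ.inv_root_sq hQ hP hV hmem n

theorem IsTauFamily.laxL_odd_odd :
    laxL Q P (2 * n + 1) (2 * n + 1) = dLog (τ (n + 1)) := by
  rw [laxL_apply_odd, zPair_zMul_one_same (InGk.upTo_odd hQ n) (InGk.startsAt_even hP.mem n),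
    add_sub_cancel_right, hQ.waveRow_odd_fst_zero, hτ.waveRow_odd_fst_top hQ hP hV hmem,
    hτ.waveRow_even_snd_one hQ hP hV hmem, dLog]
  linear_combination ((τ (n + 1))⁻¹ * dOne (τ (n + 1))) * hτ.inv_root_sq hQ hP hV hmem n -
    ((r n)⁻¹ * (r n)⁻¹ * τ n * dOne (τ (n + 1))) * hτ.mul_inv (n + 1)

theorem IsTauFamily.laxL_odd_even : laxL Q P (2 * n + 1) (2 * n) =
    -(schurTwo 1 (τ n) * (τ n)⁻¹) - schurTwo (-1) (τ (n + 1)) * (τ (n + 1))⁻¹ := by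
  have hs := InGk.startsAt_odd (Q := Q) hP.mem n
  rw [← add_sub_cancel_right (2 * algebraMap ι ℤ n) 1] at hs
  rw [laxL_apply_even, zPair_zMul_one_pred (InGk.upTo_odd hQ n) hs, add_sub_cancel_right,
    show 2 * algebraMap ι ℤ n + 1 - 2 = 2 * algebraMap ι ℤ n - 1 by ring,
    hQ.waveRow_odd_fst_zero, hτ.waveRow_odd_fst_top hQ hP hV hmem,
    hτ.waveRow_odd_fst_one hQ hP hV hmem, hτ.waveRow_odd_snd_bot hQ hP hV hmem,
    hτ.waveRow_odd_snd_one hQ hP hV hmem]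
  linear_combination (-(τ n)⁻¹ * schurTwo 1 (τ n) -
      (τ (n + 1))⁻¹ * schurTwo (-1) (τ (n + 1))) * hτ.inv_root_sq hQ hP hV hmem n +
    ((r n)⁻¹ * (r n)⁻¹ * τ (n + 1) * schurTwo 1 (τ n)) * hτ.mul_inv n +
    ((r n)⁻¹ * (r n)⁻¹ * τ n * schurTwo (-1) (τ (n + 1))) * hτ.mul_inv (n + 1)

theorem IsTauFamily.laxL_odd_succ_even : laxL Q P (2 * n + 1) (2 * (n + 1)) =
    (r n)⁻¹ * τ n * ((r (n + 1))⁻¹ * τ (n + 1 + 1)) := by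
  have hs := InGk.startsAt_odd (Q := Q) hP.mem (n + 1)
  have h := hτ.waveRow_odd_snd_bot hQ hP hV hmem (n + 1)
  have hN : 2 * algebraMap ι ℤ (n + 1) = 2 * algebraMap ι ℤ n + 1 + 1 := by
    rw [algebraMap_add_one]; ring
  rw [hN] at hs h
  rw [laxL_apply_even, zPair_zMul_one_succ (InGk.upTo_odd hQ n) hs, h,
    hτ.waveRow_odd_fst_top hQ hP hV hmem]
  ring

/-- The entry below the diagonal blocks; the two Schur polynomials add up to `∂_1^2`. -/
theorem IsTauFamily.laxL_succ_even_odd : laxL Q P (2 * (n + 1)) (2 * n + 1) =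
    (r n)⁻¹ * (r (n + 1))⁻¹ * (τ (n + 1) * dOne (dOne (τ (n + 1))) - dOne (τ (n + 1)) ^ 2) := by
  have hs := InGk.startsAt_even (Q := Q) hP.mem n
  have hf := InGk.upTo_even (P := P) hQ (n + 1)
  have h0 := hτ.waveRow_even_fst_zero hQ hP hV hmem (n + 1)
  have h1 := hτ.waveRow_even_fst_one hQ hP hV hmem (n + 1)
  have h2 := hτ.waveRow_even_fst_sub hQ hP hV hmem (n + 1) 2
  have h3 := hτ.waveRow_even_snd_add hQ hP hV hmem n 2
  have hN : 2 * algebraMap ι ℤ (n + 1) = 2 * algebraMap ι ℤ n + 1 + 1 := by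
    rw [algebraMap_add_one]; ring
  rw [hN] at hf h0 h1 h2
  have e : 2 * algebraMap ι ℤ n + 1 + 1 + 1 = 2 * algebraMap ι ℤ n + 1 + (2 : ℕ) := by
    push_cast; ring
  rw [laxL_apply_odd, zPair_zMul_one_pred hf (by rwa [add_sub_cancel_right]), h0, h1,
    add_sub_cancel_right, e, h3]
  rw [Nat.cast_ofNat] at h2
  rw [h2, hτ.waveRow_even_snd_zero hQ hP hV hmem, hτ.waveRow_even_snd_one hQ hP hV hmem,
    shiftCoeff_two, shiftCoeff_two]
  have hs : schurTwo (-1) (τ (n + 1)) + schurTwo 1 (τ (n + 1)) = dOne (dOne (τ (n + 1))) := by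
    rw [schurTwo, schurTwo]
    module
  linear_combination ((r n)⁻¹ * (r (n + 1))⁻¹ * τ (n + 1)) * hs

omit hV hmem hτ in
theorem laxL_eq_zero {i j : ι} (h : algebraMap ι ℤ i + 1 < algebraMap ι ℤ j) :
    laxL Q P i j = 0 := by
  rw [laxL_apply]
  exact zPair_eq_zero (IsLower.upTo_rowZ hQ.lower i).zMul_one
    (IsLower.startsAt_rowZ_transpose hP.mem.lower j) h

omit hV hmem in
theorem IsTauFamily.hatL_eq_zero {i j : ι} (h : algebraMap ι ℤ i + 1 < algebraMap ι ℤ j) :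
    hatL Q P τ r i j = 0 := by
  rw [hτ.hatL_apply, laxL_eq_zero hQ hP h, mul_zero, zero_mul]

/-- The τ-functions of a family satisfying the shift equations have all the required properties. -/
theorem IsTauFamily.isPfaffTau : IsPfaffTau Q P τ r where
  tau_ne := hτ.constantCoeff_ne
  root_sq := hτ.root_sq hQ hP
  psi1_even n := by
    funext N
    rw [psi1Even, hτ.rowZ_even hQ]
    simp only [tMul, zMul, sub_neg_eq_add, add_sub_cancel_right, ← mul_assoc]
    congr 1
    have h : (Q (2 * n) (2 * n))⁻¹ = r n * (τ n)⁻¹ := by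
      rw [← hτ.inv_diag_eq hQ hP]
      exact MvPowerSeries.inv_eq_of_mul_eq_one (hP.diag_mul hQ n)
    rw [h]
    linear_combination (τ n)⁻¹ * hτ.root_mul_inv n
  psi2_even n := by
    funext N
    rw [psi2Even, hτ.rowZ_secondQ_even hQ hP hV hmem]
    simp only [tMul, zMul, sub_neg_eq_add, add_sub_cancel_right, ← mul_assoc]
    congr 1
    rw [hτ.diag_eq]
    linear_combination (τ (n + 1))⁻¹ * hτ.inv_root_sq hQ hP hV hmem n -
      τ n * (r n)⁻¹ * (r n)⁻¹ * hτ.mul_inv (n + 1)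
  wave1_even n := by
    rw [Psi1, hτ.rowZ_even hQ]
  wave1_odd n := by
    rw [Psi1]
    congr 1
    have h := congrArg Prod.fst (hτ.waveRow_odd hQ hP hV hmem n)
    funext N
    refine (congrFun h N).trans ?_
    change (r n)⁻¹ * (pderiv ℂ 1 (zMul _ (shiftMinus (τ n)) N) + _) =
      (r n)⁻¹ * (zMul 1 _ _ + zDeriv _ _)
    rw [add_comm]
    simp only [zMul, zDeriv, sub_right_comm]
    rfl
  wave2_even n := by
    rw [Psi2, hτ.rowZ_secondQ_even hQ hP hV hmem]
  wave2_odd n := by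
    rw [Psi2]
    congr 1
    have h := congrArg Prod.snd (hτ.waveRow_odd hQ hP hV hmem n)
    funext N
    refine (congrFun h N).trans ?_
    change (r n)⁻¹ * (pderiv ℂ 1 (zMul _ (shiftPlus (τ (n + 1))) N) - _) =
      (r n)⁻¹ * (-zMul (-1) _ _ + zDeriv _ _)
    rw [neg_add_eq_sub]
    simp only [zMul, zDeriv]
    congr 3
    push_cast; ring
  bilinear_eq n m := by
    have hE : ∀ n, (zMul (2 * algebraMap ι ℤ n) (shiftMinus (τ n)),
        zMul (2 * algebraMap ι ℤ n + 1) (shiftPlus (τ (n + 1)))) ∈ V := by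
      intro n
      have h := V.smul_mem (r n) (hmem (2 * n))
      rwa [hτ.waveRow_even hQ hP hV hmem, smul_smul, hτ.root_mul_inv, one_smul] at h
    rw [← crossForm_tau]
    exact hV.crossForm_eq_zero (hE n) (hE m)
  block_diag n := by
    have hone : r n * (τ n)⁻¹ * (τ n * (r n)⁻¹) = 1 := by
      linear_combination (r n * (r n)⁻¹) * hτ.mul_inv n + hτ.root_mul_inv n
    refine ⟨?_, ?_, ?_, ?_⟩
    · rw [hτ.hatL_apply, two_mul_div_two, hτ.laxL_even_even hQ hP hV hmem]
      linear_combination (-dLog (τ n)) * hone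
    · rw [hτ.hatL_apply, two_mul_div_two, two_mul_add_one_div_two,
        hτ.laxL_even_odd hQ hP hV hmem, mul_one, hone]
    · rw [hτ.hatL_apply, two_mul_div_two, two_mul_add_one_div_two,
        hτ.laxL_odd_even hQ hP hV hmem]
      linear_combination (-(schurTwo 1 (τ n) * (τ n)⁻¹) -
        schurTwo (-1) (τ (n + 1)) * (τ (n + 1))⁻¹) * hone
    · rw [hτ.hatL_apply, two_mul_add_one_div_two, hτ.laxL_odd_odd hQ hP hV hmem]
      linear_combination dLog (τ (n + 1)) * hone
  block_upper n := by
    have hN := algebraMap_add_one n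
    refine ⟨hτ.hatL_eq_zero hQ hP ?_, hτ.hatL_eq_zero hQ hP ?_, ?_, hτ.hatL_eq_zero hQ hP ?_⟩
    · rw [algebraMap_two_mul, algebraMap_two_mul]; omega
    · rw [algebraMap_two_mul, algebraMap_two_mul_add_one]; omega
    · rw [hτ.hatL_apply, two_mul_div_two, two_mul_add_one_div_two,
        hτ.laxL_odd_succ_even hQ hP hV hmem]
      have h1 := hτ.inv_root_sq hQ hP hV hmem (n + 1)
      linear_combination (r n * (r n)⁻¹ * (τ n * (τ n)⁻¹)) * h1 +
        r n * (r n)⁻¹ * hτ.mul_inv n + hτ.root_mul_inv n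
    · rw [algebraMap_two_mul_add_one, algebraMap_two_mul_add_one]; omega
  block_zero i j h := by
    apply hτ.hatL_eq_zero hQ hP
    have h := algebraMap_int_lt.2 h
    rw [map_add, map_one, IntIndex.algebraMap_div_two, IntIndex.algebraMap_div_two] at h
    omega
  block_lower n := by
    rw [hτ.hatL_apply, two_mul_div_two, two_mul_add_one_div_two,
      hτ.laxL_succ_even_odd hQ hP hV hmem, dLog, dOne_mul, dOne_inv (hτ.constantCoeff_ne (n + 1))]
    have h1 := hτ.inv_root_sq hQ hP hV hmem n
    have h2 := hτ.mul_inv (n + 1)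
    have h3 := hτ.root_mul_inv (n + 1)
    generalize dOne (dOne (τ (n + 1))) = y
    generalize dOne (τ (n + 1)) = x
    generalize (τ (n + 1))⁻¹ = t at *
    linear_combination (t * ((r n)⁻¹ * (r n)⁻¹ * τ n) * (τ (n + 1) * y - x ^ 2)) * h3 +
      t * (τ (n + 1) * y - x ^ 2) * (t * h1 - (r n)⁻¹ * (r n)⁻¹ * τ n * h2) + t * y * h2

end

/-! ### Existence of the τ-functions -/

/-- The roots are `r_n = τ_{2n} / c_{2n}`; their squares are `τ_{2n} τ_{2n+2}` by the recurrence. -/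
theorem IsTauFamily.of_succ {ι : Type} [CommSemiring ι] [LinearOrder ι] [Div ι] [Algebra ι ℤ]
    [IntIndex ι] {Q P : Matrix ι ι TSeries} (hQ : InGk Q) (hP : IsGkInverse Q P) {τ : ι → TSeries}
    (h0 : ∀ n, MvPowerSeries.constantCoeff (τ n) ≠ 0) (h : ∀ n, IsTauFor Q n (τ n))
    (hs : ∀ n, τ (n + 1) = τ n * P (2 * n) (2 * n) ^ 2) :
    IsTauFamily Q τ fun n => τ n * P (2 * n) (2 * n) where
  constantCoeff_ne := h0
  isTauFor := h
  succ_mul n := by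
    rw [hs]
    linear_combination (τ n * (1 + Q (2 * n) (2 * n) * P (2 * n) (2 * n))) * hP.diag_mul hQ n
  root_mul n := by
    linear_combination τ n * hP.diag_mul hQ n

theorem IsGkInverse.constantCoeff_mul {ι : Type} [CommSemiring ι] [LinearOrder ι] [Div ι]
    [Algebra ι ℤ] [IntIndex ι] {Q P : Matrix ι ι TSeries} (hQ : InGk Q) (hP : IsGkInverse Q P)
    (n : ι) : MvPowerSeries.constantCoeff (Q (2 * n) (2 * n)) *
      MvPowerSeries.constantCoeff (P (2 * n) (2 * n)) = 1 := by
  rw [← map_mul, hP.diag_mul hQ, map_one]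

/-- In the semi-infinite case the row `0` of `Q` has the single entry `c_0`, so that `τ_0 = 1`, and the
recurrence `τ_{2n+2} = c_{2n}^{-2} τ_{2n}` gives the others. -/
theorem IsWaveSpace.exists_isPfaffTau_nat {V : Submodule TSeries (ZSeries ℕ+ × ZSeries ℕ+)}
    (hV : IsWaveSpace V) {Q P : Matrix ℕ ℕ TSeries} (hQ : InGk Q) (hP : IsGkInverse Q P)
    (hmem : ∀ i, waveRow Q P i ∈ V) : ∃ τ r, IsPfaffTau Q P τ r := by
  set τ : ℕ → TSeries := fun n => ∏ k ∈ Finset.range n, P (2 * k) (2 * k) ^ 2 with hτ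
  have hs : ∀ n, τ (n + 1) = τ n * P (2 * n) (2 * n) ^ 2 := fun n => Finset.prod_range_succ _ _
  have hc : ∀ n, MvPowerSeries.constantCoeff (τ n) ≠ 0 := by
    intro n
    rw [hτ, map_prod, Finset.prod_ne_zero_iff]
    intro k _
    rw [map_pow]
    exact pow_ne_zero _ (right_ne_zero_of_mul_eq_one (hP.constantCoeff_mul hQ k))
  have ht : ∀ n, IsTauFor Q n (τ n) := by
    intro n
    induction n with
    | zero =>
      have h1 : τ 0 = 1 := Finset.prod_range_zero _
      rw [IsTauFor, h1, map_one, map_one, one_mul, one_mul]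
      ext1 i
      rw [coeff_upSeries, PowerSeries.coeff_C]
      split_ifs with h
      · subst h
        have := waveRow_even_fst (Q := Q) (P := P) 0
        simpa [waveRow] using this.symm
      · rw [rowZ_of_notMem]
        rintro ⟨k, hk⟩
        simp at hk
        omega
    | succ n ih =>
      refine (hV.isTauFor_succ hQ hP hmem n ?_).1 ih
      rw [hs]
      linear_combination (τ n * (1 + Q (2 * n) (2 * n) * P (2 * n) (2 * n))) * hP.diag_mul hQ n
  exact ⟨τ, _, (IsTauFamily.of_succ hQ hP hc ht hs).isPfaffTau hQ hP hV hmem⟩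

/-- A recurrence with invertible factors can be solved in both directions. -/
theorem exists_int_recurrence {R : Type*} [CommMonoid R] (g : ℤ → Rˣ) (t : R) :
    ∃ f : ℤ → R, f 0 = t ∧ ∀ n, f (n + 1) = f n * g n := by
  refine ⟨fun n => match n with
    | Int.ofNat k => t * ((∏ i ∈ Finset.range k, g i : Rˣ) : R)
    | Int.negSucc k => t * ((∏ i ∈ Finset.range (k + 1), (g (Int.negSucc i))⁻¹ : Rˣ) : R),
    ?_, ?_⟩
  · change t * ((∏ i ∈ Finset.range 0, g i : Rˣ) : R) = t
    simp
  · rintro (k | k)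
    · change t * ((∏ i ∈ Finset.range (k + 1), g i : Rˣ) : R) =
        t * ((∏ i ∈ Finset.range k, g i : Rˣ) : R) * g k
      rw [Finset.prod_range_succ, Units.val_mul, mul_assoc]
    · have h : ∀ k : ℕ, t * ((∏ i ∈ Finset.range (k + 1), (g (Int.negSucc i))⁻¹ : Rˣ) : R) *
          g (Int.negSucc k) = t * ((∏ i ∈ Finset.range k, (g (Int.negSucc i))⁻¹ : Rˣ) : R) := by
        intro k
        rw [Finset.prod_range_succ, Units.val_mul, mul_assoc, mul_assoc, Units.inv_mul, mul_one]
      rcases k with _ | k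
      · have := h 0
        simp only [Finset.range_zero, Finset.prod_empty, Units.val_one, mul_one] at this
        refine Eq.trans ?_ this.symm
        change t * ((∏ i ∈ Finset.range 0, g i : Rˣ) : R) = t
        simp
      · exact (h (k + 1)).symm

/-- In the bi-infinite case there is no first row; `τ_0` comes from the integration of the cocycle
given by the rows `0` and `-2`, and the recurrence gives the others in both directions. -/
theorem IsWaveSpace.exists_isPfaffTau_int {V : Submodule TSeries (ZSeries ℕ+ × ZSeries ℕ+)}
    (hV : IsWaveSpace V) {Q P : Matrix ℤ ℤ TSeries} (hQ : InGk Q) (hP : IsGkInverse Q P)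
    (hmem : ∀ i, waveRow Q P i ∈ V) : ∃ τ r, IsPfaffTau Q P τ r := by
  obtain ⟨t, ht0, ht⟩ : ∃ t, MvPowerSeries.constantCoeff t = 1 ∧ IsTauFor Q 0 t := by
    -- The rows `0` of `Q` and `-2` of `Q_2`, normalized to have leading coefficient `1`.
    obtain ⟨v, hv⟩ : ∃ v, v = P (2 * 0) (2 * 0) • waveRow Q P (2 * 0) := ⟨_, rfl⟩
    obtain ⟨w, hw⟩ : ∃ w, w = Q (2 * (-1)) (2 * (-1)) • waveRow Q P (2 * (-1)) := ⟨_, rfl⟩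
    have hvV : v ∈ V := hv ▸ V.smul_mem _ (hmem _)
    have hwV : w ∈ V := hw ▸ V.smul_mem _ (hmem _)
    have hv1 : UpTo 0 v.1 := fun a ha => by
      have := InGk.upTo_even (P := P) hQ 0 a (by simpa using ha)
      rw [hv, Prod.smul_fst, Pi.smul_apply, this, smul_zero]
    have hv2 : StartsAt (0 + 1) v.2 := fun a ha => by
      have := InGk.startsAt_even (Q := Q) hP.mem 0 a (by simpa using ha)
      rw [hv, Prod.smul_snd, Pi.smul_apply, this, smul_zero]
    have hw1 : UpTo (0 - 2) w.1 := fun a ha => by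
      have := InGk.upTo_even (P := P) hQ (-1) a (by simpa using ha)
      rw [hw, Prod.smul_fst, Pi.smul_apply, this, smul_zero]
    have hw2 : StartsAt (0 - 1) w.2 := fun a ha => by
      have := InGk.startsAt_even (Q := Q) hP.mem (-1) a (by simpa using ha)
      rw [hw, Prod.smul_snd, Pi.smul_apply, this, smul_zero]
    have hv0 : v.1 0 = 1 := by
      have h := waveRow_even_fst (Q := Q) (P := P) 0
      have hc := hP.diag_mul hQ 0
      have e : 2 * algebraMap ℤ ℤ 0 = 0 := by simp
      rw [e] at h
      rw [hv, Prod.smul_fst, Pi.smul_apply, smul_eq_mul, h, mul_comm, hc]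
    have hw0 : w.2 (0 - 1) = 1 := by
      have h := hP.mem.waveRow_even_snd (Q := Q) (-1)
      have hc := hP.diag_mul hQ (-1)
      have e : 2 * algebraMap ℤ ℤ (-1) + 1 = 0 - 1 := by simp
      rw [e] at h
      rw [hw, Prod.smul_snd, Pi.smul_apply, smul_eq_mul, h, hc]
    have hadj := hV.mul_diagShift_adjacent hvV hwV hv1 hv2 hw1 hw2
    rw [hv0, hw0, map_one, map_one, one_mul] at hadj
    have hdiag : ∀ j k, PowerSeries.coeff k (diagShift (-1)
        (downSeries (0 - 1) fun a => shiftCoeff (-1) j (w.2 a))) =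
        shiftCoeff (-1) j (PowerSeries.coeff k (diagShift (-1) (downSeries (0 - 1) w.2))) := by
      intro j k
      simp only [diagShift, PowerSeries.coeff_mk, coeff_downSeries, shiftCoeff_sum]
      exact Finset.sum_congr rfl fun p _ => shiftCoeff_comm _ _ _ _ _
    obtain ⟨t, ht0, ht⟩ := exists_tau (u := upSeries 0 v.1) (by simp [coeff_upSeries, hv0]) hadj
      (by
        intro i j
        have h := hV.symm_adjacent hvV hwV hv1 hv2 hw1 hw2 i j
        rw [PowerSeries.coeff_mul, PowerSeries.coeff_mul] at h
        simpa only [hdiag] using h)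
    refine ⟨t, ht0, ?_⟩
    have hup : upSeries 0 v.1 = PowerSeries.C (P (2 * 0) (2 * 0)) *
        upSeries (2 * algebraMap ℤ ℤ 0) (rowZ Q (2 * 0)) := by
      ext1 i
      rw [PowerSeries.coeff_C_mul, coeff_upSeries, coeff_upSeries, hv, map_zero, mul_zero]
      rfl
    have hc := congrArg (PowerSeries.C (R := TSeries)) (hP.diag_mul hQ 0)
    rw [map_mul, map_one] at hc
    rw [IsTauFor, ht, hup]
    linear_combination
      (PowerSeries.C t * upSeries (2 * algebraMap ℤ ℤ 0) (rowZ Q (2 * 0))) * hc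
  have hu : ∀ n, P (2 * n) (2 * n) * Q (2 * n) (2 * n) = 1 := fun n => by
    rw [mul_comm, hP.diag_mul hQ]
  obtain ⟨τ, h0, hs⟩ := exists_int_recurrence
    (fun n : ℤ => (Units.mkOfMulEqOne _ _ (hu n)) ^ 2) t
  replace hs : ∀ n, τ (n + 1) = τ n * P (2 * n) (2 * n) ^ 2 := fun n => by
    rw [hs]; rfl
  have hs' : ∀ n, τ (n + 1) * Q (2 * n) (2 * n) ^ 2 = τ n := fun n => by
    rw [hs]
    linear_combination (τ n * (1 + Q (2 * n) (2 * n) * P (2 * n) (2 * n))) * hP.diag_mul hQ n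
  have hc : ∀ n, MvPowerSeries.constantCoeff (τ n) ≠ 0 := by
    intro n
    induction n with
    | zero => rw [h0, ht0]; exact one_ne_zero
    | succ n ih =>
      rw [hs, map_mul, map_pow]
      exact mul_ne_zero ih (pow_ne_zero _ (right_ne_zero_of_mul_eq_one (hP.constantCoeff_mul hQ _)))
    | pred n ih =>
      rw [← hs', sub_add_cancel, map_mul, map_pow]
      exact mul_ne_zero ih (pow_ne_zero _ (left_ne_zero_of_mul_eq_one (hP.constantCoeff_mul hQ _)))
  have ht' : ∀ n, IsTauFor Q n (τ n) := by
    intro n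
    induction n with
    | zero => rwa [h0]
    | succ n ih => exact (hV.isTauFor_succ hQ hP hmem _ (hs' _)).1 ih
    | pred n ih =>
      refine (hV.isTauFor_succ hQ hP hmem _ (hs' _)).2 ?_
      rwa [sub_add_cancel]
  exact ⟨τ, _, (IsTauFamily.of_succ hQ hP hc ht' hs).isPfaffTau hQ hP hV hmem⟩

/-! ### Products of infinite matrices -/

/-- Products of infinite matrices are associative where only finitely many terms of the double sum are
nonzero. -/
theorem infMul_assoc_apply {ι : Type} {A B C : Matrix ι ι TSeries} {i j : ι} (S T : Finset ι)
    (h : ∀ k l, A i k ≠ 0 → B k l ≠ 0 → C l j ≠ 0 → k ∈ S ∧ l ∈ T) :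
    (A ⊡ B ⊡ C) i j = (A ⊡ (B ⊡ C)) i j := by
  have hz : ∀ k l, (k ∉ S ∨ l ∉ T) → A i k * B k l * C l j = 0 := by
    intro k l hkl
    by_contra hne
    have hC := right_ne_zero_of_mul hne
    have hA := left_ne_zero_of_mul (left_ne_zero_of_mul hne)
    have hB := right_ne_zero_of_mul (left_ne_zero_of_mul hne)
    have := h k l hA hB hC
    tauto
  have h1 : ∀ l, (A ⊡ B) i l * C l j = ∑ k ∈ S, A i k * B k l * C l j := by
    intro l
    by_cases hC : C l j = 0
    · simp [hC]
    · rw [infMul, finsum_eq_sum_of_support_subset (s := S), Finset.sum_mul]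
      intro k hk
      rw [Function.mem_support] at hk
      exact (h k l (left_ne_zero_of_mul hk) (right_ne_zero_of_mul hk) hC).1
  have h2 : ∀ k, A i k * (B ⊡ C) k j = ∑ l ∈ T, A i k * B k l * C l j := by
    intro k
    by_cases hA : A i k = 0
    · simp [hA]
    · rw [infMul, finsum_eq_sum_of_support_subset (s := T), Finset.mul_sum]
      · simp only [mul_assoc]
      intro l hl
      rw [Function.mem_support] at hl
      exact (h k l hA (left_ne_zero_of_mul hl) (right_ne_zero_of_mul hl)).2
  rw [infMul, infMul]
  simp only [h1, h2]
  rw [finsum_eq_sum_of_support_subset (s := T), finsum_eq_sum_of_support_subset (s := S),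
    Finset.sum_comm]
  · intro k hk
    by_contra hS
    exact hk (Finset.sum_eq_zero fun l _ => hz k l (Or.inl hS))
  · intro l hl
    by_contra hT
    exact hl (Finset.sum_eq_zero fun k _ => hz k l (Or.inr hT))

theorem one_infMul {ι : Type} [DecidableEq ι] (A : Matrix ι ι TSeries) : 1 ⊡ A = A := by
  ext1 i j
  rw [infMul, finsum_eq_single _ i, Matrix.one_apply_eq, one_mul]
  intro k hk
  rw [Matrix.one_apply_ne hk.symm, zero_mul]

theorem infMul_one {ι : Type} [DecidableEq ι] (A : Matrix ι ι TSeries) : A ⊡ 1 = A := by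
  ext1 i j
  rw [infMul, finsum_eq_single _ j, Matrix.one_apply_eq, mul_one]
  intro k hk
  rw [Matrix.one_apply_ne hk, mul_zero]

section

set_option linter.unusedSectionVars false

variable {ι : Type} [CommSemiring ι] [LinearOrder ι] [Div ι] [Algebra ι ℤ]

/-- The matrix has at most `d` diagonals above the main one. -/
def UpperBand (d : ℤ) (A : Matrix ι ι TSeries) : Prop :=
  ∀ i j, algebraMap ι ℤ i + d < algebraMap ι ℤ j → A i j = 0

theorem UpperBand.infMul {a b : ℤ} {A B : Matrix ι ι TSeries} (hA : UpperBand a A)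
    (hB : UpperBand b B) : UpperBand (a + b) (A ⊡ B) := by
  intro i j hij
  refine finsum_eq_zero_of_forall_eq_zero fun k => ?_
  by_cases hk : algebraMap ι ℤ i + a < algebraMap ι ℤ k
  · rw [hA i k hk, zero_mul]
  · rw [hB k j (by omega), mul_zero]

theorem UpperBand.le {a : ℤ} {A : Matrix ι ι TSeries} (hA : UpperBand a A) {i j : ι}
    (h : A i j ≠ 0) : algebraMap ι ℤ j ≤ algebraMap ι ℤ i + a := by
  by_contra hcon
  exact h (hA i j (not_le.1 hcon))

theorem InGk.upperBand [IntIndex ι] {Q : Matrix ι ι TSeries} (hQ : InGk Q) : UpperBand 0 Q :=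
  fun i j h => hQ.lower i j (algebraMap_int_lt.1 (by omega))

theorem upperBand_skewJ : UpperBand 1 (skewJ : Matrix ι ι TSeries) := by
  intro i j h
  rw [skewJ, if_neg, if_neg]
  · rintro ⟨-, rfl⟩
    rw [algebraMap_add_one] at h
    omega
  · rintro ⟨-, rfl⟩
    rw [algebraMap_add_one] at h
    omega

end

/-! ### The wave space of a semi-infinite solution -/

theorem infPow_shiftMat_nat (k : ℕ) (i j : ℕ) :
    infPow (shiftMat : Matrix ℕ ℕ TSeries) k i j = if j = i + k then 1 else 0 := by
  induction k generalizing j with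
  | zero => simp [infPow, Matrix.one_apply, eq_comm]
  | succ k ih =>
    rw [infPow, infMul, finsum_eq_single _ (i + k)]
    · rw [ih, if_pos rfl, one_mul, shiftMat, add_assoc]
    · intro l hl
      rw [ih, if_neg hl, zero_mul]

theorem infPow_shiftMat_transpose_nat (k : ℕ) (i j : ℕ) :
    infPow (shiftMat : Matrix ℕ ℕ TSeries)ᵀ k i j = if i = j + k then 1 else 0 := by
  induction k generalizing j with
  | zero => simp [infPow, Matrix.one_apply]
  | succ k ih =>
    rw [infPow, infMul, finsum_eq_single _ (j + 1)]
    · rw [ih, Matrix.transpose_apply, shiftMat, if_pos rfl, mul_one, add_assoc, add_comm 1]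
    · intro l hl
      rw [Matrix.transpose_apply, shiftMat, if_neg hl, mul_zero]

theorem IsMomentSolution.pderiv_apply {m Q P : Matrix ℕ ℕ TSeries} (h : IsMomentSolution m Q P)
    (k : ℕ+) (a b : ℕ) : pderiv ℂ k (m a b) = m (a + k) b + m a (b + k) := by
  have h1 := congrFun (congrFun (h.flow k) a) b
  rw [Matrix.add_apply, infMul, infMul, finsum_eq_single _ (a + k),
    finsum_eq_single _ (b + (k : ℕ)), infPow_shiftMat_nat, infPow_shiftMat_transpose_nat,
    if_pos rfl, if_pos rfl, one_mul, mul_one] at h1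
  · exact h1
  · intro l hl
    rw [infPow_shiftMat_transpose_nat, if_neg hl, mul_zero]
  · intro l hl
    rw [infPow_shiftMat_nat, if_neg hl, zero_mul]

/-- The rows of `Q_2` are those of `Q m`. -/
theorem IsMomentSolution.infMul_eq {m Q P : Matrix ℕ ℕ TSeries} (h : IsMomentSolution m Q P) :
    Q ⊡ m = secondQ P := by
  have hassoc : ∀ (A B C : Matrix ℕ ℕ TSeries) (a b : ℤ), UpperBand a A → UpperBand b B →
      A ⊡ B ⊡ C = A ⊡ (B ⊡ C) := by
    intro A B C a b hA hB
    ext1 i j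
    refine infMul_assoc_apply (Finset.range (i + a + 1).toNat)
      (Finset.range (i + a + b + 1).toNat) fun k l hk hl _ => ?_
    have h1 := hA.le hk
    have h2 := hB.le hl
    simp only [eq_natCast, Finset.mem_range] at h1 h2 ⊢
    omega
  have hQ := h.mem.upperBand
  have hP := h.inv.mem.upperBand
  rw [h.decomp, ← hassoc Q _ _ _ _ hQ (hP.infMul upperBand_skewJ), ← hassoc Q P _ _ _ hQ hP,
    h.inv.mul_inv, one_infMul, secondQ]

theorem startsAt_zero_rowZ (A : Matrix ℕ ℕ TSeries) (i : ℕ) : StartsAt 0 (rowZ A i) := by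
  intro a ha
  apply rowZ_of_notMem
  rintro ⟨k, rfl⟩
  simp at ha
  omega

theorem zPair_eq_sum_range {f : ZSeries ℕ+} {N : ℕ} (h0 : StartsAt 0 f) (h1 : UpTo N f)
    (g : ZSeries ℕ+) : zPair f g = ∑ a ∈ Finset.range (N + 1), f a * g a := by
  have e : ∀ F : ℤ → TSeries, ∑ a ∈ Finset.range (N + 1), F a =
      ∑ a ∈ (Finset.range (N + 1)).map Nat.castEmbedding, F a := fun F => by
    rw [Finset.sum_map]
    rfl
  rw [e fun a => f a * g a]
  apply finsum_eq_sum_of_support_subset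
  intro a ha
  rw [Function.mem_support] at ha
  rw [Finset.mem_coe, Finset.mem_map]
  have ha0 : 0 ≤ a := by
    by_contra hcon
    exact ha (by rw [h0 a (not_le.1 hcon), zero_mul])
  have ha1 : a ≤ N := by
    by_contra hcon
    exact ha (by rw [h1 a (not_le.1 hcon), zero_mul])
  refine ⟨a.toNat, Finset.mem_range.2 (by omega), ?_⟩
  change ((a.toNat : ℕ) : ℤ) = a
  omega

theorem rowZ_natCast (A : Matrix ℕ ℕ TSeries) (i a : ℕ) : rowZ A i (a : ℤ) = A i a :=
  rowZ_algebraMap A i a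

/-- The pairs `(f, f')` with `f` a polynomial in `z` and `f'` equal to `f m` in nonnegative degrees.
The coefficients of `f'` in negative degrees play no role in the pairing, but the flows create
them. -/
def momentSpace (m : Matrix ℕ ℕ TSeries) : Submodule TSeries (ZSeries ℕ+ × ZSeries ℕ+) where
  carrier := {v | StartsAt 0 v.1 ∧ (∃ N, UpTo N v.1) ∧ (∃ N, StartsAt N v.2) ∧
    ∀ b : ℕ, v.2 b = zPair v.1 (rowZ mᵀ b)}
  zero_mem' := ⟨fun _ _ => rfl, ⟨0, fun _ _ => rfl⟩, ⟨0, fun _ _ => rfl⟩, fun b => by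
    simp [zPair]⟩
  add_mem' := by
    rintro v w ⟨h1, ⟨N, h2⟩, ⟨N', h3⟩, h4⟩ ⟨h1', ⟨M, h2'⟩, ⟨M', h3'⟩, h4'⟩
    have hu : UpTo (max N M) v.1 := h2.mono (le_max_left _ _)
    have hu' : UpTo (max N M) w.1 := h2'.mono (le_max_right _ _)
    have hu'' : UpTo (max N M) (v + w).1 := fun a ha => by
      rw [Prod.fst_add, Pi.add_apply, hu a ha, hu' a ha, add_zero]
    refine ⟨fun a ha => ?_, ⟨_, hu''⟩, ⟨min N' M', fun a ha => ?_⟩, fun b => ?_⟩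
    · rw [Prod.fst_add, Pi.add_apply, h1 a ha, h1' a ha, add_zero]
    · rw [Prod.snd_add, Pi.add_apply, h3 a (by omega), h3' a (by omega), add_zero]
    · have hs := startsAt_zero_rowZ mᵀ b
      rw [Prod.snd_add, Pi.add_apply, h4, h4', zPair_eq_sum hu hs, zPair_eq_sum hu' hs,
        zPair_eq_sum hu'' hs, ← Finset.sum_add_distrib]
      simp [add_mul]
  smul_mem' := by
    rintro c v ⟨h1, ⟨N, h2⟩, ⟨N', h3⟩, h4⟩
    refine ⟨fun a ha => ?_, ⟨N, fun a ha => ?_⟩, ⟨N', fun a ha => ?_⟩, fun b => ?_⟩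
    · rw [Prod.smul_fst, Pi.smul_apply, h1 a ha, smul_zero]
    · rw [Prod.smul_fst, Pi.smul_apply, h2 a ha, smul_zero]
    · rw [Prod.smul_snd, Pi.smul_apply, h3 a ha, smul_zero]
    · have hs := startsAt_zero_rowZ mᵀ b
      have hu : UpTo N (c • v).1 := fun a ha => by
        rw [Prod.smul_fst, Pi.smul_apply, h2 a ha, smul_zero]
      rw [Prod.smul_snd, Pi.smul_apply, h4, zPair_eq_sum h2 hs, zPair_eq_sum hu hs,
        Finset.smul_sum]
      simp [mul_assoc]

/-- Isotropy is the skew symmetry of `m`, and stability under the flows is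
`∂_k m = Λ^k m + m Λᵀ^k`. -/
theorem IsMomentSolution.isWaveSpace {m Q P : Matrix ℕ ℕ TSeries} (h : IsMomentSolution m Q P) :
    IsWaveSpace (momentSpace m) where
  upTo v hv := hv.2.1
  startsAt v hv := hv.2.2.1
  isotropic := by
    rintro v ⟨hv0, ⟨N, hN⟩, -, hv⟩ w ⟨hw0, ⟨M, hM⟩, -, hw⟩
    have hN' : UpTo ((max N M).toNat : ℕ) v.1 := hN.mono (by omega)
    have hM' : UpTo ((max N M).toNat : ℕ) w.1 := hM.mono (by omega)
    generalize (max N M).toNat = K at *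
    rw [zPair_eq_sum_range hv0 hN', zPair_eq_sum_range hw0 hM']
    have e1 : ∀ a : ℕ, v.1 a * w.2 a = ∑ b ∈ Finset.range (K + 1), v.1 a * w.1 b * m b a := by
      intro a
      rw [hw, zPair_eq_sum_range hw0 hM', Finset.mul_sum]
      simp only [rowZ_natCast, Matrix.transpose_apply, mul_assoc]
    have e2 : ∀ b : ℕ, w.1 b * v.2 b = ∑ a ∈ Finset.range (K + 1), -(v.1 a * w.1 b * m b a) := by
      intro b
      rw [hv, zPair_eq_sum_range hv0 hN', Finset.mul_sum]
      refine Finset.sum_congr rfl fun a _ => ?_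
      have := congrFun (congrFun h.skew b) a
      rw [Matrix.transpose_apply, Matrix.neg_apply] at this
      rw [rowZ_natCast, Matrix.transpose_apply, this]
      ring
    simp only [e1, e2]
    rw [Finset.sum_comm, ← Finset.sum_add_distrib]
    refine Finset.sum_eq_zero fun b _ => ?_
    rw [Finset.sum_neg_distrib, add_neg_cancel]
  flow := by
    rintro v ⟨hv0, ⟨N, hN⟩, ⟨M, hM⟩, hv⟩ k
    have hk := k.pos
    have hN' : UpTo (N.toNat : ℕ) v.1 := hN.mono (by omega)
    generalize N.toNat = K at *
    have hf0 : StartsAt 0 (flowOp k v).1 := fun a ha => by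
      simp only [flowOp]
      rw [hv0 a ha, hv0 _ (by omega), map_zero, add_zero]
    have hf1 : UpTo ((k + K : ℕ) : ℤ) (flowOp k v).1 := fun a ha => by
      simp only [flowOp]
      rw [hN' a (by omega), hN' _ (by omega), map_zero, add_zero]
    refine ⟨hf0, ⟨_, hf1⟩, ⟨M - k, fun a ha => ?_⟩, fun b => ?_⟩
    · simp only [flowOp]
      rw [hM a (by omega), hM _ (by omega), map_zero, sub_zero]
    · have hvk := hv (b + k)
      rw [Nat.cast_add] at hvk
      rw [zPair_eq_sum_range hf0 hf1]
      simp only [flowOp]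
      rw [hvk, hv, zPair_eq_sum_range hv0 hN', zPair_eq_sum_range hv0 hN']
      simp only [rowZ_natCast, Matrix.transpose_apply, map_sum, Derivation.leibniz, smul_eq_mul,
        h.pderiv_apply, add_mul, Finset.sum_add_distrib, mul_add]
      have e1 : ∑ a ∈ Finset.range (k + K + 1), v.1 ((a : ℤ) - k) * m a b =
          ∑ a ∈ Finset.range (K + 1), v.1 a * m (a + k) b := by
        rw [add_assoc, Finset.sum_range_add, Finset.sum_eq_zero, zero_add]
        · refine Finset.sum_congr rfl fun a _ => ?_
          have e : ((k + a : ℕ) : ℤ) - k = a := by push_cast; ring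
          rw [add_comm a, e]
        · intro a ha
          have := Finset.mem_range.1 ha
          rw [hv0 _ (by omega), zero_mul]
      have e2 : ∑ a ∈ Finset.range (k + K + 1), pderiv ℂ k (v.1 a) * m a b =
          ∑ a ∈ Finset.range (K + 1), m a b * pderiv ℂ k (v.1 a) := by
        rw [← Finset.sum_subset (s₁ := Finset.range (K + 1))]
        · simp only [mul_comm]
        · intro a ha
          rw [Finset.mem_range] at ha ⊢
          omega
        · intro a _ ha
          rw [Finset.mem_range] at ha
          rw [hN' a (by omega), map_zero, zero_mul]
      rw [e1, e2]
      ring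

theorem IsMomentSolution.waveRow_mem {m Q P : Matrix ℕ ℕ TSeries} (h : IsMomentSolution m Q P)
    (i : ℕ) : waveRow Q P i ∈ momentSpace m := by
  refine ⟨startsAt_zero_rowZ Q i, ⟨_, IsLower.upTo_rowZ h.mem.lower i⟩,
    ⟨0, startsAt_zero_rowZ _ i⟩, fun b => ?_⟩
  rw [waveRow, ← infMul_apply_eq_zPair, h.infMul_eq]
  exact rowZ_natCast _ _ _

theorem IsMomentSolution.exists_isPfaffTau {m Q P : Matrix ℕ ℕ TSeries}
    (h : IsMomentSolution m Q P) : ∃ τ r, IsPfaffTau Q P τ r :=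
  h.isWaveSpace.exists_isPfaffTau_nat h.mem h.inv h.waveRow_mem

/-! ### The complement of the projection `π_𝐤` -/

section

set_option linter.unusedSectionVars false

variable {ι : Type} [CommSemiring ι] [LinearOrder ι] [Div ι] [Algebra ι ℤ] [IntIndex ι]

theorem skewJ_apply_two_mul (k m : ι) : (skewJ : Matrix ι ι TSeries) k (2 * m) =
    if k = 2 * m + 1 then -1 else 0 := by
  obtain ⟨p, rfl | rfl⟩ := exists_eq_two_mul_or k
  · rw [skewJ_two_mul, if_neg, if_neg]
    · exact fun h => not_even_two_mul_add_one m (h ▸ even_two_mul' p)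
    · exact fun h => not_even_two_mul_add_one p (h ▸ even_two_mul' m)
  · rw [skewJ_two_mul_add_one]
    have : 2 * m = 2 * p ↔ 2 * p + 1 = 2 * m + 1 := by
      constructor
      · exact fun h => by rw [h]
      · intro h
        apply algebraMap_int_injective
        have := congrArg (algebraMap ι ℤ) h
        rw [map_add, map_add] at this
        omega
    simp only [this]

theorem skewJ_apply_two_mul_add_one (k m : ι) : (skewJ : Matrix ι ι TSeries) k (2 * m + 1) =
    if k = 2 * m then 1 else 0 := by
  obtain ⟨p, rfl | rfl⟩ := exists_eq_two_mul_or k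
  · rw [skewJ_two_mul]
    have : 2 * m + 1 = 2 * p + 1 ↔ 2 * p = 2 * m := by
      constructor
      · intro h
        apply algebraMap_int_injective
        have := congrArg (algebraMap ι ℤ) h
        rw [map_add, map_add] at this
        omega
      · exact fun h => by rw [h]
    simp only [this]
  · rw [skewJ_two_mul_add_one, if_neg, if_neg]
    · exact fun h => not_even_two_mul_add_one p (h ▸ even_two_mul' m)
    · exact fun h => not_even_two_mul_add_one m (h ▸ even_two_mul' p)

theorem calJ_apply_even (A : Matrix ι ι TSeries) (i m : ι) :
    calJ A i (2 * m) = -secondQ A i (2 * m + 1) := by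
  rw [calJ, infMul, finsum_eq_single _ (2 * m + 1), skewJ_apply_two_mul, if_pos rfl, mul_neg_one,
    secondQ]
  intro k hk
  rw [skewJ_apply_two_mul, if_neg hk, mul_zero]

theorem calJ_apply_odd (A : Matrix ι ι TSeries) (i m : ι) :
    calJ A i (2 * m + 1) = secondQ A i (2 * m) := by
  rw [calJ, infMul, finsum_eq_single _ (2 * m), skewJ_apply_two_mul_add_one, if_pos rfl, mul_one,
    secondQ]
  intro k hk
  rw [skewJ_apply_two_mul_add_one, if_neg hk, mul_zero]

/-- The weight of the block `(p, m)` of `a` in `a - π_𝐤 a = (a_+ + 𝒥 a_+) + ½ (a_0 + 𝒥 a_0)`. -/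
def blockWeight (p m : ι) : ℂ := if p < m then 1 else if p = m then 1 / 2 else 0

theorem sub_projK_apply (A : Matrix ι ι TSeries) (i j : ι) : (A - projK A) i j =
    (upperPart A i j + (1 / 2 : ℂ) • diagPart A i j) +
      (calJ (upperPart A) i j + (1 / 2 : ℂ) • calJ (diagPart A) i j) := by
  have h : A i j = lowerPart A i j + diagPart A i j + upperPart A i j := by
    rw [lowerPart, diagPart, upperPart]
    rcases lt_trichotomy (i / 2) (j / 2) with h | h | h
    · rw [if_neg h.not_gt, if_neg h.ne, if_pos h]; simp
    · rw [if_neg (by rw [h]; exact lt_irrefl _), if_pos h,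
        if_neg (by rw [h]; exact lt_irrefl _)]; simp
    · rw [if_pos h, if_neg h.ne', if_neg h.not_gt]; simp
  rw [Matrix.sub_apply, projK, Matrix.add_apply, Matrix.sub_apply, Matrix.smul_apply,
    Matrix.sub_apply, h]
  module

theorem upperPart_add_diagPart (A : Matrix ι ι TSeries) (i j : ι) :
    upperPart A i j + (1 / 2 : ℂ) • diagPart A i j = blockWeight (i / 2) (j / 2) • A i j := by
  rw [upperPart, diagPart, blockWeight]
  rcases lt_trichotomy (i / 2) (j / 2) with h | h | h
  · rw [if_pos h, if_neg h.ne, if_pos h]; simp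
  · rw [if_neg (by rw [h]; exact lt_irrefl _), if_pos h, if_neg (by rw [h]; exact lt_irrefl _),
      if_pos h]
    simp
  · rw [if_neg h.not_gt, if_neg h.ne', if_neg h.not_gt, if_neg h.ne']; simp

theorem sub_projK_even_even (A : Matrix ι ι TSeries) (p m : ι) : (A - projK A) (2 * p) (2 * m) =
    blockWeight p m • A (2 * p) (2 * m) - blockWeight m p • A (2 * m + 1) (2 * p + 1) := by
  have h := upperPart_add_diagPart A (2 * m + 1) (2 * p + 1)
  rw [two_mul_add_one_div_two, two_mul_add_one_div_two] at h
  rw [sub_projK_apply, upperPart_add_diagPart, two_mul_div_two, two_mul_div_two, calJ_apply_even,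
    calJ_apply_even, secondQ_two_mul, secondQ_two_mul, ← h]
  module

theorem sub_projK_even_odd (A : Matrix ι ι TSeries) (p m : ι) :
    (A - projK A) (2 * p) (2 * m + 1) =
      blockWeight p m • A (2 * p) (2 * m + 1) + blockWeight m p • A (2 * m) (2 * p + 1) := by
  have h := upperPart_add_diagPart A (2 * m) (2 * p + 1)
  rw [two_mul_add_one_div_two, two_mul_div_two] at h
  rw [sub_projK_apply, upperPart_add_diagPart, two_mul_div_two, two_mul_add_one_div_two,
    calJ_apply_odd, calJ_apply_odd, secondQ_two_mul, secondQ_two_mul, ← h]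

theorem sub_projK_odd_even (A : Matrix ι ι TSeries) (p m : ι) :
    (A - projK A) (2 * p + 1) (2 * m) =
      blockWeight p m • A (2 * p + 1) (2 * m) + blockWeight m p • A (2 * m + 1) (2 * p) := by
  have h := upperPart_add_diagPart A (2 * m + 1) (2 * p)
  rw [two_mul_add_one_div_two, two_mul_div_two] at h
  rw [sub_projK_apply, upperPart_add_diagPart, two_mul_div_two, two_mul_add_one_div_two,
    calJ_apply_even, calJ_apply_even, secondQ_two_mul_add_one, secondQ_two_mul_add_one, ← h,
    neg_neg, neg_neg]

theorem sub_projK_odd_odd (A : Matrix ι ι TSeries) (p m : ι) :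
    (A - projK A) (2 * p + 1) (2 * m + 1) =
      blockWeight p m • A (2 * p + 1) (2 * m + 1) - blockWeight m p • A (2 * m) (2 * p) := by
  have h := upperPart_add_diagPart A (2 * m) (2 * p)
  rw [two_mul_div_two, two_mul_div_two] at h
  rw [sub_projK_apply, upperPart_add_diagPart, two_mul_add_one_div_two, two_mul_add_one_div_two,
    calJ_apply_odd, calJ_apply_odd, secondQ_two_mul_add_one, secondQ_two_mul_add_one, ← h]
  module

theorem blockWeight_eq_zero {p m : ι} (h : m < p) : blockWeight p m = 0 := by
  rw [blockWeight, if_neg h.not_gt, if_neg h.ne']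

end

theorem sub_projK_eq_zero_of_lt {A : Matrix ℤ ℤ TSeries} {d : ℤ} (hd : 0 ≤ d)
    (hA : UpperBand d A) {i j : ℤ} (h : i + (d + 2) < j ∨ j + (d + 2) < i) :
    (A - projK A) i j = 0 := by
  have hz : ∀ i j : ℤ, i + d < j → A i j = 0 := hA
  obtain ⟨p, rfl | rfl⟩ := exists_eq_two_mul_or i <;>
  obtain ⟨m, rfl | rfl⟩ := exists_eq_two_mul_or j <;>
  rcases h with h | h
  all_goals
    first | rw [sub_projK_even_even] | rw [sub_projK_even_odd] | rw [sub_projK_odd_even] |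
      rw [sub_projK_odd_odd]
    first
    | rw [blockWeight_eq_zero (p := m) (m := p) (by omega), zero_smul, hz _ _ (by omega)]
      simp
    | rw [blockWeight_eq_zero (p := p) (m := m) (by omega), zero_smul, hz _ _ (by omega)]
      simp

/-! ### The wave space of a bi-infinite solution -/

theorem rowZ_int (A : Matrix ℤ ℤ TSeries) (i a : ℤ) : rowZ A i a = A i a :=
  rowZ_algebraMap A i a

theorem UpperBand.infMul_assoc {A B C : Matrix ℤ ℤ TSeries} {a b c : ℤ} (hA : UpperBand a A)
    (hB : UpperBand b B) (hC : UpperBand c C) : A ⊡ B ⊡ C = A ⊡ (B ⊡ C) := by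
  ext1 i j
  refine infMul_assoc_apply (Finset.Icc (j - c - b) (i + a)) (Finset.Icc (j - c) (i + a + b))
    fun k l hk hl hj => ?_
  have h1 : k ≤ i + a := hA.le hk
  have h2 : l ≤ k + b := hB.le hl
  have h3 : j ≤ l + c := hC.le hj
  simp only [Finset.mem_Icc]
  omega

theorem upperBand_shiftMat : UpperBand 1 (shiftMat : Matrix ℤ ℤ TSeries) := by
  intro i j h
  rw [shiftMat, if_neg]
  simp at h
  omega

theorem upperBand_laxL {Q P : Matrix ℤ ℤ TSeries} (hQ : InGk Q) (hP : InGk P) :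
    UpperBand 1 (laxL Q P) := by
  have h := (hQ.upperBand.infMul upperBand_shiftMat).infMul hP.upperBand
  rwa [zero_add, add_zero] at h

theorem upperBand_infPow [d : DecidableEq ℤ] {A : Matrix ℤ ℤ TSeries} (hA : UpperBand 1 A)
    (k : ℕ) : UpperBand k (infPow A k) := by
  induction k with
  | zero =>
    intro i j h
    rw [infPow, Matrix.one_apply_ne]
    simp at h
    omega
  | succ k ih =>
    rw [infPow, Nat.cast_add, Nat.cast_one]
    exact ih.infMul hA

theorem infMul_shiftMat_apply (A : Matrix ℤ ℤ TSeries) (i a : ℤ) :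
    (A ⊡ shiftMat) i a = A i (a - 1) := by
  rw [infMul, finsum_eq_single _ (a - 1)]
  · simp [shiftMat]
  · intro l hl
    rw [shiftMat, if_neg (by omega), mul_zero]

theorem laxL_infMul {Q P : Matrix ℤ ℤ TSeries} (hQ : InGk Q) (hP : IsGkInverse Q P) :
    laxL Q P ⊡ Q = Q ⊡ shiftMat := by
  rw [laxL, (hQ.upperBand.infMul upperBand_shiftMat).infMul_assoc hP.mem.upperBand hQ.upperBand,
    hP.inv_mul]
  exact infMul_one _

/-- `L^k Q = Q Λ^k`. -/
theorem infPow_laxL_infMul [d : DecidableEq ℤ] {Q P : Matrix ℤ ℤ TSeries} (hQ : InGk Q)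
    (hP : IsGkInverse Q P) (k : ℕ) (i a : ℤ) :
    (infPow (laxL Q P) k ⊡ Q) i a = Q i (a - k) := by
  have hL := upperBand_laxL hQ hP.mem
  have hLQ := laxL_infMul hQ hP
  induction k generalizing a with
  | zero =>
    rw [infPow, Nat.cast_zero, sub_zero, one_infMul]
  | succ k ih =>
    rw [infPow, (upperBand_infPow hL k).infMul_assoc hL hQ.upperBand, hLQ,
      ← (upperBand_infPow hL k).infMul_assoc hQ.upperBand upperBand_shiftMat,
      infMul_shiftMat_apply, ih]
    congr 1
    push_cast; ring

/-- The flow on the rows of `Q` is multiplication by `X = L^k - π_𝐤 L^k`, a band matrix with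
`𝒥 X = X`; the middle three conditions are this invariance, entry by entry. -/
theorem IsPfaffSolution.pderiv_add_shift {Q P : Matrix ℤ ℤ TSeries} (h : IsPfaffSolution Q P)
    (k : ℕ+) : ∃ X : Matrix ℤ ℤ TSeries,
      (∀ i j : ℤ, (i + (k + 2) < j ∨ j + (k + 2) < i) → X i j = 0) ∧
      (∀ p m, X (2 * p) (2 * m + 1) = X (2 * m) (2 * p + 1)) ∧
      (∀ p m, X (2 * p + 1) (2 * m) = X (2 * m + 1) (2 * p)) ∧
      (∀ p m, X (2 * p + 1) (2 * m + 1) = -X (2 * m) (2 * p)) ∧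
      ∀ i a, pderiv ℂ k (Q i a) + Q i (a - k) =
        ∑ j ∈ Finset.Icc (i - (k + 2)) (i + (k + 2)), X i j * Q j a := by
  obtain ⟨B, hB⟩ : ∃ B, B = infPow (laxL Q P) k := ⟨_, rfl⟩
  have hBand : UpperBand k B := hB ▸ upperBand_infPow (upperBand_laxL h.mem h.inv.mem) k
  have hz := fun i j => sub_projK_eq_zero_of_lt (i := i) (j := j) (by positivity) hBand
  refine ⟨B - projK B, hz, fun p m => ?_, fun p m => ?_, fun p m => ?_, fun i a => ?_⟩
  · rw [sub_projK_even_odd, sub_projK_even_odd, add_comm]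
  · rw [sub_projK_odd_even, sub_projK_odd_even, add_comm]
  · rw [sub_projK_odd_odd, sub_projK_even_even, neg_sub]
  · have h1 : pderiv ℂ k (Q i a) = -(projK B ⊡ Q) i a := by
      rw [hB]
      exact congrFun (congrFun (h.flow k) i) a
    have h2 : (B ⊡ Q) i a = Q i (a - k) := by
      rw [hB]
      exact infPow_laxL_infMul h.mem h.inv k i a
    have h3 : ((B - projK B) ⊡ Q) i a =
        ∑ j ∈ Finset.Icc (i - (k + 2)) (i + (k + 2)), (B - projK B) i j * Q j a := by
      apply finsum_eq_sum_of_support_subset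
      intro j hj
      rw [Function.mem_support] at hj
      rw [Finset.coe_Icc, Set.mem_Icc]
      by_contra hcon
      exact hj (by rw [hz i j (by omega), zero_mul])
    have h4 : (projK B ⊡ Q) i a = (B ⊡ Q) i a - ((B - projK B) ⊡ Q) i a := by
      rw [infMul, infMul, infMul, ← finsum_sub_distrib]
      · refine finsum_congr fun j => ?_
        rw [Matrix.sub_apply]
        ring
      · refine (Set.finite_Icc a (i + k)).subset fun j hj => ?_
        rw [Function.mem_support] at hj
        constructor
        · by_contra hcon
          exact hj (by rw [h.mem.lower j a (not_le.1 hcon), mul_zero])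
        · by_contra hcon
          exact hj (by rw [hBand i j (not_le.1 hcon), zero_mul])
      · refine (Set.finite_Icc (i - (k + 2)) (i + (k + 2))).subset fun j hj => ?_
        rw [Function.mem_support] at hj
        by_contra hcon
        rw [Set.mem_Icc] at hcon
        exact hj (by rw [hz i j (by omega), zero_mul])
    rw [h1, ← h2, ← h3, h4]
    ring

section

variable {ι : Type} [CommSemiring ι] [LinearOrder ι] [Div ι] [Algebra ι ℤ] [IntIndex ι]

theorem skewJ_swap (i j : ι) : (skewJ : Matrix ι ι TSeries) j i = -skewJ i j := by
  obtain ⟨m, rfl | rfl⟩ := exists_eq_two_mul_or j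
  · rw [skewJ_two_mul, skewJ_apply_two_mul]
    split_ifs <;> simp
  · rw [skewJ_two_mul_add_one, skewJ_apply_two_mul_add_one]
    split_ifs <;> simp

/-- The rows of `Q` and `Q_2` are dual up to `J`. -/
theorem IsGkInverse.zPair_waveRow {Q P : Matrix ι ι TSeries} (hP : IsGkInverse Q P) (i j : ι) :
    zPair (waveRow Q P i).1 (waveRow Q P j).2 = -skewJ i j := by
  obtain ⟨m, rfl | rfl⟩ := exists_eq_two_mul_or j
  · rw [waveRow, waveRow, ← rowZ_transpose_odd, ← infMul_apply_eq_zPair, hP.mul_inv,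
      skewJ_apply_two_mul, Matrix.one_apply]
    split_ifs <;> simp
  · have h := infMul_apply_eq_zPair Q P i (2 * m)
    rw [rowZ_transpose_even, hP.mul_inv, Matrix.one_apply] at h
    have h' : zPair (rowZ Q i) (-rowZ (secondQ P) (2 * m + 1)) =
        -zPair (rowZ Q i) (rowZ (secondQ P) (2 * m + 1)) := by
      rw [zPair, zPair, ← finsum_neg_distrib]
      simp only [Pi.neg_apply, mul_neg]
    rw [h'] at h
    rw [skewJ_apply_two_mul_add_one, h, neg_neg]
    rfl

end

section

variable {Q P : Matrix ℤ ℤ TSeries}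

theorem InGk.upTo_waveRow (hQ : InGk Q) (i : ℤ) : UpTo i (waveRow Q P i).1 :=
  IsLower.upTo_rowZ hQ.lower i

theorem InGk.startsAt_waveRow (hP : InGk P) (i : ℤ) : StartsAt (i - 1) (waveRow Q P i).2 := by
  obtain ⟨m, rfl | rfl⟩ := exists_eq_two_mul_or i
  · exact (InGk.startsAt_even hP m).mono (by simp; omega)
  · exact (InGk.startsAt_odd hP m).mono (by simp)

/-- A series in `z` that pairs to zero with all rows of `Q` vanishes, as `Q` is triangular with
invertible diagonal. -/
theorem IsGkInverse.eq_zero_of_zPair (hQ : InGk Q) (hP : IsGkInverse Q P) {N : ℤ}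
    {g : ZSeries ℕ+} (hg : StartsAt N g) (h : ∀ l, zPair (waveRow Q P l).1 g = 0) : g = 0 := by
  have key : ∀ k : ℕ, StartsAt (N + k) g := by
    intro k
    induction k with
    | zero => simpa using hg
    | succ k ih =>
      intro a ha
      by_cases ha' : a < N + k
      · exact ih a ha'
      obtain rfl : a = N + k := by push_cast at ha; omega
      have h1 := h (N + k)
      rw [zPair_eq_antidiagonal (hQ.upTo_waveRow (N + k)) ih 0 (by simp)] at h1
      simp only [Finset.Nat.antidiagonal_zero, Finset.sum_singleton, Nat.cast_zero, sub_zero,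
        add_zero] at h1
      have h2 : (waveRow Q P (N + k)).1 (N + k) = Q (N + k) (N + k) := rowZ_int _ _ _
      rw [h2] at h1
      obtain ⟨m, hm | hm⟩ := exists_eq_two_mul_or (N + (k : ℤ))
      · have := hP.diag_mul hQ m
        rw [hm] at h1 ⊢
        linear_combination P (2 * m) (2 * m) * h1 - g (2 * m) * this
      · have := hP.diag_mul hQ m
        rw [hm, hQ.diag_eq] at h1
        rw [hm]
        linear_combination P (2 * m) (2 * m) * h1 - g (2 * m + 1) * this
  funext a
  exact key (a - N + 1).toNat a (by omega)

/-- The flow of a pair of rows is a finite combination of such pairs. For the rows of `Q` this is the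
Pfaff lattice; the rows of `Q_2` are dual to those of `Q`, and satisfy the same equation because the
coefficient matrix is `𝒥`-invariant. -/
theorem IsPfaffSolution.flowOp_waveRow (h : IsPfaffSolution Q P) (k : ℕ+) :
    ∃ (X : Matrix ℤ ℤ TSeries) (S : ℤ → Finset ℤ), ∀ i,
      flowOp k (waveRow Q P i) = ∑ j ∈ S i, X i j • waveRow Q P j := by
  have hQ := h.mem
  have hP := h.inv
  obtain ⟨X, hz, heo, hoe, hoo, hX⟩ := h.pderiv_add_shift k
  obtain ⟨S, hS⟩ : ∃ S : ℤ → Finset ℤ, S = fun i : ℤ => Finset.Icc (i - (k + 2)) (i + (k + 2)) :=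
    ⟨_, rfl⟩
  have hzS : ∀ i j, j ∉ S i → X i j = 0 := fun i j hj => hz i j (by
    rw [hS, Finset.mem_Icc] at hj
    omega)
  have h1 : ∀ i, (flowOp k (waveRow Q P i)).1 = ∑ j ∈ S i, X i j • (waveRow Q P j).1 := by
    intro i
    funext a
    rw [Finset.sum_apply]
    simp only [flowOp, waveRow, Pi.smul_apply, rowZ_int, smul_eq_mul, hS]
    exact hX i a
  have hst : ∀ i, ∀ j ∈ S i, StartsAt (i - k - 3) (X i j • (waveRow Q P j).2) := by
    intro i j hj
    rw [hS, Finset.mem_Icc] at hj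
    exact ((hP.mem.startsAt_waveRow j).smul _).mono (by omega)
  have hst' : ∀ i, StartsAt (i - k - 3) (∑ j ∈ S i, X i j • (waveRow Q P j).2) := by
    intro i a ha
    rw [Finset.sum_apply]
    exact Finset.sum_eq_zero fun j hj => hst i j hj a ha
  have hd : ∀ i, StartsAt (i - k - 3) fun a => pderiv ℂ k ((waveRow Q P i).2 a) := fun i a ha => by
    simp only [hP.mem.startsAt_waveRow i a (by omega), map_zero]
  have hs : ∀ i, StartsAt (i - k - 3) fun a => (waveRow Q P i).2 (a + k) := fun i a ha =>
    hP.mem.startsAt_waveRow i _ (by omega)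
  have hf2 : ∀ i, (flowOp k (waveRow Q P i)).2 = (fun a => pderiv ℂ k ((waveRow Q P i).2 a)) -
      fun a => (waveRow Q P i).2 (a + k) := fun i => rfl
  have hfs : ∀ i, StartsAt (i - k - 3) (flowOp k (waveRow Q P i)).2 := fun i a ha => by
    have h1 := hd i a ha
    have h2 := hs i a ha
    simp only at h1 h2
    rw [hf2, Pi.sub_apply, h1, h2, sub_zero]
  -- The pairing with `q_l` turns the flow of the second component into that of `q_l`.
  have e1 : ∀ l i, zPair (waveRow Q P l).1 (flowOp k (waveRow Q P i)).2 =
      ∑ j ∈ S l, X l j * skewJ j i := by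
    intro l i
    have hl := hQ.upTo_waveRow (P := P) l
    have hi := hP.mem.startsAt_waveRow (Q := Q) i
    have hdl : UpTo l fun a => pderiv ℂ k ((waveRow Q P l).1 a) := fun a ha => by
      simp only [hl a ha, map_zero]
    have hsl : UpTo (l + k) fun a => (waveRow Q P l).1 (a - k) := fun a ha => hl _ (by omega)
    have hsum : (flowOp k (waveRow Q P l)).1 = (fun a => pderiv ℂ k ((waveRow Q P l).1 a)) +
      fun a => (waveRow Q P l).1 (a - k) := rfl
    have hpd := pderiv_zPair hl hi k
    have hJ : pderiv ℂ k (-(skewJ : Matrix ℤ ℤ TSeries) l i) = 0 := by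
      rw [skewJ]
      split_ifs <;> simp
    rw [hP.zPair_waveRow, hJ] at hpd
    have h2 : zPair (flowOp k (waveRow Q P l)).1 (waveRow Q P i).2 =
        ∑ j ∈ S l, -(X l j * skewJ j i) := by
      rw [h1, zPair_sum_left (N := l + k + 2) hi]
      · refine Finset.sum_congr rfl fun j _ => ?_
        rw [zPair_smul_left (hQ.upTo_waveRow j) hi, hP.zPair_waveRow, mul_neg]
      · intro j hj
        rw [hS, Finset.mem_Icc] at hj
        exact ((hQ.upTo_waveRow j).smul _).mono (by omega)
    rw [hsum, zPair_add_left hdl hsl hi, Finset.sum_neg_distrib] at h2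
    rw [hf2, zPair_sub_right hl (hd i) (hs i), zPair_shift]
    linear_combination -h2 - hpd
  have e2 : ∀ l i, zPair (waveRow Q P l).1 (∑ j ∈ S i, X i j • (waveRow Q P j).2) =
      ∑ j ∈ S i, -(X i j * skewJ l j) := by
    intro l i
    rw [zPair_sum_right (hQ.upTo_waveRow l) _ (hst i)]
    refine Finset.sum_congr rfl fun j _ => ?_
    rw [zPair_smul_right (hQ.upTo_waveRow l) (hP.mem.startsAt_waveRow j), hP.zPair_waveRow, mul_neg]
  have e3 : ∀ l m, ∑ j ∈ S l, X l j * (skewJ : Matrix ℤ ℤ TSeries) j (2 * m) =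
      -X l (2 * m + 1) := by
    intro l m
    rw [Finset.sum_eq_single (2 * m + 1), skewJ_apply_two_mul, if_pos rfl, mul_neg_one]
    · intro j _ hj
      rw [skewJ_apply_two_mul, if_neg hj, mul_zero]
    · intro hj
      rw [hzS _ _ hj, zero_mul]
  have e4 : ∀ l m, ∑ j ∈ S l, X l j * (skewJ : Matrix ℤ ℤ TSeries) j (2 * m + 1) =
      X l (2 * m) := by
    intro l m
    rw [Finset.sum_eq_single (2 * m), skewJ_apply_two_mul_add_one, if_pos rfl, mul_one]
    · intro j _ hj
      rw [skewJ_apply_two_mul_add_one, if_neg hj, mul_zero]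
    · intro hj
      rw [hzS _ _ hj, zero_mul]
  refine ⟨X, S, fun i => ?_⟩
  ext1
  · rw [Prod.fst_sum, h1]
    rfl
  · rw [Prod.snd_sum, ← sub_eq_zero]
    refine hP.eq_zero_of_zPair hQ (N := i - k - 3) (fun a ha => ?_) fun l => ?_
    · rw [Pi.sub_apply, hfs i a ha, Finset.sum_apply, zero_sub, neg_eq_zero]
      exact Finset.sum_eq_zero fun j hj => hst i j hj a ha
    · simp only [Prod.smul_snd]
      rw [zPair_sub_right (hQ.upTo_waveRow l) (hfs i) (hst' i), e1, e2]
      simp only [skewJ_swap (ι := ℤ) _ l, mul_neg, neg_neg]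
      obtain ⟨p, rfl | rfl⟩ := exists_eq_two_mul_or l <;>
      obtain ⟨m, rfl | rfl⟩ := exists_eq_two_mul_or i
      · rw [e3, e3, heo]; ring
      · rw [e3, e4, hoo]; ring
      · rw [e3, e4, hoo]; ring
      · rw [e4, e4, hoe]; ring

end

/-- The module spanned by the rows of `Q` and `Q_2`. -/
def rowSpace (Q P : Matrix ℤ ℤ TSeries) : Submodule TSeries (ZSeries ℕ+ × ZSeries ℕ+) :=
  Submodule.span TSeries (Set.range (waveRow Q P))

theorem waveRow_mem_rowSpace (Q P : Matrix ℤ ℤ TSeries) (i : ℤ) : waveRow Q P i ∈ rowSpace Q P :=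
  Submodule.subset_span ⟨i, rfl⟩

/-- Isotropy holds because the pairings of rows form the skew-symmetric matrix `-J`. -/
theorem IsPfaffSolution.isWaveSpace {Q P : Matrix ℤ ℤ TSeries} (h : IsPfaffSolution Q P) :
    IsWaveSpace (rowSpace Q P) := by
  have hu : ∀ v ∈ rowSpace Q P, ∃ N, UpTo N v.1 := by
    intro v hv
    induction hv using Submodule.span_induction with
    | mem v hv =>
      obtain ⟨i, rfl⟩ := hv
      exact ⟨_, h.mem.upTo_waveRow i⟩
    | zero => exact ⟨0, fun _ _ => rfl⟩
    | add v w _ _ hv hw =>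
      obtain ⟨N, hN⟩ := hv
      obtain ⟨M, hM⟩ := hw
      exact ⟨_, hN.add hM⟩
    | smul c v _ hv =>
      obtain ⟨N, hN⟩ := hv
      exact ⟨N, hN.smul c⟩
  have hs : ∀ v ∈ rowSpace Q P, ∃ N, StartsAt N v.2 := by
    intro v hv
    induction hv using Submodule.span_induction with
    | mem v hv =>
      obtain ⟨i, rfl⟩ := hv
      exact ⟨_, h.inv.mem.startsAt_waveRow i⟩
    | zero => exact ⟨0, fun _ _ => rfl⟩
    | add v w _ _ hv hw =>
      obtain ⟨N, hN⟩ := hv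
      obtain ⟨M, hM⟩ := hw
      exact ⟨_, hN.add hM⟩
    | smul c v _ hv =>
      obtain ⟨N, hN⟩ := hv
      exact ⟨N, hN.smul c⟩
  refine ⟨hu, hs, ?_, ?_⟩
  · have key : ∀ w ∈ rowSpace Q P,
        (∀ i, zPair (waveRow Q P i).1 w.2 + zPair w.1 (waveRow Q P i).2 = 0) →
        ∀ v ∈ rowSpace Q P, zPair v.1 w.2 + zPair w.1 v.2 = 0 := by
      intro w hw hrow v hv
      obtain ⟨_, hw1⟩ := hu w hw
      obtain ⟨_, hw2⟩ := hs w hw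
      induction hv using Submodule.span_induction with
      | mem v hv =>
        obtain ⟨i, rfl⟩ := hv
        exact hrow i
      | zero => simp [zPair]
      | add v v' hv hv' ih ih' =>
        obtain ⟨_, hv1⟩ := hu v hv
        obtain ⟨_, hv2⟩ := hs v hv
        obtain ⟨_, hv1'⟩ := hu v' hv'
        obtain ⟨_, hv2'⟩ := hs v' hv'
        rw [Prod.fst_add, Prod.snd_add, zPair_add_left hv1 hv1' hw2, zPair_add_right hw1 hv2 hv2']
        linear_combination ih + ih'
      | smul c v hv ih =>
        obtain ⟨_, hv1⟩ := hu v hv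
        obtain ⟨_, hv2⟩ := hs v hv
        rw [Prod.smul_fst, Prod.smul_snd, zPair_smul_left hv1 hw2, zPair_smul_right hw1 hv2]
        linear_combination c * ih
    intro v hv w hw
    refine key w hw (fun i => ?_) v hv
    rw [add_comm]
    refine key _ (waveRow_mem_rowSpace Q P i) (fun j => ?_) w hw
    rw [h.inv.zPair_waveRow, h.inv.zPair_waveRow, skewJ_swap i j]
    ring
  · intro v hv k
    obtain ⟨X, S, hX⟩ := h.flowOp_waveRow k
    induction hv using Submodule.span_induction with
    | mem v hv =>
      obtain ⟨i, rfl⟩ := hv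
      rw [hX]
      exact Submodule.sum_mem _ fun j _ => Submodule.smul_mem _ _ (waveRow_mem_rowSpace Q P j)
    | zero => rw [flowOp_zero]; exact Submodule.zero_mem _
    | add v w _ _ hv hw => rw [flowOp_add]; exact Submodule.add_mem _ hv hw
    | smul c v hv ih =>
      rw [flowOp_smul]
      exact Submodule.add_mem _ (Submodule.smul_mem _ _ ih) (Submodule.smul_mem _ _ hv)

theorem IsPfaffSolution.exists_isPfaffTau {Q P : Matrix ℤ ℤ TSeries} (h : IsPfaffSolution Q P) :
    ∃ τ r, IsPfaffTau Q P τ r :=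
  h.isWaveSpace.exists_isPfaffTau_int h.mem h.inv (waveRow_mem_rowSpace Q P)

end

theorem proposition3p1 :
    (∀ m Q P : Matrix ℕ ℕ TSeries, IsMomentSolution m Q P →
      ∃ τ r : ℕ → TSeries, IsPfaffTau Q P τ r) ∧
    (∀ Q P : Matrix ℤ ℤ TSeries, IsPfaffSolution Q P →
      ∃ τ r : ℤ → TSeries, IsPfaffTau Q P τ r) :=
  ⟨fun _ _ _ h => h.exists_isPfaffTau, fun _ _ h => h.exists_isPfaffTau⟩
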